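/- Let $n\ge 2$, let $\eta=\mathrm{diag}(1,1,-1,\dots,-1)$ be indexed by $-1,0,1,\dots,n$, let $\mathcal G_n=\mathfrak{so}(2,n)$ with its basis $M_{ab}$ $(-1\le a<b\le n)$, $M_{ab}=-M_{ba}$, $[M_{ab},M_{cd}]=\eta_{ad}M_{bc}+\eta_{bc}M_{ad}-\eta_{ac}M_{bd}-\eta_{bd}M_{ac}$, and let $\tilde C_n$ be the universal covering group of $SO_0(2,n)$. Let $U$ be a $C_n$-massless representation of $\tilde C_n$ on a complex Hilbert space $\mathcal H$: a nontrivial highest weight, (strongly continuous) unitary, irreducible representation whose restriction to the connected subgroup with Lie algebra $\mathcal P_n=\langle M_{-1,\alpha}+M_{\alpha,n},\ M_{\alpha\beta}:0\le\alpha,\beta\le n-1\rangle$ (the covering of the $n$-Poincaré group) is irreducible. For $X\in\mathcal G_n$ let $U(X)$ denote the generator of $t\mapsto U(\exp tX)$. For $0<\rho\le 1$ let $\mathbf S_\rho$ be the linear operator on $\mathcal G_n$ with $\mathbf S_\rho M_{\alpha\beta}=M_{\alpha\beta}$ and $\mathbf S_\rho M_{-1,\alpha}=\sqrt\rho\,M_{-1,\alpha}$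 $(0\le\alpha,\beta\le n)$, and let $[x,y]_\rho=\mathbf S_\rho^{-1}[\mathbf S_\rho x,\mathbf S_\rho y]$. Let $(\mathbf Z_\rho)_{0<\rho\le1}$ be any family of closed injective operators of $\mathcal H$ with $\mathbf Z_1=1$ and $\mathbf Z_\rho^{-1}U(M_{\alpha\beta})\mathbf Z_\rho=U(M_{\alpha\beta})$ (as unbounded operators) for $0\le\alpha,\beta\le n$, and put $U_\rho(x)=\mathbf Z_\rho^{-1}\,U(\mathbf S_\rho x)\,\mathbf Z_\rho$. Let $T_{n+1}=\mathbb R^{1,n}$, let $\tilde L_{n+1}\subset\tilde C_n$ be the connected subgroup with Lie algebra $\langle M_{\alpha\beta}:0\le\alpha,\beta\le n\rangle$, which covers $L_{n+1}=SO_0(1,n)$, and let $\tilde P_{n+1}=\tilde L_{n+1}\ltimes T_{n+1}$, in whose Lie algebra $M_{-1,\alpha}$ is identified with the generator of the translations along the basis vector $e_\alpha$. Then: 1. $\rho$ is the curvature: for $a,b,c\in\mathbb R^{1,n}$, writing $M_{-1}(a)=\sum_\alpha a^\alpha M_{-1,\alpha}$, the curvature tensor $R(x,y)z=-[[x,y]_\rho,z]_\rho$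 of the homogeneous space $S_{n+1}/L_{n+1}$ satisfies $R(M_{-1}(a),M_{-1}(b))M_{-1}(c)=\rho\,M_{-1}\bigl(\eta(b,c)a-\eta(a,c)b\bigr)$. 2. As $\rho\to0^+$, $[x,y]_\rho$ converges to the bracket of the Poincaré algebra $\mathcal P_{n+1}=\mathfrak{so}(1,n)\ltimes\mathbb R^{1,n}$, for all $x,y$. 3. The space of smooth vectors of $U$ is dense in $\mathcal H$, and for every smooth vector $v$ and every $a\in\mathbb R^{1,n}$, $U_\rho(M_{-1}(a))v$ is defined for all $0<\rho\le1$ and tends to $0$ as $\rho\to0^+$. 4. There is exactly one strongly continuous unitary representation $W$ of $\tilde P_{n+1}$ on $\mathcal H$ (the contracted representation) such that for every smooth vector $v$ of $U$, and every $x$ in $\langle M_{\alpha\beta}:0\le\alpha,\beta\le n\rangle$ or of the form $x=M_{-1}(a)$, $U_\rho(x)v$ is defined for all $0<\rho\le1$ and converges, as $\rho\to0^+$, to $\frac{d}{dt}\big|_{t=0}W(\exp tx)v$; and this $W$ is trivial on $T_{n+1}$. -/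

import Mathlib

noncomputable section

namespace ConfMassless

open Filter Topology
open scoped Matrix ContDiff

attribute [local instance 100] LieRing.ofAssociativeRing

/-! ### The group `SO₀(2,n)` and its Lie algebra

The indices `-1, 0, 1, …, n` of the pseudo-orthonormal basis are represented by
`0, 1, 2, …, n + 1 : Fin (n + 2)`. -/

/-- The diagonal entries of `η`: `1` for the indices `-1, 0` and `-1` for the indices `1, …, n`. -/
def metric (n : ℕ) (a : Fin (n + 2)) : ℝ := if (a : ℕ) < 2 then 1 else -1

/-- The matrix `η = diag(1, 1, -1, …, -1)`. -/
def eta (n : ℕ) : Matrix (Fin (n + 2)) (Fin (n + 2)) ℝ := Matrix.diagonal (metric n)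

/-- The group `O(2,n)`, with the topology of a subgroup of the general linear group. -/
def indefO (n : ℕ) : Subgroup (GL (Fin (n + 2)) ℝ) where
  carrier := {A | (A.val)ᵀ * eta n * A.val = eta n}
  one_mem' := by simp
  mul_mem' := by
    intro A B hA hB
    simp only [Set.mem_ofPred_eq, Units.val_mul, Matrix.transpose_mul] at *
    calc _ = (B.val)ᵀ * ((A.val)ᵀ * eta n * A.val) * B.val := by simp only [Matrix.mul_assoc]
      _ = _ := by rw [hA, hB]
  inv_mem' := by
    intro A hA
    simp only [Set.mem_ofPred_eq] at *
    have h1 : A.val * (A⁻¹).val = 1 := A.mul_inv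
    have h2 : ((A⁻¹).val)ᵀ * (A.val)ᵀ = 1 := by
      rw [← Matrix.transpose_mul, h1, Matrix.transpose_one]
    calc _ = ((A⁻¹).val)ᵀ * ((A.val)ᵀ * eta n * A.val) * (A⁻¹).val := by rw [hA]
      _ = (((A⁻¹).val)ᵀ * (A.val)ᵀ) * eta n * (A.val * (A⁻¹).val) := by
          simp only [Matrix.mul_assoc]
      _ = _ := by rw [h1, h2]; simp

/-- `SO₀(2,n)`, the identity component of `O(2,n)`. -/
abbrev SO0 (n : ℕ) : Subgroup (indefO n) := Subgroup.connectedComponentOfOne (indefO n)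

/-- The matrix of an element of `SO₀(2,n)`. -/
def mat {n : ℕ} (g : SO0 n) : Matrix (Fin (n + 2)) (Fin (n + 2)) ℝ :=
  ((g : indefO n) : GL (Fin (n + 2)) ℝ).val

/-- The Lie algebra `𝒢_n = so(2,n)`. -/
abbrev so (n : ℕ) : LieSubalgebra ℝ (Matrix (Fin (n + 2)) (Fin (n + 2)) ℝ) :=
  skewAdjointMatricesLieSubalgebra (eta n)

theorem mem_so_iff {n : ℕ} (A : Matrix (Fin (n + 2)) (Fin (n + 2)) ℝ) :
    A ∈ so n ↔ Aᵀ * eta n = eta n * (-A) := by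
  rw [mem_skewAdjointMatricesLieSubalgebra, mem_skewAdjointMatricesSubmodule]
  rfl

theorem mem_so_iff_entries {n : ℕ} (A : Matrix (Fin (n + 2)) (Fin (n + 2)) ℝ) :
    A ∈ so n ↔ ∀ c d, A d c * metric n d = -(metric n c * A c d) := by
  rw [mem_so_iff, ← Matrix.ext_iff]
  simp [eta, Matrix.mul_diagonal, Matrix.diagonal_mul]

/-- The generators `M_{ab} = e_a ⊗ e_b^♭ - e_b ⊗ e_a^♭`. They satisfy `M_{ab} = -M_{ba}` and
`[M_{ab}, M_{cd}] = η_{ad} M_{bc} + η_{bc} M_{ad} - η_{ac} M_{bd} - η_{bd} M_{ac}`. -/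
def M {n : ℕ} (a b : Fin (n + 2)) : so n :=
  ⟨Matrix.single a b (metric n b) - Matrix.single b a (metric n a), by
    rw [mem_so_iff_entries]
    intro c d
    simp only [Matrix.sub_apply, Matrix.single_apply]
    by_cases h1 : a = c <;> by_cases h2 : a = d <;> by_cases h3 : b = c <;>
      by_cases h4 : b = d <;> simp [h1, h2, h3, h4] <;> (try subst_vars) <;> simp_all [mul_comm]⟩

theorem exp_mem_indefO {n : ℕ} (X : so n) (t : ℝ) :
    (NormedSpace.exp (t • (X : Matrix (Fin (n + 2)) (Fin (n + 2)) ℝ)))ᵀ * eta n *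
      NormedSpace.exp (t • (X : Matrix (Fin (n + 2)) (Fin (n + 2)) ℝ)) = eta n := by
  have hη : eta n * eta n = 1 := by
    rw [eta, Matrix.diagonal_mul_diagonal, ← Matrix.diagonal_one]
    congr 1
    funext a
    simp only [metric]
    split_ifs <;> norm_num
  have hu : IsUnit (eta n) := IsUnit.of_mul_eq_one _ hη
  have hinv : (eta n)⁻¹ = eta n := Matrix.inv_eq_right_inv hη
  have hX := (mem_so_iff _).1 X.2
  have hc : (t • (X : Matrix (Fin (n + 2)) (Fin (n + 2)) ℝ))ᵀ
      = eta n * (-(t • (X : Matrix (Fin (n + 2)) (Fin (n + 2)) ℝ))) * (eta n)⁻¹ := by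
    rw [hinv, Matrix.transpose_smul, ← smul_neg, Matrix.mul_smul, ← hX, Matrix.smul_mul,
      Matrix.mul_assoc, hη, Matrix.mul_one]
  rw [← Matrix.exp_transpose, hc, Matrix.exp_conj _ _ hu, hinv, Matrix.mul_assoc,
    Matrix.mul_assoc, ← Matrix.mul_assoc (eta n) (eta n), hη, Matrix.one_mul, Matrix.mul_assoc,
    ← Matrix.exp_add_of_commute _ _ (Commute.neg_left (Commute.refl (t • X.1)))]
  simp

/-- `exp(tX)` as an element of `O(2,n)`. -/
def expO {n : ℕ} (X : so n) (t : ℝ) : indefO n :=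
  ⟨{ val := NormedSpace.exp (t • (X : Matrix (Fin (n + 2)) (Fin (n + 2)) ℝ))
     inv := NormedSpace.exp (-(t • (X : Matrix (Fin (n + 2)) (Fin (n + 2)) ℝ)))
     val_inv := by
      rw [← Matrix.exp_add_of_commute _ _ (Commute.neg_right (Commute.refl (t • X.1)))]; simp
     inv_val := by
      rw [← Matrix.exp_add_of_commute _ _ (Commute.neg_left (Commute.refl (t • X.1)))]; simp },
   exp_mem_indefO X t⟩

theorem continuous_matrix_exp {m : ℕ} :
    Continuous (NormedSpace.exp : Matrix (Fin m) (Fin m) ℝ → Matrix (Fin m) (Fin m) ℝ) := by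
  open scoped Matrix.Norms.Operator in
  exact NormedSpace.exp_continuous

theorem continuous_expO {n : ℕ} (X : so n) : Continuous (expO X) := by
  refine Continuous.subtype_mk (Units.continuous_iff.2 ⟨?_, ?_⟩) _
  · exact continuous_matrix_exp.comp (continuous_id.smul continuous_const)
  · exact continuous_matrix_exp.comp (continuous_id.smul continuous_const).neg

theorem expO_zero {n : ℕ} (X : so n) : expO X 0 = 1 := by
  apply Subtype.ext
  apply Units.ext
  simp [expO]

theorem expO_mem {n : ℕ} (X : so n) (t : ℝ) : expO X t ∈ SO0 n := by
  have h : IsPreconnected (Set.range (expO X)) := isPreconnected_range (continuous_expO X)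
  exact h.subset_connectedComponent ⟨0, expO_zero X⟩ ⟨t, rfl⟩

/-- The one-parameter subgroup `t ↦ exp(tX)` of `SO₀(2,n)`. -/
def expSO {n : ℕ} (X : so n) : C(ℝ, SO0 n) :=
  ⟨fun t => ⟨expO X t, expO_mem X t⟩, (continuous_expO X).subtype_mk _⟩

/-! ### The universal covering group

A universal covering group of `SO₀(2,n)` is a simply connected topological group `G` with a
homomorphism `p : G →* SO0 n` that is a covering map. -/

section Cover

variable {n : ℕ} {G : Type*} [Group G] [TopologicalSpace G] {p : G →* SO0 n}

theorem exists_oneParam (hp : IsCoveringMap p) (X : so n) :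
    ∃ γ : C(ℝ, G), γ 0 = 1 ∧ ∀ t, p (γ t) = expSO X t := by
  obtain ⟨γ, ⟨h0, h1⟩, -⟩ := hp.existsUnique_continuousMap_lifts (expSO X) (a₀ := (0 : ℝ))
    (e₀ := (1 : G)) (by
      rw [map_one]
      exact (Subtype.ext (expO_zero X)).symm)
  exact ⟨γ, h0, fun t => congrFun h1 t⟩

/-- The one-parameter subgroup `t ↦ exp(tX)` of the covering group: the unique continuous lift
of `t ↦ exp(tX) ∈ SO₀(2,n)` that starts at `1`. -/
def oneParam (hp : IsCoveringMap p) (X : so n) : C(ℝ, G) := (exists_oneParam hp X).choose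

/-- The connected Lie subgroup of the covering group with Lie algebra `𝔥`: the subgroup generated
by the one-parameter subgroups with generators in `𝔥`. -/
def analyticSubgroup (hp : IsCoveringMap p) (𝔥 : Submodule ℝ (so n)) : Subgroup G :=
  Subgroup.closure {g | ∃ X ∈ 𝔥, ∃ t : ℝ, oneParam hp X t = g}

theorem oneParam_mem (hp : IsCoveringMap p) {𝔥 : Submodule ℝ (so n)} {X : so n} (hX : X ∈ 𝔥)
    (t : ℝ) : oneParam hp X t ∈ analyticSubgroup hp 𝔥 :=
  Subgroup.subset_closure ⟨X, hX, t, rfl⟩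

end Cover

/-- The Poincaré algebra `𝒫_n = 𝓛_n + 𝒯_n ⊆ 𝒢_n`, spanned by the `M_{-1,α} + M_{α,n}` and the
`M_{αβ}` with `0 ≤ α, β ≤ n - 1`. -/
def poincareAlg (n : ℕ) : Submodule ℝ (so n) :=
  Submodule.span ℝ
    ({X | ∃ α : Fin n, X = M 0 α.succ.castSucc + M α.succ.castSucc (Fin.last (n + 1))} ∪
      {X | ∃ α β : Fin n, X = M α.succ.castSucc β.succ.castSucc})

/-- The Lorentz algebra `𝓛_{n+1} ⊆ 𝒢_n`, spanned by the `M_{αβ}` with `0 ≤ α, β ≤ n`. -/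
def lorentzAlg (n : ℕ) : Submodule ℝ (so n) :=
  Submodule.span ℝ {X | ∃ α β : Fin (n + 1), X = M α.succ β.succ}

/-! ### Unitary representations -/

/-- A strongly continuous unitary representation of `G` on the Hilbert space `H`. -/
structure UnitaryRep (G : Type*) [Group G] [TopologicalSpace G] (H : Type*)
    [NormedAddCommGroup H] [InnerProductSpace ℂ H] [CompleteSpace H] where
  toHom : G →* unitary (H →L[ℂ] H)
  continuous_orbit : ∀ v : H, Continuous fun g : G => (toHom g : H →L[ℂ] H) v

section Rep

variable {n : ℕ} {G : Type*} [Group G] [TopologicalSpace G] {p : G →* SO0 n}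
  {H : Type*} [NormedAddCommGroup H] [InnerProductSpace ℂ H] [CompleteSpace H]

/-- The operator `U(g)`. -/
def UnitaryRep.op (U : UnitaryRep G H) (g : G) : H →L[ℂ] H := (U.toHom g : H →L[ℂ] H)

/-- The restriction of `U` to the subgroup `S` is irreducible. -/
def UnitaryRep.IsIrreducibleOn (U : UnitaryRep G H) (S : Subgroup G) : Prop :=
  Nontrivial H ∧ ∀ K : Submodule ℂ H, IsClosed (K : Set H) →
    (∀ g ∈ S, ∀ v ∈ K, U.op g v ∈ K) → K = ⊥ ∨ K = ⊤

/-- The operator `U(X) = dU(X)` for `X ∈ 𝒢_n`: the generator of `t ↦ U(exp(tX))`, defined on all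
vectors at which this one-parameter group is differentiable. -/
def dU (hp : IsCoveringMap p) (U : UnitaryRep G H) (X : so n) : H →ₗ.[ℂ] H where
  domain :=
    { carrier := {v | DifferentiableAt ℝ (fun t : ℝ => U.op (oneParam hp X t) v) 0}
      add_mem' := fun {v w} hv hw => by
        simp only [Set.mem_ofPred_eq, map_add] at *
        exact hv.fun_add hw
      zero_mem' := by simp
      smul_mem' := fun c v hv => by
        simp only [Set.mem_ofPred_eq, map_smul] at *
        exact hv.fun_const_smul c }
  toFun :=
    { toFun := fun v => deriv (fun t : ℝ => U.op (oneParam hp X t) (v : H)) 0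
      map_add' := fun v w => by
        simp only [Submodule.coe_add, map_add]
        exact deriv_fun_add v.2 w.2
      map_smul' := fun c v => by
        simp only [Submodule.coe_smul, map_smul, RingHom.id_apply]
        exact deriv_fun_const_smul c v.2 }

/-- The space of smooth vectors: the orbit map `g ↦ U(g) v` is smooth near `1`, hence everywhere,
read in the chart given by the exponential map, `𝒢_n` being parametrized linearly by the
coefficients of the `M_{ab}`. -/
def smoothVectors (hp : IsCoveringMap p) (U : UnitaryRep G H) : Submodule ℂ H where
  carrier := {v | ContDiffAt ℝ ∞ (fun c : Fin (n + 2) → Fin (n + 2) → ℝ =>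
    U.op (oneParam hp (∑ a, ∑ b, c a b • M a b) 1) v) 0}
  add_mem' := fun {v w} hv hw => by
    simp only [Set.mem_ofPred_eq, map_add] at *
    exact hv.add hw
  zero_mem' := by
    simp only [Set.mem_ofPred_eq, map_zero]
    exact contDiffAt_const
  smul_mem' := fun c v hv => by
    simp only [Set.mem_ofPred_eq, map_smul] at *
    exact hv.const_smul c

/-- The isotropic vectors `e_{2j} + σ i e_{2j+1}` of `ℂ^{n+2}` (in the numbering `0, …, n + 1`);
for `n` odd and `2j = n + 1` this is the last basis vector. With `f_j^± = isoVec n j (±1)`, the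
bivectors `f_j^+ ∧ f_k^±` (`j < k`) and, for `n` odd, `f_j^+ ∧ e_{n+1}` are root vectors for the
positive roots `e_j ± e_k` and `e_j`. -/
def isoVec (n j : ℕ) (σ : ℂ) (a : Fin (n + 2)) : ℂ :=
  if (a : ℕ) = 2 * j then 1 else if (a : ℕ) = 2 * j + 1 then σ * Complex.I else 0

/-- The action on a smooth vector `v` of the element `f ∧ g = ∑ f_a g_b M_{ab}` of the
complexification of `𝒢_n`. -/
def wedgeAct (hp : IsCoveringMap p) (U : UnitaryRep G H) (f g : Fin (n + 2) → ℂ) (v : H) : H :=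
  ∑ a, ∑ b, (f a * g b) • deriv (fun t : ℝ => U.op (oneParam hp (M a b) t) v) 0

/-- `v` is a highest weight vector: a nonzero smooth vector, an eigenvector of the Cartan
subalgebra spanned by `M_{-1,0}, M_{1,2}, M_{3,4}, …`, and annihilated by all positive
root vectors. -/
structure IsHighestWeightVector (hp : IsCoveringMap p) (U : UnitaryRep G H) (v : H) : Prop where
  smooth : v ∈ smoothVectors hp U
  ne_zero : v ≠ 0
  weight : ∀ (j : ℕ) (hj : 2 * j + 1 < n + 2), ∃ c : ℂ,
    deriv (fun t : ℝ =>
      U.op (oneParam hp (M (n := n) ⟨2 * j, by omega⟩ ⟨2 * j + 1, hj⟩) t) v) 0 = c • v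
  annihilated : ∀ j k : ℕ, j < k → 2 * k < n + 2 → ∀ σ : ℂ, σ = 1 ∨ σ = -1 →
    wedgeAct hp U (isoVec n j 1) (isoVec n k σ) v = 0

/-- `U` is a highest weight representation: it is generated by a highest weight vector. -/
def IsHighestWeight (hp : IsCoveringMap p) (U : UnitaryRep G H) : Prop :=
  ∃ v, IsHighestWeightVector hp U v ∧
    Dense (Submodule.span ℂ (Set.range fun g : G => U.op g v) : Set H)

/-- `U` is `C_n`-massless: a nontrivial highest weight unitary representation that is irreducible
and remains irreducible on the (covering of the) Poincaré group `P_n`. -/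
structure IsCnMassless (hp : IsCoveringMap p) (U : UnitaryRep G H) : Prop where
  nontrivial : ∃ g, U.op g ≠ 1
  highestWeight : IsHighestWeight hp U
  irreducible : U.IsIrreducibleOn ⊤
  irreducible_poincare : U.IsIrreducibleOn (analyticSubgroup hp (poincareAlg n))

end Rep

/-! ### The contraction of the Lie algebra -/

/-- The linear operator on the vector space of `𝒢_n` with `M_{αβ} ↦ M_{αβ}` and
`M_{-1,α} ↦ s M_{-1,α}` for `0 ≤ α, β ≤ n`. -/
def rescale {n : ℕ} (s : ℝ) : so n →ₗ[ℝ] so n where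
  toFun X := ⟨Matrix.of fun c d => (if c = 0 ∨ d = 0 then s else 1) * X.1 c d, by
    have hX := (mem_so_iff_entries _).1 X.2
    rw [mem_so_iff_entries]
    intro c d
    simp only [Matrix.of_apply, or_comm (a := d = 0)]
    linear_combination (if c = 0 ∨ d = 0 then s else 1) * hX c d⟩
  map_add' X Y := by
    apply Subtype.ext
    ext c d
    simp [mul_add]
  map_smul' r X := by
    apply Subtype.ext
    ext c d
    simp [mul_left_comm]

/-- The contraction operator `S_ρ`. -/
def S {n : ℕ} (ρ : ℝ) : so n →ₗ[ℝ] so n := rescale (Real.sqrt ρ)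

/-- The bracket `[X,Y]_ρ = S_ρ⁻¹ [S_ρ X, S_ρ Y]` of `𝒢_n^ρ`. -/
def bracketρ {n : ℕ} (ρ : ℝ) (X Y : so n) : so n := rescale (Real.sqrt ρ)⁻¹ ⁅S ρ X, S ρ Y⁆

/-- The component in `𝓛_{n+1} = so(1,n)` of `X = A + ∑ a_α M_{-1,α}`, as an
`(n+1) × (n+1)` matrix. -/
def linPart {n : ℕ} (X : so n) : Matrix (Fin (n + 1)) (Fin (n + 1)) ℝ :=
  X.1.submatrix Fin.succ Fin.succ

/-- The coefficients `a_α` of the `M_{-1,α}` in `X`. -/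
def transPart {n : ℕ} (X : so n) : Fin (n + 1) → ℝ := fun α => -(X.1 α.succ 0)

/-- The element `∑ a_α M_{-1,α}`. -/
def translGen {n : ℕ} (a : Fin (n + 1) → ℝ) : so n := ∑ α : Fin (n + 1), a α • M 0 α.succ

/-- The Minkowski form `η_{αβ} a^α b^β`, `0 ≤ α, β ≤ n`, on `ℝ^{1,n}`. -/
def minkowski {n : ℕ} (a b : Fin (n + 1) → ℝ) : ℝ := ∑ α, metric n α.succ * a α * b α

/-! ### The covering of the Poincaré group `P_{n+1} = L_{n+1} ⋉ T_{n+1}` -/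

section Poincare

variable {n : ℕ} {G : Type*} [Group G] [TopologicalSpace G] {p : G →* SO0 n}

/-- The covering `L̃_{n+1}` of the Lorentz group `L_{n+1} = SO₀(1,n)`: the connected Lie subgroup
of the covering of `SO₀(2,n)` with Lie algebra `𝓛_{n+1}`. -/
abbrev LorentzCover (hp : IsCoveringMap p) : Subgroup G := analyticSubgroup hp (lorentzAlg n)

theorem lorentzAlg_col {X : so n} (hX : X ∈ lorentzAlg n) (c : Fin (n + 2)) : X.1 c 0 = 0 := by
  induction hX using Submodule.span_induction with
  | mem X hX =>
    obtain ⟨α, β, rfl⟩ := hX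
    simp [M]
  | zero => simp
  | add X Y _ _ hX hY => simp [hX, hY]
  | smul r X _ hX => simp [hX]

theorem exp_mulVec_eq {m : ℕ} (A : Matrix (Fin m) (Fin m) ℝ) (v : Fin m → ℝ)
    (h : A *ᵥ v = 0) : NormedSpace.exp A *ᵥ v = v := by
  open scoped Matrix.Norms.Operator in
  have hs := NormedSpace.exp_series_hasSum_exp' (𝕂 := ℝ) A
  have hc : Continuous fun B : Matrix (Fin m) (Fin m) ℝ => B *ᵥ v :=
    continuous_id.matrix_mulVec continuous_const
  have h1 := hs.map (Matrix.mulVecBilin ℝ ℝ |>.flip v) (by exact hc)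
  have h2 : HasSum (⇑((Matrix.mulVecBilin ℝ ℝ).flip v) ∘
      fun k : ℕ => ((Nat.factorial k : ℝ))⁻¹ • A ^ k) v := by
    convert! hasSum_ite_eq 0 v using 1
    funext k
    rcases k with _ | k
    · simp
    · simp only [Function.comp_apply, LinearMap.flip_apply, Matrix.mulVecBilin_apply, pow_succ,
        Matrix.smul_mulVec, ← Matrix.mulVec_mulVec, h]
      simp
  exact h1.unique h2

theorem lorentz_col (hp : IsCoveringMap p) {g : G} (hg : g ∈ LorentzCover hp) :
    mat (p g) *ᵥ Pi.single 0 1 = Pi.single 0 1 := by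
  induction hg using Subgroup.closure_induction with
  | mem g hg =>
    obtain ⟨X, hX, t, rfl⟩ := hg
    rw [oneParam, (exists_oneParam hp X).choose_spec.2 t]
    apply exp_mulVec_eq
    ext c
    simp [lorentzAlg_col hX]
  | one =>
    have h1 : mat (p 1) = 1 := by simp [mat]
    rw [h1, Matrix.one_mulVec]
  | mul g h _ _ ihg ihh =>
    have : mat (p (g * h)) = mat (p g) * mat (p h) := by simp [mat]
    rw [this, ← Matrix.mulVec_mulVec, ihh, ihg]
  | inv g _ ih =>
    have h1 : mat (p g⁻¹) * mat (p g) = 1 := by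
      have : mat (p (g⁻¹ * g)) = mat (p g⁻¹) * mat (p g) := by
        rw [map_mul]; rfl
      rw [← this, inv_mul_cancel, map_one]; rfl
    calc _ = mat (p g⁻¹) *ᵥ (mat (p g) *ᵥ Pi.single 0 1) := by rw [ih]
      _ = _ := by rw [Matrix.mulVec_mulVec, h1, Matrix.one_mulVec]

/-- The matrix of `g ∈ L̃_{n+1}` acting on `ℝ^{1,n}`, the span of `e_0, …, e_n`. -/
def lorentzMat (hp : IsCoveringMap p) :
    LorentzCover hp →* Matrix (Fin (n + 1)) (Fin (n + 1)) ℝ where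
  toFun g := (mat (p g)).submatrix Fin.succ Fin.succ
  map_one' := by
    have : mat (p ((1 : LorentzCover hp) : G)) = 1 := by simp [mat]
    rw [this]
    exact Matrix.submatrix_one _ (Fin.succ_injective _)
  map_mul' g h := by
    have hm : mat (p ((g * h : LorentzCover hp) : G)) = mat (p g) * mat (p h) := by simp [mat]
    have hz : ∀ α : Fin (n + 1), mat (p g) α.succ 0 = 0 := fun α => by
      have := congrFun (lorentz_col hp g.2) α.succ
      simpa using this
    rw [hm]
    ext α β
    simp [Matrix.mul_apply, Fin.sum_univ_succ (n := n + 1), hz]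

/-- The action of `L̃_{n+1}` on the translation group `T_{n+1} = ℝ^{1,n}`. -/
def lorentzAct (hp : IsCoveringMap p) :
    LorentzCover hp →* MulAut (Multiplicative (Fin (n + 1) → ℝ)) where
  toFun g := AddEquiv.toMultiplicative
    { toFun := fun a => lorentzMat hp g *ᵥ a
      invFun := fun a => lorentzMat hp g⁻¹ *ᵥ a
      left_inv := fun a => by simp [Matrix.mulVec_mulVec, ← map_mul]
      right_inv := fun a => by simp [Matrix.mulVec_mulVec, ← map_mul]
      map_add' := fun a b => Matrix.mulVec_add _ _ _ }
  map_one' := by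
    ext a : 1
    apply Multiplicative.toAdd.injective
    simp
  map_mul' g h := by
    ext a : 1
    apply Multiplicative.toAdd.injective
    simp [Matrix.mulVec_mulVec]

/-- The covering `P̃_{n+1} = T_{n+1} ⋊ L̃_{n+1}` of the Poincaré group. -/
abbrev PoincareCover (hp : IsCoveringMap p) : Type _ :=
  Multiplicative (Fin (n + 1) → ℝ) ⋊[lorentzAct hp] (LorentzCover hp)

/-- The product topology on `P̃_{n+1}`. -/
instance poincareTopology (hp : IsCoveringMap p) : TopologicalSpace (PoincareCover hp) :=
  TopologicalSpace.induced (fun x => (Multiplicative.toAdd x.left, x.right)) inferInstance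

/-- The translation by `a`, as an element of `P̃_{n+1}`. -/
def transl (hp : IsCoveringMap p) (a : Fin (n + 1) → ℝ) : PoincareCover hp :=
  SemidirectProduct.inl (Multiplicative.ofAdd a)

/-- An element of `L̃_{n+1}`, as an element of `P̃_{n+1}`. -/
def lorentzIncl (hp : IsCoveringMap p) (g : LorentzCover hp) : PoincareCover hp :=
  SemidirectProduct.inr g

end Poincare

/-! ### The contraction of representations -/

section Contraction

variable {n : ℕ} {G : Type*} [Group G] [TopologicalSpace G] {p : G →* SO0 n}
  {H : Type*} [NormedAddCommGroup H] [InnerProductSpace ℂ H] [CompleteSpace H]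

/-- The graph of the (possibly unbounded) operator `Z⁻¹ ∘ A ∘ Z` with its natural domain. -/
def conjGraph (Z A : H →ₗ.[ℂ] H) : Set (H × H) :=
  {x | ∃ v w : H, (x.1, v) ∈ Z.graph ∧ (v, w) ∈ A.graph ∧ (x.2, w) ∈ Z.graph}

/-- A family `(Z_ρ)`, `0 < ρ ≤ 1`, of closed invertible operators of `H` with `Z_1 = 1` and
`Z_ρ⁻¹ U(M_{αβ}) Z_ρ = U(M_{αβ})` for `0 ≤ α, β ≤ n`. Invertibility is only used in the weak
sense that `Z_ρ` is injective, and no continuity in `ρ` is required. -/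
structure IsContractionFamily (hp : IsCoveringMap p) (U : UnitaryRep G H)
    (Z : ℝ → H →ₗ.[ℂ] H) : Prop where
  closed : ∀ ρ ∈ Set.Ioc (0 : ℝ) 1, (Z ρ).IsClosed
  injective : ∀ ρ ∈ Set.Ioc (0 : ℝ) 1, Function.Injective (Z ρ)
  one : ∀ v : H, (v, v) ∈ (Z 1).graph
  commutes : ∀ ρ ∈ Set.Ioc (0 : ℝ) 1, ∀ α β : Fin (n + 1),
    conjGraph (Z ρ) (dU hp U (M α.succ β.succ)) = ((dU hp U (M α.succ β.succ)).graph : Set (H × H))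

/-- The graph of the operator `U_ρ(X) = Z_ρ⁻¹ ∘ U(S_ρ X) ∘ Z_ρ`. -/
def Uρ (hp : IsCoveringMap p) (U : UnitaryRep G H) (Z : ℝ → H →ₗ.[ℂ] H) (ρ : ℝ) (X : so n) :
    Set (H × H) :=
  conjGraph (Z ρ) (dU hp U (S ρ X))

/-- On the vector `v` the operators `U_ρ(X)`, `0 < ρ ≤ 1`, are all defined and
`U_ρ(X) v → w` as `ρ → 0`. -/
def TendsToAt (hp : IsCoveringMap p) (U : UnitaryRep G H) (Z : ℝ → H →ₗ.[ℂ] H) (X : so n)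
    (v w : H) : Prop :=
  ∃ u : ℝ → H, (∀ ρ ∈ Set.Ioc (0 : ℝ) 1, (v, u ρ) ∈ Uρ hp U Z ρ X) ∧
    Tendsto u (𝓝[>] 0) (𝓝 w)

/-- `W` is the contracted representation: a unitary representation of `P̃_{n+1}` whose
differential is, on the smooth vectors of `U`, the limit of the `U_ρ` as `ρ → 0`, where
`M_{αβ}` corresponds to the Lorentz generators of the Poincaré group and `M_{-1,α}` to the
translations. -/
structure IsContraction (hp : IsCoveringMap p) (U : UnitaryRep G H) (Z : ℝ → H →ₗ.[ℂ] H)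
    (W : UnitaryRep (PoincareCover hp) H) : Prop where
  lorentz : ∀ v ∈ smoothVectors hp U, ∀ (X : so n) (hX : X ∈ lorentzAlg n), ∃ w : H,
    TendsToAt hp U Z X v w ∧
    HasDerivAt (fun t : ℝ => W.op (lorentzIncl hp ⟨oneParam hp X t, oneParam_mem hp hX t⟩) v) w 0
  translation : ∀ v ∈ smoothVectors hp U, ∀ a : Fin (n + 1) → ℝ, ∃ w : H,
    TendsToAt hp U Z (translGen a) v w ∧
    HasDerivAt (fun t : ℝ => W.op (transl hp (t • a)) v) w 0

end Contraction

end ConfMassless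

end

open ConfMassless Filter Topology
open scoped Matrix

/-!
By Gårding's argument the vectors of class `C^∞` are dense, so that operators may be compared
through their commutators with the Lie algebra. Since `U` is irreducible on the Poincaré group, a
version of Schur's lemma for symmetric quadratic operators makes the symmetric tensor
`∑_c η_{cc} (M_{ac} M_{cb} + M_{bc} M_{ca})` a scalar multiple of `η_{ab}`. These quadratic
relations express the square of the compact generator `M_{-1,0}` through the Lorentz algebra, and,
together with the ladder operators and the highest weight vector, they confine the weights of
`M_{-1,0}` to one half-line, on which a weight is determined by its square. Hence a bounded operator
that commutes with the Lorentz algebra commutes with `M_{-1,0}` too, therefore with all of `𝒢_n`,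
and is a scalar: `U` is irreducible already on the Lorentz group. Each `Z_ρ` is then a nonzero
scalar, so that `U_ρ(M_{-1}(a)) = √ρ U(M_{-1}(a))` tends to zero and the contraction is trivial on
the translations.
-/

noncomputable section

namespace ConfMassless

open Filter Topology
open scoped Matrix ContDiff

attribute [local instance 100] LieRing.ofAssociativeRing

/-! ### The Lie algebra `so(2,n)` -/

section LieAlgebra

variable {n : ℕ}

theorem metric_mul_self (a : Fin (n + 2)) : metric n a * metric n a = 1 := by
  simp only [metric]; split_ifs <;> norm_num

theorem metric_zero : metric n 0 = 1 := by simp [metric]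

theorem metric_one : metric n 1 = 1 := by simp [metric]

theorem metric_of_two_le {a : Fin (n + 2)} (h : 2 ≤ (a : ℕ)) : metric n a = -1 := by
  simp [metric, not_lt.2 h]

theorem eta_apply (a b : Fin (n + 2)) : eta n a b = if a = b then metric n a else 0 := by
  simp [eta, Matrix.diagonal_apply]

theorem eta_ne {a b : Fin (n + 2)} (h : a ≠ b) : eta n a b = 0 := by simp [eta_apply, h]

theorem eta_self (a : Fin (n + 2)) : eta n a a = metric n a := by simp [eta_apply]

theorem eta_comm (a b : Fin (n + 2)) : eta n a b = eta n b a := by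
  by_cases h : a = b
  · rw [h]
  · rw [eta_ne h, eta_ne (Ne.symm h)]

theorem M_apply (a b c d : Fin (n + 2)) :
    (M a b : so n).1 c d = (if a = c then eta n b d else 0) - (if b = c then eta n a d else 0) := by
  simp only [M, Matrix.sub_apply, Matrix.single_apply, eta_apply, ite_and]

theorem M_swap (a b : Fin (n + 2)) : (M b a : so n) = -M a b := by
  apply Subtype.ext
  simp [M]

theorem M_self (a : Fin (n + 2)) : (M a a : so n) = 0 := by
  apply Subtype.ext
  simp [M]

theorem coe_bracket (X Y : so n) : (⁅X, Y⁆ : so n).1 = X.1 * Y.1 - Y.1 * X.1 := rfl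

theorem single_metric_mul_single_metric (a b c d : Fin (n + 2)) :
    Matrix.single a b (metric n b) * Matrix.single c d (metric n d) =
      eta n b c • Matrix.single a d (metric n d) := by
  obtain rfl | h := eq_or_ne b c
  · rw [Matrix.single_mul_single_same, eta_self, Matrix.smul_single, smul_eq_mul]
  · rw [Matrix.single_mul_single_of_ne _ _ _ _ h, eta_ne h, zero_smul]

theorem M_bracket (a b c d : Fin (n + 2)) :
    ⁅(M a b : so n), M c d⁆ = eta n a d • M b c + eta n b c • M a d - eta n a c • M b d
      - eta n b d • M a c := by
  apply Subtype.ext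
  rw [coe_bracket]
  simp only [M, AddSubgroupClass.coe_sub, AddMemClass.coe_add, SetLike.val_smul, mul_sub,
    sub_mul, single_metric_mul_single_metric, eta_comm d a, eta_comm d b,
    eta_comm c a, eta_comm c b]
  module

/-- The antisymmetric coordinates of an element of `so(2,n)` with respect to the spanning family
`M_{ab}`, in which each pair `{a, b}` is counted twice. -/
def coef : so n →ₗ[ℝ] (Fin (n + 2) → Fin (n + 2) → ℝ) where
  toFun X a b := metric n b * X.1 a b / 2
  map_add' X Y := by ext a b; simp [mul_add, add_div]
  map_smul' r X := by ext a b; simp; ring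

/-- The element `∑ c_{ab} M_{ab}` of `so(2,n)`, as a linear function of the matrix `c`. -/
def ofCoef : (Fin (n + 2) → Fin (n + 2) → ℝ) →ₗ[ℝ] so n where
  toFun c := ∑ a, ∑ b, c a b • M a b
  map_add' c d := by simp [add_smul, Finset.sum_add_distrib]
  map_smul' r c := by simp [mul_smul, Finset.smul_sum]

theorem ofCoef_apply (c : Fin (n + 2) → Fin (n + 2) → ℝ) :
    (ofCoef c : so n) = ∑ a, ∑ b, c a b • M a b := rfl

theorem coe_ofCoef (c : Fin (n + 2) → Fin (n + 2) → ℝ) (i j : Fin (n + 2)) :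
    (ofCoef c : so n).1 i j = metric n j * (c i j - c j i) := by
  rw [ofCoef_apply]
  simp only [AddSubmonoidClass.coe_finsetSum, Matrix.sum_apply, SetLike.val_smul,
    Matrix.smul_apply, M_apply, smul_eq_mul, mul_sub, Finset.sum_sub_distrib, mul_ite, mul_zero,
    eta_apply]
  simp
  ring

theorem ofCoef_coef (X : so n) : ofCoef (coef X) = X := by
  apply Subtype.ext
  ext i j
  have h := (mem_so_iff_entries _).1 X.2 i j
  rw [coe_ofCoef]
  simp only [coef, LinearMap.coe_mk, AddHom.coe_mk]
  have h1 := metric_mul_self i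
  have h2 := metric_mul_self j
  linear_combination (X.1 i j / 2) * h2 - (metric n i / 2) * h + (X.1 i j / 2) * h1

theorem eq_sum_coef (X : so n) : X = ∑ a, ∑ b, coef X a b • M a b := by
  rw [← ofCoef_apply, ofCoef_coef]

theorem linearMap_eq_sum_coef {V : Type*} [AddCommGroup V] [Module ℝ V] (L : so n →ₗ[ℝ] V)
    (X : so n) : L X = ∑ a, ∑ b, coef X a b • L (M a b) := by
  conv_lhs => rw [← ofCoef_coef X, ofCoef_apply]
  simp only [map_sum, map_smul]

end LieAlgebra

/-! ### The contracted brackets -/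

section Bracket

variable {n : ℕ}

theorem linPart_neg (X : so n) : linPart (-X) = -linPart X := rfl

theorem linPart_smul (r : ℝ) (X : so n) : linPart (r • X) = r • linPart X := rfl

theorem transPart_neg (X : so n) : transPart (-X) = -transPart X := rfl

theorem transPart_smul (r : ℝ) (X : so n) : transPart (r • X) = r • transPart X := by
  ext α
  simp [transPart]

theorem so_apply_zero_zero (X : so n) : X.1 0 0 = 0 := by
  have h := (mem_so_iff_entries _).1 X.2 0 0
  rw [metric_zero] at h
  linarith

theorem so_apply_succ_zero (X : so n) (α : Fin (n + 1)) : X.1 α.succ 0 = -transPart X α :=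
  (neg_neg _).symm

theorem so_apply_zero_succ (X : so n) (α : Fin (n + 1)) :
    X.1 0 α.succ = transPart X α * metric n α.succ := by
  have h := (mem_so_iff_entries _).1 X.2 0 α.succ
  rw [metric_zero] at h
  simp only [transPart]
  linarith

theorem so_ext {X Y : so n} (hl : linPart X = linPart Y) (ht : transPart X = transPart Y) :
    X = Y := by
  apply Subtype.ext
  ext c d
  refine Fin.cases ?_ (fun α => ?_) c <;> refine Fin.cases ?_ (fun β => ?_) d
  · rw [so_apply_zero_zero, so_apply_zero_zero]
  · rw [so_apply_zero_succ, so_apply_zero_succ, ht]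
  · exact neg_injective (congrFun ht α)
  · exact congrFun (congrFun hl α) β

theorem transPart_bracketρ {ρ : ℝ} (hρ : 0 < ρ) (X Y : so n) :
    transPart (bracketρ ρ X Y) = linPart X *ᵥ transPart Y - linPart Y *ᵥ transPart X := by
  have hs : Real.sqrt ρ ≠ 0 := (Real.sqrt_pos.2 hρ).ne'
  ext α
  simp only [transPart, bracketρ, rescale, S, LinearMap.coe_mk, AddHom.coe_mk, coe_bracket,
    Matrix.of_apply, or_true, if_true, Matrix.sub_apply, Matrix.mul_apply, Pi.sub_apply,
    Fin.sum_univ_succ (n := n + 1), true_or, Fin.succ_ne_zero, or_self, if_false,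
    so_apply_zero_zero, Matrix.mulVec, dotProduct, linPart, Matrix.submatrix_apply, mul_zero,
    zero_add, one_mul, mul_neg, Finset.sum_neg_distrib]
  simp only [mul_left_comm _ (Real.sqrt ρ), ← Finset.mul_sum, ← mul_sub]
  rw [mul_inv_cancel_left₀ hs]
  ring

theorem linPart_bracketρ {ρ : ℝ} (hρ : 0 ≤ ρ) (X Y : so n) :
    linPart (bracketρ ρ X Y) = linPart X * linPart Y - linPart Y * linPart X
      - ρ • Matrix.of fun α β => (transPart X α * transPart Y β - transPart Y α * transPart X β) *
        metric n β.succ := by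
  ext α β
  have hs : Real.sqrt ρ * Real.sqrt ρ = ρ := Real.mul_self_sqrt hρ
  simp only [linPart, bracketρ, rescale, S, LinearMap.coe_mk, AddHom.coe_mk, coe_bracket,
    Matrix.of_apply, or_true, if_true, Matrix.sub_apply, Matrix.mul_apply, Matrix.smul_apply,
    Fin.sum_univ_succ (n := n + 1), true_or, Fin.succ_ne_zero, or_self, if_false,
    so_apply_zero_succ, so_apply_succ_zero, Matrix.submatrix_apply, one_mul, smul_eq_mul]
  linear_combination (-(transPart X α * (transPart Y β * metric n β.succ)) +
    (transPart Y α * (transPart X β * metric n β.succ))) * hs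

theorem linPart_translGen (a : Fin (n + 1) → ℝ) : linPart (translGen a : so n) = 0 := by
  ext α β
  simp [linPart, translGen, Matrix.sum_apply, M_apply, eta_apply,
    (Fin.succ_ne_zero _).symm]

theorem transPart_translGen (a : Fin (n + 1) → ℝ) : transPart (translGen a : so n) = a := by
  ext α
  simp [transPart, translGen, Matrix.sum_apply, M_apply, eta_apply,
    (Fin.succ_ne_zero _).symm, metric_zero]

theorem curvature_bracketρ {ρ : ℝ} (hρ : 0 < ρ) (a b c : Fin (n + 1) → ℝ) :
    -bracketρ ρ (bracketρ ρ (translGen a) (translGen b)) (translGen c) =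
      (ρ • translGen (minkowski b c • a - minkowski a c • b) : so n) := by
  apply so_ext
  · simp only [linPart_neg, linPart_smul, linPart_bracketρ hρ.le, linPart_translGen,
      transPart_bracketρ hρ]
    ext α β
    simp
  · simp only [transPart_neg, transPart_smul, transPart_bracketρ hρ, linPart_bracketρ hρ.le,
      linPart_translGen, transPart_translGen]
    ext α
    simp only [Pi.neg_apply, Pi.sub_apply, Pi.smul_apply, Matrix.mulVec, dotProduct,
      Matrix.zero_apply, mul_zero, zero_mul, sub_zero, zero_sub, Matrix.neg_apply,
      Matrix.smul_apply, Matrix.of_apply, smul_eq_mul, Finset.sum_const_zero,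
      minkowski]
    rw [← Finset.sum_neg_distrib, Finset.sum_mul, Finset.sum_mul, ← Finset.sum_sub_distrib,
      Finset.mul_sum]
    exact Finset.sum_congr rfl fun β _ => by ring

theorem tendsto_linPart_bracketρ (X Y : so n) :
    Tendsto (fun ρ : ℝ => linPart (bracketρ ρ X Y)) (𝓝[>] 0)
      (𝓝 (linPart X * linPart Y - linPart Y * linPart X)) := by
  set C : Matrix (Fin (n + 1)) (Fin (n + 1)) ℝ := Matrix.of fun α β =>
    (transPart X α * transPart Y β - transPart Y α * transPart X β) * metric n β.succ
  have hc : Continuous fun ρ : ℝ => linPart X * linPart Y - linPart Y * linPart X - ρ • C :=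
    continuous_const.sub (continuous_id.smul continuous_const)
  have h := (hc.tendsto 0).mono_left (nhdsWithin_le_nhds (s := Set.Ioi 0))
  rw [zero_smul, sub_zero] at h
  refine h.congr' ?_
  filter_upwards [self_mem_nhdsWithin] with ρ (hρ : 0 < ρ)
  exact (linPart_bracketρ hρ.le X Y).symm

theorem tendsto_transPart_bracketρ (X Y : so n) :
    Tendsto (fun ρ : ℝ => transPart (bracketρ ρ X Y)) (𝓝[>] 0)
      (𝓝 (linPart X *ᵥ transPart Y - linPart Y *ᵥ transPart X)) := by
  refine tendsto_const_nhds.congr' ?_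
  filter_upwards [self_mem_nhdsWithin] with ρ hρ
  exact (transPart_bracketρ hρ X Y).symm

theorem S_of_mem_lorentzAlg (ρ : ℝ) {X : so n} (hX : X ∈ lorentzAlg n) : S ρ X = X := by
  have h0 := lorentzAlg_col hX
  apply so_ext
  · ext α β
    simp [linPart, S, rescale]
  · ext α
    simp [transPart, S, rescale, h0]

theorem S_translGen (ρ : ℝ) (a : Fin (n + 1) → ℝ) :
    S ρ (translGen a) = (Real.sqrt ρ • translGen a : so n) := by
  have h0 : ∀ α β : Fin (n + 1), (translGen a : so n).1 α.succ β.succ = 0 := fun α β =>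
    congrFun (congrFun (linPart_translGen a) α) β
  apply so_ext
  · ext α β
    simp [linPart, S, rescale, h0]
  · ext α
    simp [transPart, S, rescale]

end Bracket

/-! ### Exponentials -/

section Exp

variable {𝔸 : Type*} [NormedRing 𝔸] [NormedAlgebra ℝ 𝔸] [CompleteSpace 𝔸]

theorem exp_smul_mul_exp_smul_neg (A : 𝔸) (t : ℝ) :
    NormedSpace.exp (t • A) * NormedSpace.exp (t • (-A)) = 1 := by
  let _ : NormedAlgebra ℚ 𝔸 := NormedAlgebra.restrictScalars ℚ ℝ 𝔸
  rw [← NormedSpace.exp_add_of_commute (by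
    rw [smul_neg]; exact Commute.neg_right (Commute.refl _))]
  simp

theorem exp_smul_of_cube_eq_neg {A : 𝔸} (hA : A * (A * A) = -A) (t : ℝ) :
    NormedSpace.exp (t • A) = 1 + Real.sin t • A + (1 - Real.cos t) • (A * A) := by
  set R : ℝ → 𝔸 := fun s => 1 + Real.sin s • A + (1 - Real.cos s) • (A * A) with hR
  have hRd : ∀ s, HasDerivAt R (A * R s) s := by
    intro s
    have h := (((Real.hasDerivAt_sin s).smul_const A).const_add 1).add
      (((Real.hasDerivAt_cos s).const_sub 1).smul_const (A * A))
    refine HasDerivAt.congr_deriv h ?_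
    simp only [hR, mul_add, mul_one, mul_smul_comm, hA]
    module
  have hquot : ∀ s, HasDerivAt (fun s : ℝ => NormedSpace.exp (s • (-A)) * R s) 0 s := by
    intro s
    have h := (hasDerivAt_exp_smul_const (𝕂 := ℝ) (-A) s).mul (hRd s)
    refine HasDerivAt.congr_deriv h ?_
    simp [mul_assoc]
  have hconst := is_const_of_deriv_eq_zero (fun s => (hquot s).differentiableAt)
    (fun s => (hquot s).deriv) t 0
  have hinv : NormedSpace.exp (t • (-A)) * R t = 1 := by
    rw [hconst]; simp [hR]
  calc NormedSpace.exp (t • A) = NormedSpace.exp (t • A) * (NormedSpace.exp (t • (-A)) * R t) := by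
        rw [hinv, mul_one]
    _ = R t := by rw [← mul_assoc, exp_smul_mul_exp_smul_neg, one_mul]

theorem hasDerivAt_exp_conj (A B : 𝔸) :
    HasDerivAt (fun t : ℝ => NormedSpace.exp (t • A) * B * NormedSpace.exp (t • (-A)))
      (A * B - B * A) 0 := by
  have h := ((hasDerivAt_exp_smul_const (𝕂 := ℝ) A 0).mul_const B).mul
    (hasDerivAt_exp_smul_const (𝕂 := ℝ) (-A) 0)
  refine HasDerivAt.congr_deriv h ?_
  simp [sub_eq_add_neg]

end Exp

section Matrices

variable {n : ℕ}

theorem mat_mul (g h : SO0 n) : mat (g * h) = mat g * mat h := rfl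

theorem mat_one : mat (1 : SO0 n) = 1 := rfl

theorem mat_injective : Function.Injective (mat (n := n)) := fun _ _ h =>
  Subtype.ext (Subtype.ext (Units.ext h))

theorem mat_mul_mat_inv (g : SO0 n) : mat g * mat g⁻¹ = 1 := by
  rw [← mat_mul, mul_inv_cancel, mat_one]

theorem inv_mat (g : SO0 n) : (mat g)⁻¹ = mat g⁻¹ := Matrix.inv_eq_right_inv (mat_mul_mat_inv g)

theorem mat_expSO (X : so n) (t : ℝ) : mat (expSO X t) = NormedSpace.exp (t • X.1) := rfl

theorem continuous_mat : Continuous (mat (n := n)) :=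
  Units.continuous_val.comp (continuous_subtype_val.comp continuous_subtype_val)

theorem transpose_mat_mul_eta_mul_mat (g : SO0 n) : (mat g)ᵀ * eta n * mat g = eta n := g.1.2

theorem expSO_add (X : so n) (s t : ℝ) : expSO X (s + t) = expSO X s * expSO X t := by
  apply mat_injective
  rw [mat_mul, mat_expSO, mat_expSO, mat_expSO, add_smul]
  exact Matrix.exp_add_of_commute _ _ (((Commute.refl X.1).smul_left s).smul_right t)

open scoped Matrix.Norms.Operator in
theorem expSO_two_pi : expSO (M 0 1 : so n) (2 * Real.pi) = 1 := by
  have h01 : (0 : Fin (n + 2)) ≠ 1 := by simp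
  apply mat_injective
  change NormedSpace.exp ((2 * Real.pi) • (M 0 1 : so n).1) = 1
  have hM : (M 0 1 : so n).1 = Matrix.single 0 1 1 - Matrix.single 1 0 1 := by
    simp [M, metric_zero, metric_one]
  refine (exp_smul_of_cube_eq_neg ?_ (2 * Real.pi)).trans ?_
  · rw [hM]
    simp [mul_sub, sub_mul, Matrix.single_mul_single_of_ne, h01, h01.symm]
    abel
  · simp

end Matrices

/-! ### One-parameter subgroups of the covering group -/

section Adjoint

variable {n : ℕ} {G : Type*} [Group G] {p : G →* SO0 n}

theorem mat_conj_mem_so (g : SO0 n) (X : so n) : mat g * X.1 * mat g⁻¹ ∈ so n := by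
  have hX := (mem_so_iff _).1 X.2
  have hA := transpose_mat_mul_eta_mul_mat g
  have hinv := mat_mul_mat_inv g
  set A := mat g
  set B := mat g⁻¹
  have hinvT : Bᵀ * Aᵀ = 1 := by rw [← Matrix.transpose_mul, hinv, Matrix.transpose_one]
  have hAB : Aᵀ * eta n = eta n * B := by
    calc Aᵀ * eta n = Aᵀ * eta n * A * B := by simp only [mul_assoc, hinv, mul_one]
      _ = eta n * B := by rw [hA]
  have hBA : Bᵀ * eta n = eta n * A := by
    calc Bᵀ * eta n = Bᵀ * (Aᵀ * eta n * A) := by rw [hA]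
      _ = Bᵀ * Aᵀ * eta n * A := by simp only [mul_assoc]
      _ = eta n * A := by rw [hinvT, one_mul]
  rw [mem_so_iff]
  calc (A * X.1 * B)ᵀ * eta n = Bᵀ * (X.1ᵀ * (Aᵀ * eta n)) := by
        simp only [Matrix.transpose_mul, mul_assoc]
    _ = Bᵀ * (X.1ᵀ * eta n) * B := by rw [hAB]; simp only [mul_assoc]
    _ = Bᵀ * eta n * (-X.1) * B := by rw [hX]; simp only [mul_assoc]
    _ = eta n * (-(A * X.1 * B)) := by rw [hBA]; simp [mul_assoc]

/-- The adjoint action of the covering group on its Lie algebra. -/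
def Ad (p : G →* SO0 n) (g : G) : so n →ₗ[ℝ] so n where
  toFun X := ⟨mat (p g) * X.1 * mat (p g)⁻¹, mat_conj_mem_so (p g) X⟩
  map_add' X Y := by
    apply Subtype.ext
    simp [mul_add, add_mul]
  map_smul' r X := by
    apply Subtype.ext
    simp

theorem coe_Ad (g : G) (X : so n) : (Ad p g X).1 = mat (p g) * X.1 * mat (p g)⁻¹ := rfl

theorem Ad_one (X : so n) : Ad p 1 X = X := by
  apply Subtype.ext
  simp [coe_Ad, mat_one]

theorem continuous_coef_Ad [TopologicalSpace G] (hp : Continuous p) (X : so n)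
    (a b : Fin (n + 2)) : Continuous fun g : G => coef (Ad p g X) a b := by
  have hmat : Continuous fun g : G => mat (p g) := continuous_mat.comp hp
  have hinv : Continuous fun g : G => mat (p g)⁻¹ := continuous_mat.comp hp.inv
  have hconj : Continuous fun g : G => (mat (p g) * X.1 * mat (p g)⁻¹) a b :=
    ((hmat.matrix_mul continuous_const).matrix_mul hinv).matrix_elem a b
  exact (hconj.const_mul (metric n b)).div_const 2

end Adjoint

section OneParam

variable {n : ℕ} {G : Type*} [Group G] [TopologicalSpace G] {p : G →* SO0 n}

theorem p_oneParam (hp : IsCoveringMap p) (X : so n) (t : ℝ) :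
    p (oneParam hp X t) = expSO X t := (exists_oneParam hp X).choose_spec.2 t

theorem oneParam_zero (hp : IsCoveringMap p) (X : so n) : oneParam hp X 0 = 1 :=
  (exists_oneParam hp X).choose_spec.1

theorem mat_oneParam (hp : IsCoveringMap p) (X : so n) (t : ℝ) :
    mat (p (oneParam hp X t)) = NormedSpace.exp (t • X.1) := by
  rw [p_oneParam, mat_expSO]

theorem eq_oneParam (hp : IsCoveringMap p) {X : so n} {γ : ℝ → G} (hγ : Continuous γ)
    (h0 : γ 0 = 1) (h : ∀ t, p (γ t) = expSO X t) (t : ℝ) : γ t = oneParam hp X t := by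
  refine congrFun (hp.eq_of_comp_eq hγ (oneParam hp X).continuous ?_ 0 ?_) t
  · funext s
    rw [Function.comp_apply, Function.comp_apply, h, p_oneParam]
  · rw [h0, oneParam_zero]

theorem oneParam_smul (hp : IsCoveringMap p) (r : ℝ) (X : so n) (t : ℝ) :
    oneParam hp (r • X) t = oneParam hp X (r * t) := by
  refine (eq_oneParam hp (γ := fun t => oneParam hp X (r * t)) (by fun_prop) ?_ ?_ t).symm
  · rw [mul_zero, oneParam_zero]
  · intro s
    rw [p_oneParam]
    apply mat_injective
    rw [mat_expSO, mat_expSO, SetLike.val_smul, smul_smul, mul_comm]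

theorem oneParam_zero_left (hp : IsCoveringMap p) (t : ℝ) : oneParam hp (0 : so n) t = 1 := by
  rw [← zero_smul ℝ (0 : so n), oneParam_smul, zero_mul, oneParam_zero]

section Group

variable [IsTopologicalGroup G]

theorem oneParam_add (hp : IsCoveringMap p) (X : so n) (s t : ℝ) :
    oneParam hp X (s + t) = oneParam hp X s * oneParam hp X t := by
  have h := eq_oneParam hp (X := X) (γ := fun t => (oneParam hp X s)⁻¹ * oneParam hp X (s + t))
    (by fun_prop) (by simp) (fun t => by
      rw [map_mul, map_inv, p_oneParam, p_oneParam, expSO_add, inv_mul_cancel_left]) t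
  rw [← h, mul_inv_cancel_left]

theorem oneParam_neg (hp : IsCoveringMap p) (X : so n) (t : ℝ) :
    oneParam hp X (-t) = (oneParam hp X t)⁻¹ := by
  rw [eq_inv_iff_mul_eq_one, ← oneParam_add, neg_add_cancel, oneParam_zero]

theorem oneParam_Ad (hp : IsCoveringMap p) (g : G) (X : so n) (t : ℝ) :
    oneParam hp (Ad p g X) t = g * oneParam hp X t * g⁻¹ := by
  refine (eq_oneParam hp (γ := fun t => g * oneParam hp X t * g⁻¹) (by fun_prop) ?_ ?_ t).symm
  · simp [oneParam_zero]
  · intro s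
    rw [map_mul, map_mul, map_inv, p_oneParam]
    apply mat_injective
    have hunit : IsUnit (mat (p g)) := IsUnit.of_mul_eq_one _ (mat_mul_mat_inv (p g))
    rw [mat_mul, mat_mul, mat_expSO, mat_expSO, coe_Ad, ← inv_mat, ← Matrix.exp_conj _ _ hunit]
    simp

theorem hasDerivAt_coef_Ad (hp : IsCoveringMap p) (X Y : so n) (a b : Fin (n + 2)) :
    HasDerivAt (fun t : ℝ => coef (Ad p (oneParam hp X t) Y) a b) (coef ⁅X, Y⁆ a b) 0 := by
  have h : HasDerivAt (fun t : ℝ => (Ad p (oneParam hp X t) Y).1 a b) (⁅X, Y⁆.1 a b) 0 := by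
    have hm : HasDerivAt (fun t : ℝ => (Ad p (oneParam hp X t) Y).1) (⁅X, Y⁆.1) 0 := by
      open scoped Matrix.Norms.Operator in
      have h := hasDerivAt_exp_conj X.1 Y.1
      refine HasDerivAt.congr_of_eventuallyEq h (Eventually.of_forall fun t => ?_)
      simp only [coe_Ad, ← map_inv, ← oneParam_neg hp, mat_oneParam, neg_smul, smul_neg]
      rfl
    exact hasDerivAt_pi.1 (hasDerivAt_pi.1 hm a) b
  exact (h.const_mul (metric n b)).div_const 2

theorem commute_oneParam_of_map_eq_one (hp : IsCoveringMap p) {z : G} (hz : p z = 1) (X : so n)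
    (t : ℝ) : Commute z (oneParam hp X t) := by
  have hconj := congrFun (hp.eq_of_comp_eq (A := ℝ)
    (g₁ := fun s => oneParam hp X s * z * (oneParam hp X s)⁻¹) (g₂ := fun _ => z)
    (by fun_prop) continuous_const (by funext s; simp [hz]) 0 (by simp [oneParam_zero])) t
  exact (mul_inv_eq_iff_eq_mul.1 hconj).symm

end Group

theorem continuous_expSO_ofCoef :
    Continuous fun c : Fin (n + 2) → Fin (n + 2) → ℝ => expSO (ofCoef c) 1 := by
  have hc : Continuous fun c : Fin (n + 2) → Fin (n + 2) → ℝ => (1 : ℝ) • (ofCoef c).1 := by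
    refine continuous_matrix fun i j => ?_
    simp only [Matrix.smul_apply, coe_ofCoef]
    fun_prop
  refine Continuous.subtype_mk (Continuous.subtype_mk (Units.continuous_iff.2 ⟨?_, ?_⟩) _) _
  · exact continuous_matrix_exp.comp hc
  · exact continuous_matrix_exp.comp hc.neg

theorem continuous_oneParam_ofCoef (hp : IsCoveringMap p) :
    Continuous fun c : Fin (n + 2) → Fin (n + 2) → ℝ => oneParam hp (ofCoef c) 1 := by
  obtain ⟨Γ, ⟨h0, h1⟩, -⟩ := hp.existsUnique_continuousMap_lifts
    ⟨_, continuous_expSO_ofCoef (n := n)⟩ (a₀ := 0) (e₀ := (1 : G)) (by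
      rw [map_one]
      refine mat_injective ?_
      change mat 1 = mat (expSO (ofCoef 0) 1)
      rw [mat_expSO, mat_one]
      simp)
  convert Γ.continuous using 1
  funext c
  refine ((eq_oneParam hp (γ := fun t : ℝ => Γ (t • c)) (by fun_prop) ?_ ?_ 1).symm).trans ?_
  · simpa using h0
  · intro t
    have h := congrFun h1 (t • c)
    refine h.trans (mat_injective ?_)
    simp [mat_expSO]
  · simp

end OneParam

/-! ### Vectors of class `C^∞` -/

section Core

variable {n : ℕ} {G : Type*} [Group G] [TopologicalSpace G] {p : G →* SO0 n}
  {H : Type*} [NormedAddCommGroup H] [InnerProductSpace ℂ H] [CompleteSpace H]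

theorem UnitaryRep.op_mul (U : UnitaryRep G H) (g h : G) (v : H) :
    U.op (g * h) v = U.op g (U.op h v) := by
  simp [UnitaryRep.op]

theorem UnitaryRep.op_one (U : UnitaryRep G H) (v : H) : U.op 1 v = v := by
  simp [UnitaryRep.op]

theorem UnitaryRep.op_inv_op (U : UnitaryRep G H) (g : G) (v : H) : U.op g⁻¹ (U.op g v) = v := by
  rw [← U.op_mul, inv_mul_cancel, U.op_one]

theorem UnitaryRep.op_op_inv (U : UnitaryRep G H) (g : G) (v : H) : U.op g (U.op g⁻¹ v) = v := by
  rw [← U.op_mul, mul_inv_cancel, U.op_one]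

theorem UnitaryRep.norm_op (U : UnitaryRep G H) (g : G) (v : H) : ‖U.op g v‖ = ‖v‖ :=
  ContinuousLinearMap.norm_map_of_mem_unitary (U.toHom g).2 v

theorem UnitaryRep.inner_op_op (U : UnitaryRep G H) (g : G) (v w : H) :
    inner ℂ (U.op g v) (U.op g w) = inner ℂ v w :=
  ContinuousLinearMap.inner_map_map_of_mem_unitary (U.toHom g).2 v w

theorem UnitaryRep.inner_op_left (U : UnitaryRep G H) (g : G) (v w : H) :
    inner ℂ (U.op g v) w = inner ℂ v (U.op g⁻¹ w) := by
  conv_lhs => rw [← U.op_op_inv g w]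
  exact U.inner_op_op g v _

theorem UnitaryRep.continuous_op (U : UnitaryRep G H) (v : H) : Continuous fun g => U.op g v :=
  U.continuous_orbit v

theorem UnitaryRep.continuous_op_oneParam (hp : IsCoveringMap p) (U : UnitaryRep G H) (X : so n)
    (v : H) : Continuous fun t : ℝ => U.op (oneParam hp X t) v :=
  (U.continuous_op v).comp (oneParam hp X).continuous

theorem hasDerivAt_op_oneParam [IsTopologicalGroup G] (hp : IsCoveringMap p)
    (U : UnitaryRep G H) {X : so n} {v w : H}
    (h : HasDerivAt (fun t : ℝ => U.op (oneParam hp X t) v) w 0) (t : ℝ) :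
    HasDerivAt (fun t : ℝ => U.op (oneParam hp X t) v) (U.op (oneParam hp X t) w) t := by
  have h1 : HasDerivAt (fun s : ℝ => U.op (oneParam hp X s) v) w (t - t) := by rwa [sub_self]
  have h2 := ((U.op (oneParam hp X t)).restrictScalars ℝ).hasFDerivAt.comp_hasDerivAt t
    (h1.comp_sub_const t t)
  refine h2.congr_of_eventuallyEq (Eventually.of_forall fun s => ?_)
  simp only [Function.comp_apply, ContinuousLinearMap.coe_restrictScalars', ← U.op_mul,
    ← oneParam_add, add_sub_cancel]

theorem inner_add_inner_eq_zero_of_hasDerivAt (hp : IsCoveringMap p) (U : UnitaryRep G H)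
    {X : so n} {v v' w w' : H}
    (hv : HasDerivAt (fun t : ℝ => U.op (oneParam hp X t) v) v' 0)
    (hw : HasDerivAt (fun t : ℝ => U.op (oneParam hp X t) w) w' 0) :
    inner ℂ v' w + inner ℂ v w' = 0 := by
  have h := hv.inner ℂ hw
  simp only [U.inner_op_op, oneParam_zero, U.op_one] at h
  rw [add_comm]
  exact h.unique (hasDerivAt_const _ _)

/-- The vectors of class `C^m`, in the sense that the Lie algebra acts `m` times, linearly in its
element. Linearity is part of the definition, so that it need not be derived from continuity of the
derivatives. -/
def diffVectors (hp : IsCoveringMap p) (U : UnitaryRep G H) : ℕ → Submodule ℂ H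
  | 0 => ⊤
  | m + 1 =>
    { carrier := {v | ∃ L : so n →ₗ[ℝ] H, ∀ X,
        HasDerivAt (fun t : ℝ => U.op (oneParam hp X t) v) (L X) 0 ∧ L X ∈ diffVectors hp U m}
      add_mem' := by
        rintro v w ⟨L, hL⟩ ⟨K, hK⟩
        refine ⟨L + K, fun X => ⟨?_, add_mem (hL X).2 (hK X).2⟩⟩
        simpa using (hL X).1.fun_add (hK X).1
      zero_mem' := ⟨0, fun X => ⟨by simpa using hasDerivAt_const _ _, zero_mem _⟩⟩
      smul_mem' := by
        rintro c v ⟨L, hL⟩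
        refine ⟨c • L, fun X => ⟨?_, Submodule.smul_mem _ c (hL X).2⟩⟩
        simpa using (hL X).1.fun_const_smul c }

/-- The vectors of class `C^∞`. -/
def smoothCore (hp : IsCoveringMap p) (U : UnitaryRep G H) : Submodule ℂ H :=
  ⨅ m, diffVectors hp U m

theorem mem_smoothCore (hp : IsCoveringMap p) (U : UnitaryRep G H) (v : H) :
    v ∈ smoothCore hp U ↔ ∀ m, v ∈ diffVectors hp U m := by
  simp [smoothCore]

theorem exists_linear_of_mem_smoothCore (hp : IsCoveringMap p) (U : UnitaryRep G H) {v : H}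
    (hv : v ∈ smoothCore hp U) : ∃ L : so n →ₗ[ℝ] H, ∀ X,
      HasDerivAt (fun t : ℝ => U.op (oneParam hp X t) v) (L X) 0 ∧ L X ∈ smoothCore hp U := by
  rw [mem_smoothCore] at hv
  obtain ⟨L, hL⟩ := hv 1
  refine ⟨L, fun X => ⟨(hL X).1, (mem_smoothCore _ _ _).2 fun m => ?_⟩⟩
  obtain ⟨K, hK⟩ := hv (m + 1)
  rw [(hL X).1.unique (hK X).1]
  exact (hK X).2

variable [IsTopologicalGroup G]

theorem hasDerivAt_op_oneParam_op (hp : IsCoveringMap p) (U : UnitaryRep G H) (g : G)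
    {X : so n} {v w : H}
    (h : HasDerivAt (fun t : ℝ => U.op (oneParam hp (Ad p g⁻¹ X) t) v) w 0) :
    HasDerivAt (fun t : ℝ => U.op (oneParam hp X t) (U.op g v)) (U.op g w) 0 := by
  have h2 := ((U.op g).restrictScalars ℝ).hasFDerivAt.comp_hasDerivAt (0 : ℝ) h
  refine h2.congr_of_eventuallyEq (Eventually.of_forall fun s => ?_)
  simp only [Function.comp_apply, ContinuousLinearMap.coe_restrictScalars', ← U.op_mul,
    oneParam_Ad]
  congr 1
  group

theorem op_mem_diffVectors (hp : IsCoveringMap p) (U : UnitaryRep G H) (g : G) (m : ℕ) {v : H}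
    (hv : v ∈ diffVectors hp U m) : U.op g v ∈ diffVectors hp U m := by
  induction m generalizing v with
  | zero => exact Submodule.mem_top
  | succ m ih =>
    obtain ⟨L, hL⟩ := hv
    refine ⟨((U.op g).restrictScalars ℝ).toLinearMap ∘ₗ L ∘ₗ Ad p g⁻¹, fun X => ⟨?_, ih (hL _).2⟩⟩
    exact hasDerivAt_op_oneParam_op hp U g (hL _).1

theorem op_mem_smoothCore (hp : IsCoveringMap p) (U : UnitaryRep G H) (g : G) {v : H}
    (hv : v ∈ smoothCore hp U) : U.op g v ∈ smoothCore hp U := by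
  rw [mem_smoothCore] at hv ⊢
  exact fun m => op_mem_diffVectors hp U g m (hv m)

end Core

/-! ### Smoothness of integrals depending on a parameter -/

section ParametricIntegral

open MeasureTheory

universe u v w

variable {X : Type w} [TopologicalSpace X] [MeasurableSpace X] [OpensMeasurableSpace X]
  {μ : Measure X} [IsFiniteMeasureOnCompacts μ] {C : Set X}
  {E : Type u} [NormedAddCommGroup E] [NormedSpace ℝ E]
  {E' : Type*} [NormedAddCommGroup E'] [NormedSpace ℝ E']
  {H : Type*} [NormedAddCommGroup H] [NormedSpace ℝ H]

/-- The partial derivative in the first variable of a family of operators. -/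
def partialDeriv {F : Type*} [NormedAddCommGroup F] [NormedSpace ℝ F]
    (Ψ : E × E' → H →L[ℝ] F) (x : E × E') : H →L[ℝ] E →L[ℝ] F :=
  ((fderiv ℝ Ψ x).comp (ContinuousLinearMap.inl ℝ E E')).flip

theorem contDiff_partialDeriv {F : Type*} [NormedAddCommGroup F] [NormedSpace ℝ F]
    {Ψ : E × E' → H →L[ℝ] F} (hΨ : ContDiff ℝ ∞ Ψ) : ContDiff ℝ ∞ (partialDeriv Ψ) := by
  have h1 : ContDiff ℝ ∞ fun x => (fderiv ℝ Ψ x).comp (ContinuousLinearMap.inl ℝ E E') :=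
    (hΨ.fderiv_right (m := ∞) (by simp)).clm_comp contDiff_const
  have h2 : ContDiff ℝ ∞ fun f : E →L[ℝ] H →L[ℝ] F => f.flip := by
    let Λ : (E →L[ℝ] H →L[ℝ] F) →L[ℝ] (H →L[ℝ] E →L[ℝ] F) :=
      (ContinuousLinearMap.flipₗᵢ ℝ E H F).toContinuousLinearEquiv.toContinuousLinearMap
    exact ContinuousLinearMap.contDiff (𝕜 := ℝ) (E := E →L[ℝ] H →L[ℝ] F)
      (F := H →L[ℝ] E →L[ℝ] F) Λ
  exact h2.comp h1

theorem hasFDerivAt_setIntegral_apply [ProperSpace E] {F : Type*} [NormedAddCommGroup F]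
    [NormedSpace ℝ F] (hC : IsCompact C) (hCm : MeasurableSet C) {m : X → E'}
    (hm : ContinuousOn m C) {w : X → H} (hw : ContinuousOn w C) {Ψ : E × E' → H →L[ℝ] F}
    (hΨ : ContDiff ℝ ∞ Ψ) (x₀ : E) :
    HasFDerivAt (fun x => ∫ g in C, Ψ (x, m g) (w g) ∂μ)
      (∫ g in C, partialDeriv Ψ (x₀, m g) (w g) ∂μ) x₀ := by
  have hΨ' := contDiff_partialDeriv hΨ
  have hpair : ∀ x : E, ContinuousOn (fun g => (x, m g)) C := fun x =>
    continuousOn_const.prodMk hm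
  have hc1 : ∀ x, ContinuousOn (fun g => Ψ (x, m g) (w g)) C := fun x =>
    (hΨ.continuous.comp_continuousOn (hpair x)).clm_apply hw
  have hc2 : ∀ x, ContinuousOn (fun g => partialDeriv Ψ (x, m g) (w g)) C := fun x =>
    (hΨ'.continuous.comp_continuousOn (hpair x)).clm_apply hw
  have hK : IsCompact (Metric.closedBall x₀ 1 ×ˢ (m '' C)) :=
    (isCompact_closedBall x₀ 1).prod (hC.image_of_continuousOn hm)
  obtain ⟨B, hB⟩ : ∃ B, ∀ x ∈ Metric.closedBall x₀ 1 ×ˢ (m '' C), ‖partialDeriv Ψ x‖ ≤ B :=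
    hK.exists_bound_of_continuousOn (f := partialDeriv Ψ) (by exact hΨ'.continuous.continuousOn)
  obtain ⟨B', hB'⟩ := hC.exists_bound_of_continuousOn hw
  refine hasFDerivAt_integral_of_dominated_of_fderiv_le
    (s := Metric.closedBall x₀ 1) (bound := fun _ => B * B')
    (F' := fun x g => partialDeriv Ψ (x, m g) (w g)) (Metric.closedBall_mem_nhds x₀ one_pos)
    (Eventually.of_forall fun x => (hc1 x).aestronglyMeasurable_of_isCompact hC hCm)
    ((hc1 x₀).integrableOn_compact' hC hCm)
    ((hc2 x₀).aestronglyMeasurable_of_isCompact hC hCm) ?_ ?_ ?_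
  · refine (ae_restrict_mem hCm).mono fun g hg x hx => ?_
    refine (ContinuousLinearMap.le_opNorm _ _).trans ?_
    have h1 := hB (x, m g) ⟨hx, Set.mem_image_of_mem m hg⟩
    have h2 : 0 ≤ B := le_trans (norm_nonneg (partialDeriv Ψ (x, m g))) h1
    exact mul_le_mul h1 (hB' g hg) (norm_nonneg _) h2
  · exact integrableOn_const hC.measure_ne_top
  · refine Eventually.of_forall fun g x _ => ?_
    have h1 : HasFDerivAt (fun x => Ψ (x, m g))
        ((fderiv ℝ Ψ (x, m g)).comp (ContinuousLinearMap.inl ℝ E E')) x :=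
      (hΨ.differentiable (by simp) (x, m g)).hasFDerivAt.comp x (hasFDerivAt_prodMk_left x (m g))
    refine (h1.clm_apply (hasFDerivAt_const (w g) x)).congr_fderiv ?_
    simp [partialDeriv]

/-- `E` lives in `Type`, so that the space `E →L[ℝ] F` of the next derivative lives in the universe
of `F` and the induction on the order goes through. -/
theorem contDiff_setIntegral_apply {E : Type} [NormedAddCommGroup E] [NormedSpace ℝ E]
    [ProperSpace E] {F : Type v} [NormedAddCommGroup F] [NormedSpace ℝ F]
    (hC : IsCompact C) (hCm : MeasurableSet C) {m : X → E'} (hm : ContinuousOn m C) {w : X → H}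
    (hw : ContinuousOn w C) {Ψ : E × E' → H →L[ℝ] F} (hΨ : ContDiff ℝ ∞ Ψ) :
    ContDiff ℝ ∞ (fun x => ∫ g in C, Ψ (x, m g) (w g) ∂μ) := by
  have key : ∀ k : ℕ, ∀ (F : Type v) [NormedAddCommGroup F] [NormedSpace ℝ F]
      (Ψ : E × E' → H →L[ℝ] F), ContDiff ℝ ∞ Ψ →
      ContDiff ℝ k (fun x => ∫ g in C, Ψ (x, m g) (w g) ∂μ) := by
    intro k
    induction k with
    | zero =>
      intro F _ _ Ψ hΨ
      rw [Nat.cast_zero, contDiff_zero]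
      exact continuous_iff_continuousAt.2 fun x =>
        (hasFDerivAt_setIntegral_apply hC hCm hm hw hΨ x).continuousAt
    | succ k ih =>
      intro F _ _ Ψ hΨ
      rw [Nat.cast_succ, contDiff_succ_iff_hasFDerivAt]
      exact ⟨_, ih _ _ (contDiff_partialDeriv hΨ), fun x =>
        hasFDerivAt_setIntegral_apply hC hCm hm hw hΨ x⟩
  exact contDiff_infty.2 fun k => key k F Ψ hΨ

end ParametricIntegral

/-! ### Gårding vectors -/

section Garding

open MeasureTheory

variable {G : Type*} [Group G] [TopologicalSpace G] [MeasurableSpace G] [BorelSpace G]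
  {H : Type*} [NormedAddCommGroup H] [InnerProductSpace ℂ H] [CompleteSpace H]
  {𝔸 : Type} [NormedRing 𝔸]

/-- A compact neighbourhood `C` of `1`, on which elements near `1` can be recognized by their image
in `𝔸`. -/
structure IsSheet (m : G →* 𝔸) (C : Set G) (r : ℝ) : Prop where
  compact : IsCompact C
  measurable : MeasurableSet C
  mem_nhds : C ∈ 𝓝 (1 : G)
  translate : ∀ᶠ h in 𝓝 (1 : G), ∀ g, ‖m (h⁻¹ * g) - 1‖ < r → (h⁻¹ * g ∈ C ↔ g ∈ C)
  small : ∀ O ∈ 𝓝 (1 : G), ∃ δ > 0, ∀ g ∈ C, ‖m g - 1‖ < δ → g ∈ O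
  pos : 0 < r

/-- The mean of the vectors `U(g) v` with weight `Φ(m(g))`. -/
def gardingVector (μ : Measure G) (U : UnitaryRep G H) (m : G →* 𝔸) (C : Set G) (Φ : 𝔸 → ℝ)
    (v : H) : H :=
  ∫ g in C, Φ (m g) • U.op g v ∂μ

variable {μ : Measure G} [μ.IsHaarMeasure] {m : G →* 𝔸} {C : Set G} {r : ℝ}

theorem integrableOn_smul_op (hC : IsSheet m C r) (hm : Continuous m) (U : UnitaryRep G H)
    {Φ : 𝔸 → ℝ} (hΦ : Continuous Φ) (v : H) :
    IntegrableOn (fun g => Φ (m g) • U.op g v) C μ :=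
  ((hΦ.comp hm).smul (U.continuous_op v)).continuousOn.integrableOn_compact'
    hC.compact hC.measurable

theorem integrableOn_weight (hC : IsSheet m C r) (hm : Continuous m) {Φ : 𝔸 → ℝ}
    (hΦ : Continuous Φ) : IntegrableOn (fun g => Φ (m g)) C μ :=
  (hΦ.comp hm).continuousOn.integrableOn_compact' hC.compact hC.measurable

theorem eventually_op_gardingVector [IsTopologicalGroup G] (hC : IsSheet m C r)
    (hm : Continuous m) (U : UnitaryRep G H) {Φ : 𝔸 → ℝ} (hΦ : Continuous Φ)
    (hs : tsupport Φ ⊆ Metric.ball 1 r) (v : H) : ∀ᶠ h in 𝓝 (1 : G),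
      U.op h (gardingVector μ U m C Φ v) = ∫ g in C, Φ (m h⁻¹ * m g) • U.op g v ∂μ := by
  filter_upwards [hC.translate] with h hh
  have hop : U.op h (gardingVector μ U m C Φ v) = ∫ g in C, Φ (m g) • U.op (h * g) v ∂μ := by
    rw [gardingVector,
      ← ContinuousLinearMap.integral_comp_comm _ (integrableOn_smul_op hC hm U hΦ v)]
    refine integral_congr_ae (Eventually.of_forall fun g => ?_)
    simp only [U.op_mul]
    exact ((U.op h).restrictScalars ℝ).map_smul _ _
  rw [hop, ← integral_indicator hC.measurable, ← integral_indicator hC.measurable,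
    ← integral_mul_left_eq_self _ h⁻¹]
  refine integral_congr_ae (Eventually.of_forall fun g => ?_)
  classical
  simp only [Set.indicator_apply, mul_inv_cancel_left, ← map_mul]
  by_cases h0 : Φ (m (h⁻¹ * g)) = 0
  · simp only [h0, zero_smul, ite_self]
  · have hb : m (h⁻¹ * g) ∈ Metric.ball 1 r := hs (subset_tsupport _ h0)
    rw [Metric.mem_ball, dist_eq_norm] at hb
    simp only [hh g hb]

theorem norm_gardingVector_sub_le (hC : IsSheet m C r) (hm : Continuous m) (U : UnitaryRep G H)
    (v : H) {Φ : 𝔸 → ℝ} (hΦ : Continuous Φ) (hΦ0 : ∀ A, 0 ≤ Φ A)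
    (hint : ∫ g in C, Φ (m g) ∂μ = 1) {ε : ℝ}
    (hε : ∀ g ∈ C, Φ (m g) ≠ 0 → ‖U.op g v - v‖ ≤ ε) :
    ‖gardingVector μ U m C Φ v - v‖ ≤ ε := by
  have hi := integrableOn_weight (μ := μ) hC hm hΦ
  have hsub : gardingVector μ U m C Φ v - v = ∫ g in C, Φ (m g) • (U.op g v - v) ∂μ := by
    simp only [smul_sub]
    rw [integral_sub (integrableOn_smul_op hC hm U hΦ v) (hi.smul_const v), integral_smul_const,
      hint, one_smul, gardingVector]
  calc ‖gardingVector μ U m C Φ v - v‖ ≤ ∫ g in C, Φ (m g) * ε ∂μ := by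
        rw [hsub]
        refine norm_integral_le_of_norm_le (hi.mul_const ε) ?_
        refine (ae_restrict_mem hC.measurable).mono fun g hg => ?_
        rw [norm_smul, Real.norm_of_nonneg (hΦ0 _)]
        by_cases h0 : Φ (m g) = 0
        · simp [h0]
        · exact mul_le_mul_of_nonneg_left (hε g hg h0) (hΦ0 _)
    _ = ε := by rw [integral_mul_const, hint, one_mul]

variable [NormedAlgebra ℝ 𝔸]

/-- The action of `B ∈ 𝔸` on weight functions. -/
def weightDeriv (B : 𝔸) (Φ : 𝔸 → ℝ) (A : 𝔸) : ℝ := fderiv ℝ Φ A (B * A)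

theorem contDiff_weightDeriv (B : 𝔸) {Φ : 𝔸 → ℝ} (hΦ : ContDiff ℝ ∞ Φ) :
    ContDiff ℝ ∞ (weightDeriv B Φ) :=
  (hΦ.fderiv_right (m := ∞) (by simp)).clm_apply (contDiff_const.mul contDiff_id)

theorem tsupport_weightDeriv_subset (B : 𝔸) (Φ : 𝔸 → ℝ) :
    tsupport (weightDeriv B Φ) ⊆ tsupport Φ := by
  refine closure_minimal (fun A hA => ?_) isClosed_closure
  by_contra h
  refine hA ?_
  simp only [weightDeriv]
  rw [fderiv_of_notMem_tsupport _ h]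
  simp

/-- The operator-valued integrand of a translated Gårding vector. -/
def translateKernel (E : Type*) [NormedAddCommGroup E] [NormedSpace ℝ E] (Φ : 𝔸 → ℝ)
    (x : 𝔸 × 𝔸) : E →L[ℝ] E := Φ (x.1 * x.2) • ContinuousLinearMap.id ℝ E

theorem contDiff_translateKernel (E : Type*) [NormedAddCommGroup E] [NormedSpace ℝ E]
    {Φ : 𝔸 → ℝ} (hΦ : ContDiff ℝ ∞ Φ) : ContDiff ℝ ∞ (translateKernel E Φ) :=
  (hΦ.comp (contDiff_fst.mul contDiff_snd)).smul contDiff_const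

variable [FiniteDimensional ℝ 𝔸]

theorem contDiff_translate_gardingVector (hC : IsSheet m C r) (hm : Continuous m)
    (U : UnitaryRep G H) {Φ : 𝔸 → ℝ} (hΦ : ContDiff ℝ ∞ Φ) (v : H) :
    ContDiff ℝ ∞ (fun A : 𝔸 => ∫ g in C, Φ (A * m g) • U.op g v ∂μ) := by
  have : ProperSpace 𝔸 := FiniteDimensional.proper_real 𝔸
  exact contDiff_setIntegral_apply (μ := μ) hC.compact hC.measurable hm.continuousOn
    (U.continuous_op v).continuousOn (contDiff_translateKernel H hΦ)

theorem hasFDerivAt_translate_gardingVector (hC : IsSheet m C r) (hm : Continuous m)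
    (U : UnitaryRep G H) {Φ : 𝔸 → ℝ} (hΦ : ContDiff ℝ ∞ Φ) (v : H) :
    ∃ L : 𝔸 →L[ℝ] H, HasFDerivAt (fun A : 𝔸 => ∫ g in C, Φ (A * m g) • U.op g v ∂μ) L 1 ∧
      ∀ B, L B = gardingVector μ U m C (weightDeriv B Φ) v := by
  have : ProperSpace 𝔸 := FiniteDimensional.proper_real 𝔸
  have hK := contDiff_translateKernel H hΦ
  refine ⟨_, hasFDerivAt_setIntegral_apply (μ := μ) hC.compact hC.measurable hm.continuousOn
    (U.continuous_op v).continuousOn hK 1, fun B => ?_⟩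
  have hc : Continuous fun g => partialDeriv (translateKernel H Φ) (1, m g) (U.op g v) :=
    ((contDiff_partialDeriv hK).continuous.comp (continuous_const.prodMk hm)).clm_apply
      (U.continuous_op v)
  rw [ContinuousLinearMap.integral_apply
    (hc.continuousOn.integrableOn_compact' hC.compact hC.measurable)]
  refine integral_congr_ae (Eventually.of_forall fun g => ?_)
  have hmul : HasFDerivAt (fun x : 𝔸 × 𝔸 => x.1 * x.2)
      ((1 : 𝔸) • ContinuousLinearMap.snd ℝ 𝔸 𝔸 +
        (MulOpposite.op (m g)) • ContinuousLinearMap.fst ℝ 𝔸 𝔸) ((1 : 𝔸), m g) := by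
    exact (hasFDerivAt_fst (𝕜 := ℝ) (p := ((1 : 𝔸), m g))).mul'
      (hasFDerivAt_snd (𝕜 := ℝ) (p := ((1 : 𝔸), m g)))
  have hΦ1 : HasFDerivAt Φ (fderiv ℝ Φ (m g)) ((1 : 𝔸) * m g) := by
    rw [one_mul]
    exact (hΦ.differentiable (by simp) _).hasFDerivAt
  have hkernel := (HasFDerivAt.comp ((1 : 𝔸), m g) hΦ1 hmul).smul_const
    (ContinuousLinearMap.id ℝ H)
  have hfderiv : fderiv ℝ (translateKernel H Φ) (1, m g) = _ := hkernel.fderiv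
  simp [partialDeriv, hfderiv, weightDeriv]

theorem exists_weight_integral_eq_one (hC : IsSheet m C r) (hm : Continuous m) {δ : ℝ}
    (hδ : 0 < δ) : ∃ Φ : 𝔸 → ℝ, ContDiff ℝ ∞ Φ ∧ tsupport Φ ⊆ Metric.ball 1 δ ∧ (∀ A, 0 ≤ Φ A) ∧
      ∫ g in C, Φ (m g) ∂μ = 1 := by
  let f : ContDiffBump (1 : 𝔸) := ⟨δ / 4, δ / 2, by linarith, by linarith⟩
  have hpos : 0 < ∫ g in C, f (m g) ∂μ := by
    rw [setIntegral_pos_iff_support_of_nonneg_ae (Eventually.of_forall fun g => f.nonneg)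
      (integrableOn_weight hC hm f.continuous)]
    have hopen : IsOpen (interior C ∩ {g | f (m g) ≠ 0}) :=
      isOpen_interior.inter (isOpen_ne_fun (f.continuous.comp hm) continuous_const)
    have hone : (1 : G) ∈ interior C ∩ {g | f (m g) ≠ 0} := by
      refine ⟨mem_interior_iff_mem_nhds.2 hC.mem_nhds, ?_⟩
      rw [Set.mem_ofPred_eq, map_one,
        f.one_of_mem_closedBall (Metric.mem_closedBall_self f.rIn_pos.le)]
      exact one_ne_zero
    exact (hopen.measure_pos μ ⟨1, hone⟩).trans_le
      (measure_mono fun g hg => ⟨hg.2, interior_subset hg.1⟩)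
  refine ⟨fun A => (∫ g in C, f (m g) ∂μ)⁻¹ * f A, contDiff_const.mul f.contDiff, ?_,
    fun A => mul_nonneg (inv_nonneg.2 hpos.le) f.nonneg, ?_⟩
  · refine tsupport_mul_subset_right.trans ?_
    rw [f.tsupport_eq]
    exact Metric.closedBall_subset_ball (half_lt_self hδ)
  · rw [integral_const_mul, inv_mul_cancel₀ hpos.ne']

theorem exists_gardingVector_norm_sub_le (hC : IsSheet m C r) (hm : Continuous m)
    (U : UnitaryRep G H) (v : H) {ε : ℝ} (hε : 0 < ε) :
    ∃ Φ : 𝔸 → ℝ, ContDiff ℝ ∞ Φ ∧ tsupport Φ ⊆ Metric.ball 1 r ∧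
      ‖gardingVector μ U m C Φ v - v‖ ≤ ε := by
  have hO : {g | ‖U.op g v - v‖ < ε} ∈ 𝓝 (1 : G) := by
    have hc : Continuous fun g => ‖U.op g v - v‖ := ((U.continuous_op v).sub continuous_const).norm
    exact (isOpen_Iio.preimage hc).mem_nhds (by simp [U.op_one, hε])
  obtain ⟨δ, hδ, hsmall⟩ := hC.small _ hO
  obtain ⟨Φ, hΦ, hs, hΦ0, hint⟩ :=
    exists_weight_integral_eq_one (μ := μ) hC hm (lt_min hδ hC.pos)
  refine ⟨Φ, hΦ, hs.trans (Metric.ball_subset_ball (min_le_right _ _)),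
    norm_gardingVector_sub_le hC hm U v hΦ.continuous hΦ0 hint fun g hg hg0 => ?_⟩
  have hb := hs (subset_tsupport _ hg0)
  rw [Metric.mem_ball, dist_eq_norm] at hb
  exact (hsmall g hg (hb.trans_le (min_le_left _ _))).le

end Garding

/-! ### Density of the smooth vectors -/

section Density

open MeasureTheory
open scoped Matrix.Norms.Operator

variable {n : ℕ} {G : Type*} [Group G] [TopologicalSpace G] {p : G →* SO0 n}
  {H : Type*} [NormedAddCommGroup H] [InnerProductSpace ℂ H] [CompleteSpace H]

theorem isEmbedding_mat : IsEmbedding (mat (n := n)) :=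
  Units.isOpenEmbedding_val.isEmbedding.comp (IsEmbedding.subtypeVal.comp IsEmbedding.subtypeVal)

theorem eta_mul_eta : eta n * eta n = 1 := by
  rw [eta, Matrix.diagonal_mul_diagonal, ← Matrix.diagonal_one]
  congr 1
  funext a
  exact metric_mul_self a

theorem isClosedEmbedding_indefO :
    IsClosedEmbedding fun g : indefO n => (g : GL (Fin (n + 2)) ℝ).val := by
  refine ⟨Units.isOpenEmbedding_val.isEmbedding.comp IsEmbedding.subtypeVal, ?_⟩
  have h : Set.range (fun g : indefO n => (g : GL (Fin (n + 2)) ℝ).val) =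
      {A : Matrix (Fin (n + 2)) (Fin (n + 2)) ℝ | Aᵀ * eta n * A = eta n} := by
    ext A
    constructor
    · rintro ⟨g, rfl⟩
      exact g.2
    · intro hA
      have h1 : (eta n * Aᵀ * eta n) * A = 1 := by
        have hA' : Aᵀ * eta n * A = eta n := hA
        calc _ = eta n * (Aᵀ * eta n * A) := by simp only [mul_assoc]
          _ = 1 := by rw [hA', eta_mul_eta]
      exact ⟨⟨⟨A, eta n * Aᵀ * eta n, mul_eq_one_comm.1 h1, h1⟩, hA⟩, rfl⟩
  rw [h]
  exact isClosed_eq (by fun_prop) continuous_const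

theorem isClosedEmbedding_mat : IsClosedEmbedding (mat (n := n)) :=
  isClosedEmbedding_indefO.comp (isClosed_connectedComponent.isClosedEmbedding_subtypeVal)

instance : LocallyCompactSpace (SO0 n) := by
  have : LocallyCompactSpace (Matrix (Fin (n + 2)) (Fin (n + 2)) ℝ) :=
    inferInstanceAs (LocallyCompactSpace (Fin (n + 2) → Fin (n + 2) → ℝ))
  exact isClosedEmbedding_mat.locallyCompactSpace

/-- The covering homomorphism, as a homomorphism into the algebra of matrices. -/
def matHom (p : G →* SO0 n) : G →* Matrix (Fin (n + 2)) (Fin (n + 2)) ℝ where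
  toFun g := mat (p g)
  map_one' := by rw [map_one, mat_one]
  map_mul' g h := by rw [map_mul, mat_mul]

theorem continuous_matHom (hp : Continuous p) : Continuous (matHom p) :=
  continuous_mat.comp hp

theorem exists_eq_of_norm_matHom_sub_lt (hp : IsCoveringMap p) {O : Set G} (hO : O ∈ 𝓝 (1 : G)) :
    ∃ r > 0, ∀ x : G, ‖matHom p x - 1‖ < r → ∃ k ∈ O, p k = p x := by
  have h1 : p '' O ∈ 𝓝 (1 : SO0 n) := by
    have := hp.isOpenMap.image_mem_nhds hO
    rwa [map_one] at this
  rw [isEmbedding_mat.nhds_eq_comap, mat_one] at h1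
  obtain ⟨T, hT, hTO⟩ := mem_comap.1 h1
  obtain ⟨r, hr, hrT⟩ := Metric.mem_nhds_iff.1 hT
  refine ⟨r, hr, fun x hx => ?_⟩
  have : p x ∈ p '' O := hTO (hrT (by rw [Metric.mem_ball, dist_eq_norm]; exact hx))
  exact this

variable [IsTopologicalGroup G]

theorem locallyCompactSpace_of_isCoveringMap (hp : IsCoveringMap p) : LocallyCompactSpace G := by
  obtain ⟨e, he, -⟩ := hp.isLocalHomeomorph (1 : G)
  have ht : e.target ∈ 𝓝 (e 1) := e.open_target.mem_nhds (e.map_source he)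
  obtain ⟨K, hK, hKt, hKc⟩ := local_compact_nhds ht
  refine IsCompact.locallyCompactSpace_of_mem_nhds_of_group (K := e.symm '' K)
    (hKc.image_of_continuousOn (e.continuousOn_symm.mono hKt)) (x := 1) ?_
  have h1 : e ⁻¹' K ∩ e.source ∈ 𝓝 (1 : G) :=
    inter_mem ((e.continuousAt he).preimage_mem_nhds hK) (e.open_source.mem_nhds he)
  refine mem_of_superset h1 fun g hg => ⟨e g, hg.1, e.left_inv hg.2⟩

theorem exists_injOn_isCompact_isClosed_mem_nhds (hp : IsCoveringMap p) :
    ∃ C ∈ 𝓝 (1 : G), IsCompact C ∧ IsClosed C ∧ Set.InjOn p C := by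
  have := locallyCompactSpace_of_isCoveringMap hp
  obtain ⟨e, he, hpe⟩ := hp.isLocalHomeomorph (1 : G)
  obtain ⟨K, hK, hKc, hKcl⟩ := exists_mem_nhds_isCompact_isClosed (1 : G)
  obtain ⟨F, hF, hFcl, hFs⟩ := exists_mem_nhds_isClosed_subset (e.open_source.mem_nhds he)
  refine ⟨F ∩ K, inter_mem hF hK, hKc.inter_left hFcl, hFcl.inter hKcl, ?_⟩
  rw [hpe]
  exact e.injOn.mono (Set.inter_subset_left.trans hFs)

theorem exists_isSheet [MeasurableSpace G] [BorelSpace G] (hp : IsCoveringMap p) :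
    ∃ C r, IsSheet (matHom p) C r := by
  obtain ⟨C, hC, hCc, hCcl, hinj⟩ := exists_injOn_isCompact_isClosed_mem_nhds hp
  obtain ⟨V, hVo, hV1, hVV⟩ := exists_open_nhds_one_mul_subset hC
  have hVC : V ⊆ C := fun x hx => by
    have := hVV (Set.mul_mem_mul hV1 hx)
    rwa [one_mul] at this
  obtain ⟨r, hr, hrV⟩ := exists_eq_of_norm_matHom_sub_lt hp (hVo.mem_nhds hV1)
  refine ⟨C, r, hCc, hCcl.measurableSet, hC, ?_, fun O hO => ?_, hr⟩
  · filter_upwards [hVo.mem_nhds hV1] with h hh g hg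
    obtain ⟨k, hk, hkg⟩ := hrV _ hg
    have hhk : h * k ∈ C := hVV (Set.mul_mem_mul hh hk)
    refine ⟨fun hgC => ?_, fun hgC => ?_⟩
    · rwa [hinj (hVC hk) hgC hkg, mul_inv_cancel_left] at hhk
    · have hg : h * k = g := hinj hhk hgC (by simp [hkg])
      rw [← hg, inv_mul_cancel_left]
      exact hVC hk
  · obtain ⟨δ, hδ, hδO⟩ := exists_eq_of_norm_matHom_sub_lt hp (inter_mem hO hC)
    refine ⟨δ, hδ, fun g hg hgδ => ?_⟩
    obtain ⟨k, hk, hkg⟩ := hδO g hgδ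
    rw [← hinj hk.2 hg hkg]
    exact hk.1

theorem matHom_oneParam_inv (hp : IsCoveringMap p) (X : so n) (t : ℝ) :
    matHom p (oneParam hp X t)⁻¹ = NormedSpace.exp (t • (-X.1)) := by
  change mat (p (oneParam hp X t)⁻¹) = _
  rw [← oneParam_neg, mat_oneParam, neg_smul, smul_neg]

theorem contDiff_matrix_exp {m : ℕ} : ContDiff ℝ ∞
    (NormedSpace.exp : Matrix (Fin m) (Fin m) ℝ → Matrix (Fin m) (Fin m) ℝ) := by
  have h : ∀ x : Matrix (Fin m) (Fin m) ℝ, AnalyticAt ℝ NormedSpace.exp x := fun x =>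
    NormedSpace.exp_analytic x
  exact contDiff_iff_contDiffAt.2 fun x => (h x).contDiffAt

section Vectors

variable [MeasurableSpace G] [BorelSpace G] {μ : Measure G} [μ.IsHaarMeasure] {C : Set G} {r : ℝ}

theorem gardingVector_mem_smoothVectors (hp : IsCoveringMap p) (U : UnitaryRep G H)
    (hC : IsSheet (matHom p) C r) {Φ : Matrix (Fin (n + 2)) (Fin (n + 2)) ℝ → ℝ}
    (hΦ : ContDiff ℝ ∞ Φ) (hs : tsupport Φ ⊆ Metric.ball 1 r) (v : H) :
    gardingVector μ U (matHom p) C Φ v ∈ smoothVectors hp U := by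
  have hm := continuous_matHom hp.continuous
  have h1 := eventually_op_gardingVector (μ := μ) hC hm U hΦ.continuous hs v
  have hc := (continuous_oneParam_ofCoef (n := n) hp).tendsto 0
  simp only [map_zero, oneParam_zero_left] at hc
  have h2 := hc.eventually h1
  let ℓ : (Fin (n + 2) → Fin (n + 2) → ℝ) →ₗ[ℝ] Matrix (Fin (n + 2)) (Fin (n + 2)) ℝ :=
    -((so n).toSubmodule.subtype ∘ₗ ofCoef)
  have hℓ : ContDiff ℝ ∞ ℓ := (LinearMap.toContinuousLinearMap ℓ).contDiff
  have h3 : ContDiff ℝ ∞ fun c : Fin (n + 2) → Fin (n + 2) → ℝ =>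
      ∫ g in C, Φ (NormedSpace.exp (ℓ c) * matHom p g) • U.op g v ∂μ :=
    (contDiff_translate_gardingVector (μ := μ) hC hm U hΦ v).comp (contDiff_matrix_exp.comp hℓ)
  refine h3.contDiffAt.congr_of_eventuallyEq ?_
  filter_upwards [h2] with c hc
  rw [ofCoef_apply] at hc
  rw [hc, ← ofCoef_apply, matHom_oneParam_inv, one_smul]
  rfl

theorem gardingVector_mem_diffVectors (hp : IsCoveringMap p) (U : UnitaryRep G H)
    (hC : IsSheet (matHom p) C r) {Φ : Matrix (Fin (n + 2)) (Fin (n + 2)) ℝ → ℝ}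
    (hΦ : ContDiff ℝ ∞ Φ) (hs : tsupport Φ ⊆ Metric.ball 1 r) (v : H) (k : ℕ) :
    gardingVector μ U (matHom p) C Φ v ∈ diffVectors hp U k := by
  induction k generalizing Φ with
  | zero => exact Submodule.mem_top
  | succ k ih =>
    have hm := continuous_matHom hp.continuous
    obtain ⟨L, hL, hLB⟩ := hasFDerivAt_translate_gardingVector (μ := μ) hC hm U hΦ v
    have h1 := eventually_op_gardingVector (μ := μ) hC hm U hΦ.continuous hs v
    refine ⟨-(L.toLinearMap ∘ₗ (so n).toSubmodule.subtype), fun X => ⟨?_, ?_⟩⟩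
    · have hc := (oneParam hp X).continuous.tendsto 0
      rw [oneParam_zero] at hc
      have h2 := hc.eventually h1
      have h3 : HasDerivAt (fun t : ℝ => NormedSpace.exp (t • (-X.1))) (-X.1) 0 := by
        have h := hasDerivAt_exp_smul_const (𝕂 := ℝ) (-X.1) 0
        refine HasDerivAt.congr_deriv h ?_
        rw [zero_smul, NormedSpace.exp_zero, one_mul]
      have h0 : HasFDerivAt (fun A => ∫ g in C, Φ (A * matHom p g) • U.op g v ∂μ) L
          (NormedSpace.exp ((0 : ℝ) • (-X.1))) := by
        rw [zero_smul, NormedSpace.exp_zero]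
        exact hL
      have h4 := h0.comp_hasDerivAt (0 : ℝ) h3
      refine (h4.congr_of_eventuallyEq ?_).congr_deriv ?_
      · filter_upwards [h2] with t ht
        rw [ht, matHom_oneParam_inv]
        rfl
      · rw [map_neg]
        rfl
    · have h5 : (-(L.toLinearMap ∘ₗ (so n).toSubmodule.subtype)) X = L (-X.1) := by simp
      rw [h5, hLB]
      exact ih (contDiff_weightDeriv _ hΦ) ((tsupport_weightDeriv_subset _ _).trans hs)

end Vectors

theorem dense_of_gardingVector_mem (hp : IsCoveringMap p) (U : UnitaryRep G H) (K : Set H)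
    (hK : ∀ [MeasurableSpace G] [BorelSpace G] (μ : Measure G) [μ.IsHaarMeasure]
      (C : Set G) (r : ℝ),
      IsSheet (matHom p) C r → ∀ Φ : Matrix (Fin (n + 2)) (Fin (n + 2)) ℝ → ℝ, ContDiff ℝ ∞ Φ →
      tsupport Φ ⊆ Metric.ball 1 r → ∀ v, gardingVector μ U (matHom p) C Φ v ∈ K) : Dense K := by
  let _ : MeasurableSpace G := borel G
  have : BorelSpace G := ⟨rfl⟩
  have := locallyCompactSpace_of_isCoveringMap hp
  obtain ⟨C, r, hC⟩ := exists_isSheet hp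
  refine Metric.dense_iff.2 fun v ε hε => ?_
  obtain ⟨Φ, hΦ, hs, hv⟩ := exists_gardingVector_norm_sub_le (μ := Measure.haar) hC
    (continuous_matHom hp.continuous) U v (half_pos hε)
  refine ⟨_, ?_, hK Measure.haar C r hC Φ hΦ hs v⟩
  rw [Metric.mem_ball, dist_eq_norm]
  linarith

theorem dense_smoothVectors (hp : IsCoveringMap p) (U : UnitaryRep G H) :
    Dense (smoothVectors hp U : Set H) :=
  dense_of_gardingVector_mem hp U _ fun _ _ _ _ hC _ hΦ hs v =>
    gardingVector_mem_smoothVectors hp U hC hΦ hs v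

theorem dense_smoothCore (hp : IsCoveringMap p) (U : UnitaryRep G H) :
    Dense (smoothCore hp U : Set H) :=
  dense_of_gardingVector_mem hp U _ fun _ _ _ _ hC _ hΦ hs v =>
    (mem_smoothCore hp U _).2 fun k => gardingVector_mem_diffVectors hp U hC hΦ hs v k

end Density

section SmoothVectors

variable {n : ℕ} {G : Type*} [Group G] [TopologicalSpace G] {p : G →* SO0 n}
  {H : Type*} [NormedAddCommGroup H] [InnerProductSpace ℂ H] [CompleteSpace H]

theorem hasDerivAt_of_mem_smoothVectors (hp : IsCoveringMap p) (U : UnitaryRep G H) {v : H}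
    (hv : v ∈ smoothVectors hp U) (X : so n) :
    HasDerivAt (fun t : ℝ => U.op (oneParam hp X t) v)
      (deriv (fun t : ℝ => U.op (oneParam hp X t) v) 0) 0 := by
  have hv' : ContDiffAt ℝ ∞ (fun c => U.op (oneParam hp (ofCoef c) 1) v) ((0 : ℝ) • coef X) := by
    rw [zero_smul]; exact hv
  have h1 := hv'.differentiableAt (by simp)
  have h2 : DifferentiableAt ℝ (fun t : ℝ => t • coef X) 0 := by fun_prop
  have h3 : DifferentiableAt ℝ
    (fun t : ℝ => U.op (oneParam hp (ofCoef (t • coef X)) 1) v) 0 :=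
    DifferentiableAt.comp (g := fun c => U.op (oneParam hp (ofCoef c) 1) v) (0 : ℝ) h1 h2
  simp only [map_smul, ofCoef_coef, oneParam_smul, mul_one] at h3
  exact h3.hasDerivAt

theorem op_mem_smoothVectors [IsTopologicalGroup G] (hp : IsCoveringMap p) (U : UnitaryRep G H)
    (g : G) {v : H} (hv : v ∈ smoothVectors hp U) : U.op g v ∈ smoothVectors hp U := by
  let ℓ : (Fin (n + 2) → Fin (n + 2) → ℝ) →ₗ[ℝ] (Fin (n + 2) → Fin (n + 2) → ℝ) :=
    coef ∘ₗ Ad p g⁻¹ ∘ₗ ofCoef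
  have hℓ : ContDiff ℝ ∞ ℓ := (LinearMap.toContinuousLinearMap ℓ).contDiff
  have hv' : ContDiffAt ℝ ∞ (fun c => U.op (oneParam hp (ofCoef c) 1) v) (ℓ 0) := by
    rw [map_zero]; exact hv
  have h1 : ContDiffAt ℝ ∞ (fun c => U.op g (U.op (oneParam hp (ofCoef (ℓ c)) 1) v)) 0 :=
    ((U.op g).restrictScalars ℝ).contDiff.contDiffAt.comp 0 (hv'.comp 0 hℓ.contDiffAt)
  refine h1.congr_of_eventuallyEq (Eventually.of_forall fun c => ?_)
  simp only [ℓ, LinearMap.comp_apply, ofCoef_coef, oneParam_Ad, ← U.op_mul, ← ofCoef_apply]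
  congr 1
  group

end SmoothVectors

/-! ### The Lie algebra action on vectors of class `C^∞` -/

section LieAct

variable {n : ℕ} {G : Type*} [Group G] [TopologicalSpace G] {p : G →* SO0 n}
  {H : Type*} [NormedAddCommGroup H] [InnerProductSpace ℂ H] [CompleteSpace H]

theorem exists_hasDerivAt_mem_smoothCore (hp : IsCoveringMap p) (U : UnitaryRep G H)
    (v : smoothCore hp U) : ∃ L : so n →ₗ[ℝ] smoothCore hp U, ∀ X,
      HasDerivAt (fun t : ℝ => U.op (oneParam hp X t) (v : H)) (L X : H) 0 := by
  obtain ⟨L, hL⟩ := exists_linear_of_mem_smoothCore hp U v.2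
  exact ⟨L.codRestrict ((smoothCore hp U).restrictScalars ℝ) fun X => (hL X).2, fun X => (hL X).1⟩

/-- The differential of `U`: the action of `so(2,n)` on the space of vectors of class `C^∞`. -/
def lieAct (hp : IsCoveringMap p) (U : UnitaryRep G H) :
    so n →ₗ[ℝ] Module.End ℂ (smoothCore hp U) :=
  have hL := fun v => (exists_hasDerivAt_mem_smoothCore hp U v).choose_spec
  { toFun X :=
      { toFun v := (exists_hasDerivAt_mem_smoothCore hp U v).choose X
        map_add' v w := Subtype.ext ((hL (v + w) X).unique
          (by simpa only [Submodule.coe_add, map_add] using (hL v X).fun_add (hL w X)))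
        map_smul' c v := Subtype.ext ((hL (c • v) X).unique
          (by simpa only [Submodule.coe_smul, map_smul, RingHom.id_apply] using
            (hL v X).fun_const_smul c)) }
    map_add' X Y := LinearMap.ext fun v =>
      (exists_hasDerivAt_mem_smoothCore hp U v).choose.map_add X Y
    map_smul' r X := LinearMap.ext fun v =>
      (exists_hasDerivAt_mem_smoothCore hp U v).choose.map_smul r X }

theorem hasDerivAt_lieAct (hp : IsCoveringMap p) (U : UnitaryRep G H) (X : so n)
    (v : smoothCore hp U) :
    HasDerivAt (fun t : ℝ => U.op (oneParam hp X t) (v : H)) (lieAct hp U X v : H) 0 :=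
  (exists_hasDerivAt_mem_smoothCore hp U v).choose_spec X

theorem lieAct_eq_of_hasDerivAt (hp : IsCoveringMap p) (U : UnitaryRep G H) {X : so n}
    {v : smoothCore hp U} {w : H}
    (h : HasDerivAt (fun t : ℝ => U.op (oneParam hp X t) (v : H)) w 0) :
    (lieAct hp U X v : H) = w := (hasDerivAt_lieAct hp U X v).unique h

theorem lieAct_smul (hp : IsCoveringMap p) (U : UnitaryRep G H) (r : ℝ) (X : so n) :
    lieAct hp U (r • X) = (r : ℂ) • lieAct hp U X := by
  ext v
  rw [map_smul]
  exact (Complex.coe_smul r _).symm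

theorem inner_lieAct_left (hp : IsCoveringMap p) (U : UnitaryRep G H) (X : so n)
    (v w : smoothCore hp U) :
    inner ℂ (lieAct hp U X v : H) (w : H) = -inner ℂ (v : H) (lieAct hp U X w : H) :=
  eq_neg_of_add_eq_zero_left (inner_add_inner_eq_zero_of_hasDerivAt hp U
    (hasDerivAt_lieAct hp U X v) (hasDerivAt_lieAct hp U X w))

theorem hasDerivAt_op_oneParam_linear (hp : IsCoveringMap p) (U : UnitaryRep G H) (X : so n)
    (L : so n →ₗ[ℝ] smoothCore hp U) {Z : ℝ → so n} {Z' : so n}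
    (hZ : ∀ a b, HasDerivAt (fun t => coef (Z t) a b) (coef Z' a b) 0) :
    HasDerivAt (fun t : ℝ => U.op (oneParam hp X t) (L (Z t) : H))
      (lieAct hp U X (L (Z 0)) + L Z' : H) 0 := by
  have hsum := HasDerivAt.fun_sum (u := Finset.univ) fun a _ =>
    HasDerivAt.fun_sum (u := Finset.univ) fun b _ =>
      (hZ a b).smul (hasDerivAt_lieAct hp U X (L (M a b)))
  let ι : smoothCore hp U →ₗ[ℝ] H := (smoothCore hp U).subtype.restrictScalars ℝ
  refine (hsum.congr_of_eventuallyEq (Eventually.of_forall fun t => ?_)).congr_deriv ?_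
  · exact linearMap_eq_sum_coef
      (((U.op (oneParam hp X t)).restrictScalars ℝ).toLinearMap ∘ₗ ι ∘ₗ L) (Z t)
  · simp only [oneParam_zero, U.op_one, Finset.sum_add_distrib]
    congr 1
    · exact (linearMap_eq_sum_coef
        (ι ∘ₗ (lieAct hp U X).restrictScalars ℝ ∘ₗ L) (Z 0)).symm
    · exact (linearMap_eq_sum_coef (ι ∘ₗ L) Z').symm

variable [IsTopologicalGroup G]

/-- The restriction of `U` to the space of vectors of class `C^∞`. -/
def coreRep (hp : IsCoveringMap p) (U : UnitaryRep G H) :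
    Representation ℂ G (smoothCore hp U) where
  toFun g := (U.op g).toLinearMap.restrict fun _ hv => op_mem_smoothCore hp U g hv
  map_one' := LinearMap.ext fun v => Subtype.ext (U.op_one v)
  map_mul' g h := LinearMap.ext fun v => Subtype.ext (U.op_mul g h v)

theorem coe_coreRep (hp : IsCoveringMap p) (U : UnitaryRep G H) (g : G) (v : smoothCore hp U) :
    (coreRep hp U g v : H) = U.op g v := rfl

theorem lieAct_coreRep (hp : IsCoveringMap p) (U : UnitaryRep G H) (g : G) (X : so n)
    (v : smoothCore hp U) :
    lieAct hp U X (coreRep hp U g v) = coreRep hp U g (lieAct hp U (Ad p g⁻¹ X) v) :=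
  Subtype.ext (lieAct_eq_of_hasDerivAt hp U
    (hasDerivAt_op_oneParam_op hp U g (hasDerivAt_lieAct hp U _ v)))

theorem hasDerivAt_lieAct_coreRep_sub_lie (hp : IsCoveringMap p) (U : UnitaryRep G H)
    (X Z : so n) (v : smoothCore hp U) :
    HasDerivAt (fun t : ℝ => (lieAct hp U Z (coreRep hp U (oneParam hp X t) v) : H))
      (lieAct hp U X (lieAct hp U Z v) - lieAct hp U ⁅X, Z⁆ v : H) 0 := by
  have hinv : ∀ t, (oneParam hp X t)⁻¹ = oneParam hp (-X) t := fun t => by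
    rw [← oneParam_neg, ← neg_one_smul ℝ X, oneParam_smul, neg_one_mul]
  have h := hasDerivAt_op_oneParam_linear hp U X (LinearMap.applyₗ' ℝ v ∘ₗ lieAct hp U)
    (hasDerivAt_coef_Ad hp (-X) Z)
  simp only [lieAct_coreRep, hinv, coe_coreRep]
  refine h.congr_deriv ?_
  simp only [LinearMap.comp_apply, LinearMap.applyₗ'_apply_apply, oneParam_zero, Ad_one, neg_lie,
    map_neg, Submodule.coe_neg, sub_eq_add_neg]

theorem lieAct_lie (hp : IsCoveringMap p) (U : UnitaryRep G H) (X Z : so n) :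
    lieAct hp U ⁅X, Z⁆ = lieAct hp U X * lieAct hp U Z - lieAct hp U Z * lieAct hp U X := by
  ext v
  have hZX : (lieAct hp U Z (lieAct hp U X v) : H) =
      (lieAct hp U X (lieAct hp U Z v) : H) - lieAct hp U ⁅X, Z⁆ v := by
    refine (dense_smoothCore hp U).eq_of_inner_right (𝕜 := ℂ) fun w hw => ?_
    have hleft := (hasDerivAt_const (0 : ℝ) w).inner ℂ
      (hasDerivAt_lieAct_coreRep_sub_lie hp U X Z v)
    have hright := ((hasDerivAt_const (0 : ℝ) (lieAct hp U Z ⟨w, hw⟩ : H)).inner ℂ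
      (hasDerivAt_lieAct hp U X v)).fun_neg
    have huniq := hleft.unique (hright.congr_of_eventuallyEq (Eventually.of_forall fun t => by
      simp only [← coe_coreRep, inner_lieAct_left hp U Z ⟨w, hw⟩, neg_neg]))
    simp only [inner_zero_left, add_zero] at huniq
    rw [huniq, inner_lieAct_left hp U Z ⟨w, hw⟩, neg_neg]
  simp only [LinearMap.sub_apply, Module.End.mul_apply, Submodule.coe_sub]
  rw [hZX]
  abel

theorem hasDerivAt_lieAct_coreRep (hp : IsCoveringMap p) (U : UnitaryRep G H) (X Z : so n)
    (v : smoothCore hp U) :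
    HasDerivAt (fun t : ℝ => (lieAct hp U Z (coreRep hp U (oneParam hp X t) v) : H))
      (lieAct hp U Z (lieAct hp U X v) : H) 0 := by
  refine (hasDerivAt_lieAct_coreRep_sub_lie hp U X Z v).congr_deriv ?_
  rw [lieAct_lie]
  simp

end LieAct

/-! ### Averages over a one-parameter subgroup -/

section Average

open MeasureTheory

variable {n : ℕ} {G : Type*} [Group G] [TopologicalSpace G] {p : G →* SO0 n}
  {H : Type*} [NormedAddCommGroup H] [InnerProductSpace ℂ H] [CompleteSpace H]

/-- The average of `t ↦ U(exp(tY)) v` over `[-π, π]` with weight `c`. -/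
def orbitAverage (hp : IsCoveringMap p) (U : UnitaryRep G H) (Y : so n) (c : ℝ → ℂ) (v : H) : H :=
  ∫ t in (-Real.pi)..Real.pi, c t • U.op (oneParam hp Y t) v

theorem smul_op_linear_eq_sum (hp : IsCoveringMap p) (U : UnitaryRep G H) (Y X : so n) (c : ℝ → ℂ)
    (L : so n →ₗ[ℝ] H) (t : ℝ) :
    c t • U.op (oneParam hp Y t) (L (Ad p (oneParam hp Y t)⁻¹ X)) =
      ∑ a, ∑ b, (c t * (coef (Ad p (oneParam hp Y t)⁻¹ X) a b : ℂ)) •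
        U.op (oneParam hp Y t) (L (M a b)) := by
  rw [linearMap_eq_sum_coef L]
  simp only [map_sum, Finset.smul_sum, mul_smul]
  refine Finset.sum_congr rfl fun a _ => Finset.sum_congr rfl fun b _ => ?_
  rw [← Complex.coe_smul, map_smul]

/-- The weights `e^{-iλt} ((1 + cos t) / 2)^k`, which single out the weights near `λ` and peak at
`t = 0`. -/
def cosWeight (l : ℝ) (k : ℕ) (t : ℝ) : ℂ :=
  Complex.exp (-(Complex.I * l * t)) * (((1 + Real.cos t) / 2) ^ k : ℝ)

theorem continuous_cosWeight (l : ℝ) (k : ℕ) : Continuous (cosWeight l k) := by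
  unfold cosWeight
  fun_prop

/-- The weight `cosWeight` normalized so that it concentrates at `t = 0` as `k → ∞`. -/
def peakWeight (l : ℝ) (k : ℕ) : ℝ → ℂ :=
  ((∫ x in Set.Icc (-Real.pi) Real.pi, ((1 + Real.cos x) / 2) ^ k : ℝ) : ℂ)⁻¹ • cosWeight l k

theorem continuous_peakWeight (l : ℝ) (k : ℕ) : Continuous (peakWeight l k) :=
  (continuous_cosWeight l k).const_smul _

theorem tendsto_integral_peakWeight (l : ℝ) {f : ℝ → H} (hf : Continuous f) :
    Tendsto (fun k => ∫ t in (-Real.pi)..Real.pi, peakWeight l k t • f t) atTop (𝓝 (f 0)) := by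
  have hpi := Real.pi_pos
  have h := tendsto_setIntegral_pow_smul_of_unique_maximum_of_isCompact_of_continuousOn
    (μ := volume) (s := Set.Icc (-Real.pi) Real.pi) (x₀ := (0 : ℝ))
    (c := fun t : ℝ => (1 + Real.cos t) / 2)
    (g := fun t : ℝ => Complex.exp (-(Complex.I * l * t)) • f t) isCompact_Icc
    (by fun_prop) ?_ ?_ ?_ ?_
    (Continuous.continuousOn (by fun_prop))
  · simp only [Complex.ofReal_zero, mul_zero, neg_zero, Complex.exp_zero, one_smul] at h
    refine h.congr fun k => ?_
    rw [intervalIntegral.integral_of_le (by linarith), ← integral_Icc_eq_integral_Ioc,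
      ← integral_smul]
    refine integral_congr_ae (Eventually.of_forall fun t => ?_)
    simp only [peakWeight, cosWeight, Pi.smul_apply, smul_eq_mul]
    rw [← Complex.coe_smul, ← Complex.coe_smul, smul_smul, smul_smul, Complex.ofReal_inv]
    congr 1
    ring
  · intro y hy hy0
    have : Real.cos y < 1 := by
      refine lt_of_le_of_ne (Real.cos_le_one y) fun hcos => hy0 ?_
      exact (Real.cos_eq_one_iff_of_lt_of_lt (by linarith [hy.1]) (by linarith [hy.2])).1 hcos
    simp only [Real.cos_zero]
    linarith
  · intro x _
    linarith [Real.neg_one_le_cos x]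
  · simp
  · rw [interior_Icc, closure_Ioo (by linarith)]
    constructor <;> linarith

theorem tendsto_orbitAverage_peakWeight (hp : IsCoveringMap p) (U : UnitaryRep G H) (Y : so n)
    (l : ℝ) (v : H) :
    Tendsto (fun k => orbitAverage hp U Y (peakWeight l k) v) atTop (𝓝 v) := by
  have h := tendsto_integral_peakWeight l (U.continuous_op_oneParam hp Y v)
  rwa [oneParam_zero, U.op_one] at h

theorem orbitAverage_add (hp : IsCoveringMap p) (U : UnitaryRep G H) (Y : so n) {c d : ℝ → ℂ}
    (hc : Continuous c) (hd : Continuous d) (v : H) :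
    orbitAverage hp U Y (c + d) v = orbitAverage hp U Y c v + orbitAverage hp U Y d v := by
  have hint {c : ℝ → ℂ} (hc : Continuous c) : IntervalIntegrable
      (fun t => c t • U.op (oneParam hp Y t) v) volume (-Real.pi) Real.pi :=
    (hc.smul (U.continuous_op_oneParam hp Y v)).intervalIntegrable _ _
  simp only [orbitAverage, Pi.add_apply, add_smul]
  exact intervalIntegral.integral_add (hint hc) (hint hd)

theorem orbitAverage_smul (hp : IsCoveringMap p) (U : UnitaryRep G H) (Y : so n) (r : ℂ)
    (c : ℝ → ℂ) (v : H) : orbitAverage hp U Y (r • c) v = r • orbitAverage hp U Y c v := by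
  simp only [orbitAverage, Pi.smul_apply, smul_assoc]
  exact intervalIntegral.integral_smul _ _

variable [IsTopologicalGroup G]

theorem continuous_coef_Ad_oneParam_inv (hp : IsCoveringMap p) (Y X : so n) (a b : Fin (n + 2)) :
    Continuous fun t : ℝ => coef (Ad p (oneParam hp Y t)⁻¹ X) a b :=
  (continuous_coef_Ad hp.continuous X a b).comp (oneParam hp Y).continuous.inv

theorem continuous_smul_op_linear (hp : IsCoveringMap p) (U : UnitaryRep G H) (Y X : so n)
    {c : ℝ → ℂ} (hc : Continuous c) (L : so n →ₗ[ℝ] H) :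
    Continuous fun t : ℝ => c t • U.op (oneParam hp Y t) (L (Ad p (oneParam hp Y t)⁻¹ X)) := by
  simp only [smul_op_linear_eq_sum]
  refine continuous_finsetSum _ fun a _ => continuous_finsetSum _ fun b _ => ?_
  exact (hc.mul (Complex.continuous_ofReal.comp
    (continuous_coef_Ad_oneParam_inv hp Y X a b))).smul (U.continuous_op_oneParam hp Y _)

/-- The differential of `X ↦ U(exp(sX))` at the average of `t ↦ U(exp(tY)) v`, when `L` is the one
at `v`. -/
def orbitAverageDiff (hp : IsCoveringMap p) (U : UnitaryRep G H) (Y : so n) {c : ℝ → ℂ}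
    (hc : Continuous c) (L : so n →ₗ[ℝ] H) : so n →ₗ[ℝ] H where
  toFun X := ∫ t in (-Real.pi)..Real.pi,
    c t • U.op (oneParam hp Y t) (L (Ad p (oneParam hp Y t)⁻¹ X))
  map_add' X X' := by
    rw [← intervalIntegral.integral_add
      ((continuous_smul_op_linear hp U Y X hc L).intervalIntegrable _ _)
      ((continuous_smul_op_linear hp U Y X' hc L).intervalIntegrable _ _)]
    simp only [map_add, smul_add]
  map_smul' r X := by
    rw [RingHom.id_apply, ← intervalIntegral.integral_smul]
    refine intervalIntegral.integral_congr fun t _ => ?_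
    simp only [map_smul]
    rw [smul_comm, ← Complex.coe_smul, map_smul, Complex.coe_smul]

theorem orbitAverageDiff_eq_sum (hp : IsCoveringMap p) (U : UnitaryRep G H) (Y X : so n)
    {c : ℝ → ℂ} (hc : Continuous c) (L : so n →ₗ[ℝ] H) :
    orbitAverageDiff hp U Y hc L X = ∑ a, ∑ b, orbitAverage hp U Y
      (fun t => c t * (coef (Ad p (oneParam hp Y t)⁻¹ X) a b : ℂ)) (L (M a b)) := by
  have hcont : ∀ a b, Continuous fun t : ℝ => (c t * (coef (Ad p (oneParam hp Y t)⁻¹ X) a b : ℂ)) •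
      U.op (oneParam hp Y t) (L (M a b)) := fun a b =>
    (hc.mul (Complex.continuous_ofReal.comp (continuous_coef_Ad_oneParam_inv hp Y X a b))).smul
      (U.continuous_op_oneParam hp Y _)
  simp only [orbitAverageDiff, LinearMap.coe_mk, AddHom.coe_mk, smul_op_linear_eq_sum, orbitAverage]
  rw [intervalIntegral.integral_finsetSum fun a _ =>
    (continuous_finsetSum _ fun b _ => hcont a b).intervalIntegrable _ _]
  exact Finset.sum_congr rfl fun a _ =>
    intervalIntegral.integral_finsetSum fun b _ => (hcont a b).intervalIntegrable _ _

theorem hasDerivAt_orbitAverage (hp : IsCoveringMap p) (U : UnitaryRep G H) (Y X : so n)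
    {c : ℝ → ℂ} (hc : Continuous c) {v : H} {L : so n →ₗ[ℝ] H}
    (hL : ∀ X, HasDerivAt (fun t : ℝ => U.op (oneParam hp X t) v) (L X) 0) :
    HasDerivAt (fun s : ℝ => U.op (oneParam hp X s) (orbitAverage hp U Y c v))
      (orbitAverageDiff hp U Y hc L X) 0 := by
  let f : ℝ → H := fun t => c t • U.op (oneParam hp Y t) v
  let f' : ℝ → H := fun t => c t • U.op (oneParam hp Y t) (L (Ad p (oneParam hp Y t)⁻¹ X))
  have hf : Continuous f := hc.smul (U.continuous_op_oneParam hp Y v)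
  have hf' : Continuous f' := continuous_smul_op_linear hp U Y X hc L
  have hdiff : ∀ t s, HasDerivAt (fun s : ℝ => U.op (oneParam hp X s) (f t))
      (U.op (oneParam hp X s) (f' t)) s := fun t s => by
    have hvec := hasDerivAt_op_oneParam_op hp U (oneParam hp Y t) (hL (Ad p (oneParam hp Y t)⁻¹ X))
    simpa only [f, f', map_smul] using (hasDerivAt_op_oneParam hp U hvec s).fun_const_smul (c t)
  have h := (intervalIntegral.hasDerivAt_integral_of_dominated_loc_of_deriv_le
    (μ := volume) (a := -Real.pi) (b := Real.pi) (x₀ := 0) (s := Set.univ)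
    (F := fun s t => U.op (oneParam hp X s) (f t)) (F' := fun s t => U.op (oneParam hp X s) (f' t))
    (bound := fun t => ‖f' t‖) univ_mem
    (Eventually.of_forall fun s => ((U.op _).continuous.comp hf).aestronglyMeasurable)
    (((U.op _).continuous.comp hf).intervalIntegrable _ _)
    ((U.op _).continuous.comp hf').aestronglyMeasurable
    (Eventually.of_forall fun t _ s _ => (U.norm_op _ _).le) (hf'.norm.intervalIntegrable _ _)
    (Eventually.of_forall fun t _ s _ => hdiff t s)).2
  refine (h.congr_of_eventuallyEq (Eventually.of_forall fun s => ?_)).congr_deriv ?_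
  · exact (ContinuousLinearMap.intervalIntegral_comp_comm _ (hf.intervalIntegrable _ _)).symm
  · simp only [oneParam_zero, U.op_one]
    rfl

theorem orbitAverage_mem_diffVectors (hp : IsCoveringMap p) (U : UnitaryRep G H) (Y : so n)
    (m : ℕ) {c : ℝ → ℂ} (hc : Continuous c) {v : H} (hv : v ∈ diffVectors hp U m) :
    orbitAverage hp U Y c v ∈ diffVectors hp U m := by
  induction m generalizing c v with
  | zero => exact Submodule.mem_top
  | succ m ih =>
    obtain ⟨L, hL⟩ := hv
    refine ⟨orbitAverageDiff hp U Y hc L, fun X =>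
      ⟨hasDerivAt_orbitAverage hp U Y X hc fun X => (hL X).1, ?_⟩⟩
    rw [orbitAverageDiff_eq_sum]
    exact sum_mem fun a _ => sum_mem fun b _ => ih (hc.mul (Complex.continuous_ofReal.comp
      (continuous_coef_Ad_oneParam_inv hp Y X a b))) (hL _).2

theorem orbitAverage_mem_smoothCore (hp : IsCoveringMap p) (U : UnitaryRep G H) (Y : so n)
    {c : ℝ → ℂ} (hc : Continuous c) {v : H} (hv : v ∈ smoothCore hp U) :
    orbitAverage hp U Y c v ∈ smoothCore hp U := by
  rw [mem_smoothCore] at hv ⊢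
  exact fun m => orbitAverage_mem_diffVectors hp U Y m hc (hv m)

theorem tendsto_lieAct_orbitAverage_peakWeight (hp : IsCoveringMap p) (U : UnitaryRep G H)
    (Y X : so n) (l : ℝ) (v : smoothCore hp U) :
    Tendsto (fun k => (lieAct hp U X ⟨orbitAverage hp U Y (peakWeight l k) v,
      orbitAverage_mem_smoothCore hp U Y (continuous_peakWeight l k) v.2⟩ : H)) atTop
      (𝓝 (lieAct hp U X v)) := by
  obtain ⟨L, hL⟩ := exists_linear_of_mem_smoothCore hp U v.2
  have hc := continuous_smul_op_linear hp U Y X (c := fun _ => 1) continuous_const L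
  simp only [one_smul] at hc
  have h := tendsto_integral_peakWeight l hc
  rw [oneParam_zero, inv_one, U.op_one, Ad_one] at h
  rw [lieAct_eq_of_hasDerivAt hp U (hL X).1]
  refine h.congr fun k => ?_
  exact (lieAct_eq_of_hasDerivAt hp U
    (v := ⟨_, orbitAverage_mem_smoothCore hp U Y (continuous_peakWeight l k) v.2⟩)
    (hasDerivAt_orbitAverage hp U Y X (continuous_peakWeight l k) fun X => (hL X).1)).symm

end Average

/-! ### Schur's lemma -/

section Schur

theorem cfc_ne_zero_of_mem_spectrum {A : Type*} {P : A → Prop} [Ring A] [StarRing A]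
    [TopologicalSpace A] [Algebra ℝ A] [ContinuousFunctionalCalculus ℝ A P] [Nontrivial A]
    {a : A} (ha : P a) {f : ℝ → ℝ} (hf : Continuous f) {x : ℝ} (hx : x ∈ spectrum ℝ a)
    (hfx : f x ≠ 0) : cfc f a ≠ 0 := by
  intro hzero
  have hmem : f x ∈ spectrum ℝ (cfc f a) := by
    rw [cfc_map_spectrum f a ha hf.continuousOn]
    exact ⟨x, hx, rfl⟩
  rw [hzero, spectrum.zero_eq] at hmem
  exact hfx hmem

variable {H : Type*} [NormedAddCommGroup H] [InnerProductSpace ℂ H]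

/-- The closure of the graph of an operator with domain `D`. -/
def graphClosure {D : Submodule ℂ H} (O : D →ₗ[ℂ] H) : Submodule ℂ (WithLp 2 (H × H)) :=
  (LinearMap.range ((WithLp.linearEquiv 2 ℂ (H × H)).symm.toLinearMap ∘ₗ
    D.subtype.prod O)).topologicalClosure

theorem toLp_mem_graphClosure {D : Submodule ℂ H} (O : D →ₗ[ℂ] H) (v : D) :
    WithLp.toLp 2 ((v : H), O v) ∈ graphClosure O :=
  Submodule.le_topologicalClosure _ ⟨v, rfl⟩

theorem mem_of_mem_graphClosure {D : Submodule ℂ H} {O : D →ₗ[ℂ] H} {s : Set (WithLp 2 (H × H))}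
    (hs : IsClosed s) (hmem : ∀ v : D, WithLp.toLp 2 ((v : H), O v) ∈ s) {x : WithLp 2 (H × H)}
    (hx : x ∈ graphClosure O) : x ∈ s := by
  refine closure_minimal ?_ hs hx
  rintro _ ⟨v, rfl⟩
  exact hmem v

theorem one_sub_mul_inner_eq_of_starProjection {K : Submodule ℂ (WithLp 2 (H × H))}
    [K.HasOrthogonalProjection] {β γ : ℂ}
    (hP : ∀ h : H, K.starProjection (WithLp.toLp 2 (h, 0)) = WithLp.toLp 2 (β • h, γ • h))
    {v w : H} (hvw : WithLp.toLp 2 (v, w) ∈ K) (h : H) :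
    (1 - β) * inner ℂ v h = γ * inner ℂ w h := by
  have hzero := Submodule.starProjection_inner_eq_zero (K := K) (WithLp.toLp 2 (h, 0)) _ hvw
  rw [← inner_conj_symm, map_eq_zero, hP, WithLp.prod_inner_apply] at hzero
  change inner ℂ v (h - β • h) + inner ℂ w (0 - γ • h) = 0 at hzero
  simp only [inner_sub_right, inner_smul_right, inner_zero_right] at hzero
  linear_combination hzero

variable [CompleteSpace H] {G : Type*} [Group G] [TopologicalSpace G]

theorem eq_zero_or_injective_of_commute (U : UnitaryRep G H) {T : Subgroup G}
    (hU : U.IsIrreducibleOn T) {B : H →L[ℂ] H} (hc : ∀ g ∈ T, Commute B (U.op g)) :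
    B = 0 ∨ Function.Injective B := by
  have hker := hU.2 (LinearMap.ker B.toLinearMap) B.isClosed_ker fun g hg v hv => by
    have h := congrArg (fun A : H →L[ℂ] H => A v) (hc g hg).eq
    simp only [mul_apply_eq_comp] at h
    simp only [LinearMap.mem_ker, ContinuousLinearMap.coe_coe] at hv ⊢
    rw [h, hv, map_zero]
  rcases hker with hbot | htop
  · exact Or.inr (LinearMap.ker_eq_bot.1 hbot)
  · exact Or.inl (ContinuousLinearMap.coe_injective (LinearMap.ker_eq_top.1 htop))

/- Two spectral values can be separated by functions `f`, `g` with `f * g = 0`; then `f(A)` and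
`g(A)` are nonzero members of the commutant with product zero. -/
theorem subsingleton_spectrum_of_commute (U : UnitaryRep G H) {T : Subgroup G}
    (hU : U.IsIrreducibleOn T) {A : H →L[ℂ] H} (hA : IsSelfAdjoint A)
    (hc : ∀ g ∈ T, Commute A (U.op g)) : (spectrum ℝ A).Subsingleton := by
  have := hU.1
  suffices hlt : ∀ x ∈ spectrum ℝ A, ∀ y ∈ spectrum ℝ A, ¬ x < y from fun x hx y hy =>
    le_antisymm (not_lt.1 (hlt y hy x hx)) (not_lt.1 (hlt x hx y hy))
  intro x hx y hy hxy
  let f : ℝ → ℝ := fun t => max 0 (t - (x + y) / 2)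
  let g : ℝ → ℝ := fun t => max 0 ((x + y) / 2 - t)
  have hf : Continuous f := by fun_prop
  have hg : Continuous g := by fun_prop
  have hfA : cfc f A ≠ 0 := cfc_ne_zero_of_mem_spectrum hA hf hy
    (lt_max_of_lt_right (by linarith)).ne'
  have hgA : cfc g A ≠ 0 := cfc_ne_zero_of_mem_spectrum hA hg hx
    (lt_max_of_lt_right (by linarith)).ne'
  have hfg : (fun t => f t * g t) = fun _ => 0 := by
    funext t
    simp only [f, g]
    rcases le_total t ((x + y) / 2) with h | h
    · rw [max_eq_left (by linarith), zero_mul]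
    · rw [max_eq_left (a := (0 : ℝ)) (b := (x + y) / 2 - t) (by linarith), mul_zero]
  have hmul : cfc f A * cfc g A = 0 := by
    rw [← cfc_mul f g A hf.continuousOn hg.continuousOn, hfg, cfc_const_zero]
  rcases eq_zero_or_injective_of_commute U hU (fun u hu => hA.commute_cfc (hc u hu) f) with h | hinj
  · exact hfA h
  · refine hgA (ContinuousLinearMap.ext fun v => hinj ?_)
    simpa using congrArg (fun B : H →L[ℂ] H => B v) hmul

theorem schur_of_isSelfAdjoint (U : UnitaryRep G H) {T : Subgroup G} (hU : U.IsIrreducibleOn T)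
    {A : H →L[ℂ] H} (hA : IsSelfAdjoint A) (hc : ∀ g ∈ T, Commute A (U.op g)) :
    ∃ c : ℝ, A = algebraMap ℝ (H →L[ℂ] H) c := by
  have := hU.1
  obtain ⟨c, hcA⟩ := ContinuousFunctionalCalculus.spectrum_nonempty (R := ℝ) A hA
  refine ⟨c, ?_⟩
  rw [← cfc_const c A hA]
  conv_lhs => rw [← cfc_id ℝ A hA]
  exact cfc_congr fun x hx => subsingleton_spectrum_of_commute U hU hA hc hx hcA

theorem schur (U : UnitaryRep G H) {T : Subgroup G} (hU : U.IsIrreducibleOn T)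
    {B : H →L[ℂ] H} (hc : ∀ g ∈ T, ∀ v, B (U.op g v) = U.op g (B v)) :
    ∃ c : ℂ, ∀ v, B v = c • v := by
  have hB : ∀ g ∈ T, Commute B (U.op g) := fun g hg => ContinuousLinearMap.ext fun v => hc g hg v
  have hstar : ∀ g, star (U.op g) = U.op g⁻¹ := fun g => by
    rw [UnitaryRep.op, UnitaryRep.op, map_inv]
    rfl
  have hB' : ∀ g ∈ T, Commute (star B) (U.op g) := fun g hg => by
    have h := (hB g⁻¹ (inv_mem hg)).star_star
    rwa [hstar, inv_inv] at h
  obtain ⟨a, ha⟩ := schur_of_isSelfAdjoint U hU (realPart B).2 fun g hg => by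
    rw [realPart_apply_coe]
    exact ((hB g hg).add_left (hB' g hg)).smul_left _
  obtain ⟨b, hb⟩ := schur_of_isSelfAdjoint U hU (imaginaryPart B).2 fun g hg => by
    rw [imaginaryPart_apply_coe]
    exact (((hB g hg).sub_left (hB' g hg)).smul_left _).smul_left _
  refine ⟨a + Complex.I * b, fun v => ?_⟩
  have hsum := congrArg (fun B : H →L[ℂ] H => B v) (realPart_add_I_smul_imaginaryPart B)
  rw [← hsum, ha, hb]
  simp only [add_apply, smul_apply, Algebra.algebraMap_eq_smul_one, one_apply_eq_self]
  rw [add_smul, mul_smul, Complex.coe_smul, Complex.coe_smul]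

/-- The operator `U(g) ⊕ U(g)` on the Hilbert sum `H ⊕ H`. -/
def doubleOp (U : UnitaryRep G H) (g : G) : WithLp 2 (H × H) →L[ℂ] WithLp 2 (H × H) :=
  (WithLp.prodContinuousLinearEquiv 2 ℂ H H).symm.toContinuousLinearMap ∘L
    ((U.op g).prodMap (U.op g)) ∘L
      (WithLp.prodContinuousLinearEquiv 2 ℂ H H).toContinuousLinearMap

theorem doubleOp_toLp (U : UnitaryRep G H) (g : G) (v w : H) :
    doubleOp U g (WithLp.toLp 2 (v, w)) = WithLp.toLp 2 (U.op g v, U.op g w) := rfl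

theorem inner_doubleOp_left (U : UnitaryRep G H) (g : G) (x y : WithLp 2 (H × H)) :
    inner ℂ (doubleOp U g x) y = inner ℂ x (doubleOp U g⁻¹ y) := by
  rw [WithLp.prod_inner_apply, WithLp.prod_inner_apply]
  exact congrArg₂ _ (U.inner_op_left _ _ _) (U.inner_op_left _ _ _)

theorem starProjection_doubleOp (U : UnitaryRep G H) {T : Subgroup G}
    {K : Submodule ℂ (WithLp 2 (H × H))} [K.HasOrthogonalProjection]
    (hK : ∀ g ∈ T, ∀ x ∈ K, doubleOp U g x ∈ K) {g : G} (hg : g ∈ T) (x : WithLp 2 (H × H)) :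
    K.starProjection (doubleOp U g x) = doubleOp U g (K.starProjection x) := by
  refine Submodule.eq_starProjection_of_mem_of_inner_eq_zero
    (hK g hg _ (Submodule.starProjection_apply_mem _ _)) fun w hw => ?_
  rw [← map_sub, inner_doubleOp_left]
  exact Submodule.starProjection_inner_eq_zero x _ (hK _ (inv_mem hg) w hw)

theorem exists_starProjection_toLp_eq (U : UnitaryRep G H) {T : Subgroup G}
    (hU : U.IsIrreducibleOn T) {K : Submodule ℂ (WithLp 2 (H × H))} [K.HasOrthogonalProjection]
    (hK : ∀ g ∈ T, ∀ x ∈ K, doubleOp U g x ∈ K) :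
    ∃ β γ : ℂ, ∀ h : H, K.starProjection (WithLp.toLp 2 (h, 0)) = WithLp.toLp 2 (β • h, γ • h) := by
  let ι : H →L[ℂ] WithLp 2 (H × H) :=
    (WithLp.prodContinuousLinearEquiv 2 ℂ H H).symm.toContinuousLinearMap ∘L
      ContinuousLinearMap.inl ℂ H H
  have hι : ∀ g ∈ T, ∀ h, K.starProjection (ι (U.op g h)) =
      doubleOp U g (K.starProjection (ι h)) := fun g hg h => by
    rw [← starProjection_doubleOp U hK hg]
    change _ = K.starProjection (doubleOp U g (WithLp.toLp 2 (h, 0)))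
    rw [doubleOp_toLp, map_zero]
    rfl
  obtain ⟨β, hβ⟩ := schur U hU (B := WithLp.fstL 2 ℂ H H ∘L K.starProjection ∘L ι)
    fun g hg h => congrArg WithLp.fst (hι g hg h)
  obtain ⟨γ, hγ⟩ := schur U hU (B := WithLp.sndL 2 ℂ H H ∘L K.starProjection ∘L ι)
    fun g hg h => congrArg WithLp.snd (hι g hg h)
  refine ⟨β, γ, fun h => ?_⟩
  rw [← hβ h, ← hγ h]
  rfl

/- The projection onto the closed graph of `O` has scalar blocks, so the graph is that of a scalar
or contains `H ⊕ 0`. -/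
theorem schur_of_symmetric (U : UnitaryRep G H) {T : Subgroup G} (hU : U.IsIrreducibleOn T)
    {D : Submodule ℂ H} {O : D →ₗ[ℂ] H}
    (hsymm : ∀ v w : D, inner ℂ (O v) (w : H) = inner ℂ (v : H) (O w))
    (hinv : ∀ g ∈ T, ∀ v : D, ∃ h : U.op g v ∈ D, O ⟨_, h⟩ = U.op g (O v)) :
    ∃ c : ℂ, ∀ v : D, O v = c • (v : H) := by
  have hclosed : IsClosed (graphClosure O : Set (WithLp 2 (H × H))) :=
    Submodule.isClosed_topologicalClosure _
  have : CompleteSpace (graphClosure O) := hclosed.completeSpace_coe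
  obtain ⟨β, γ, hP⟩ := exists_starProjection_toLp_eq U hU (K := graphClosure O) fun g hg x hx =>
    mem_of_mem_graphClosure (hclosed.preimage (doubleOp U g).continuous) (fun v => by
      obtain ⟨hgv, hO⟩ := hinv g hg v
      rw [Set.mem_preimage, doubleOp_toLp, ← hO]
      exact toLp_mem_graphClosure O ⟨_, hgv⟩) hx
  have horth := fun v => one_sub_mul_inner_eq_of_starProjection hP (toLp_mem_graphClosure O v)
  by_cases hγ : γ = 0
  · refine ⟨0, fun v => ?_⟩
    rw [zero_smul]
    rcases eq_or_ne (v : H) 0 with hv | hv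
    · rw [Submodule.coe_eq_zero.1 hv, map_zero]
    have hβ : β = 1 := by
      have h := horth v v
      rw [hγ, zero_mul, mul_eq_zero, or_iff_left (inner_self_ne_zero.2 hv)] at h
      exact (sub_eq_zero.1 h).symm
    have hmem : WithLp.toLp 2 (O v, (0 : H)) ∈ graphClosure O := by
      have h := Submodule.starProjection_apply_mem (graphClosure O) (WithLp.toLp 2 (O v, 0))
      rwa [hP, hβ, hγ, one_smul, zero_smul] at h
    have hOv := mem_of_mem_graphClosure
      (s := {x : WithLp 2 (H × H) | inner ℂ x.snd (v : H) = inner ℂ x.fst (O v)})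
      (isClosed_eq ((WithLp.sndL 2 ℂ H H).continuous.inner continuous_const)
        ((WithLp.fstL 2 ℂ H H).continuous.inner continuous_const)) (hsymm · v) hmem
    exact inner_self_eq_zero.1 (hOv.symm.trans (inner_zero_left _))
  · refine ⟨(starRingEnd ℂ) ((1 - β) / γ), fun v => ext_inner_right ℂ fun h => ?_⟩
    rw [inner_smul_left, Complex.conj_conj]
    have hvh := horth v h
    field_simp
    linear_combination -hvh

theorem isIrreducibleOn_of_forall_exists_smul [Nontrivial H] (U : UnitaryRep G H) {T : Subgroup G}
    (h : ∀ B : H →L[ℂ] H, (∀ g ∈ T, ∀ v, B (U.op g v) = U.op g (B v)) → ∃ z : ℂ, ∀ v, B v = z • v) :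
    U.IsIrreducibleOn T := by
  refine ⟨inferInstance, fun K hK hinv => ?_⟩
  have : CompleteSpace K := hK.completeSpace_coe
  have hinv_orthogonal : ∀ g ∈ T, ∀ v ∈ Kᗮ, U.op g v ∈ Kᗮ := fun g hg v hv =>
    (Submodule.mem_orthogonal' _ _).2 fun w hw => by
      rw [U.inner_op_left]
      exact (Submodule.mem_orthogonal' _ _).1 hv _ (hinv _ (inv_mem hg) w hw)
  obtain ⟨z, hz⟩ := h K.starProjection fun g hg v =>
    Submodule.eq_starProjection_of_mem_orthogonal (hinv g hg _ (K.starProjection_apply_mem v)) <| by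
      rw [← map_sub]
      exact hinv_orthogonal g hg _ (K.sub_starProjection_mem_orthogonal v)
  refine or_iff_not_imp_left.2 fun hbot => ?_
  obtain ⟨u, hu, hu0⟩ := K.ne_bot_iff.1 hbot
  have hz1 : (z - 1) • u = 0 := by
    rw [sub_smul, one_smul, ← hz, Submodule.starProjection_eq_self_iff.2 hu, sub_self]
  refine K.eq_top_iff'.2 fun v => Submodule.starProjection_eq_self_iff.1 ?_
  rw [hz, sub_eq_zero.1 ((smul_eq_zero.1 hz1).resolve_right hu0), one_smul]

end Schur

/-! ### Commutants -/

section Commutant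

theorem eq_of_hasDerivAt_zero_shift {E : Type*} [NormedAddCommGroup E] [NormedSpace ℝ E]
    {f : ℝ → E} (h : ∀ t, HasDerivAt (fun s => f (s + t)) 0 0) (t : ℝ) : f t = f 0 := by
  have hf : ∀ t, HasDerivAt f 0 t := fun t => by
    have hshift : HasDerivAt (fun s => f (s + t)) 0 (t - t) := by rw [sub_self]; exact h t
    simpa using hshift.comp_sub_const t t
  exact is_const_of_deriv_eq_zero (fun t => (hf t).differentiableAt) (fun t => (hf t).deriv) t 0

variable {n : ℕ} {G : Type*} [Group G] [TopologicalSpace G] {p : G →* SO0 n}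
  {H : Type*} [NormedAddCommGroup H] [InnerProductSpace ℂ H] [CompleteSpace H]

/-- The elements of the Lie algebra with which the operator `O`, defined on the vectors of class
`C^∞`, commutes in the sense of sesquilinear forms. -/
def commutant (hp : IsCoveringMap p) (U : UnitaryRep G H) (O : smoothCore hp U →ₗ[ℂ] H) :
    Submodule ℝ (so n) where
  carrier := {X | ∀ v w : smoothCore hp U,
    inner ℂ (O (lieAct hp U X v)) (w : H) + inner ℂ (O v) (lieAct hp U X w : H) = 0}
  add_mem' {X Y} hX hY v w := by
    simp only [map_add, LinearMap.add_apply, Submodule.coe_add, inner_add_left, inner_add_right]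
    linear_combination hX v w + hY v w
  zero_mem' v w := by simp
  smul_mem' r X hX v w := by
    rw [lieAct_smul]
    simp only [LinearMap.smul_apply, Submodule.coe_smul, map_smul, inner_smul_left,
      inner_smul_right, Complex.conj_ofReal]
    linear_combination (r : ℂ) * hX v w

theorem mem_commutant_of_commute (hp : IsCoveringMap p) (U : UnitaryRep G H)
    {O : Module.End ℂ (smoothCore hp U)} {X : so n} (h : Commute O (lieAct hp U X)) :
    X ∈ commutant hp U ((smoothCore hp U).subtype ∘ₗ O) := by
  intro v w
  have hv : O (lieAct hp U X v) = lieAct hp U X (O v) := LinearMap.congr_fun h.eq v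
  simp only [LinearMap.comp_apply, Submodule.subtype_apply, hv, inner_lieAct_left]
  ring

theorem mem_commutant_of_op_comm (hp : IsCoveringMap p) (U : UnitaryRep G H) {X : so n}
    {B : H →L[ℂ] H} (hB : ∀ t v, B (U.op (oneParam hp X t) v) = U.op (oneParam hp X t) (B v)) :
    X ∈ commutant hp U (B.toLinearMap.domRestrict (smoothCore hp U)) := fun v w => by
  have hv := (B.restrictScalars ℝ).hasFDerivAt.comp_hasDerivAt (0 : ℝ) (hasDerivAt_lieAct hp U X v)
  simp only [Function.comp_def, ContinuousLinearMap.coe_restrictScalars', hB] at hv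
  exact inner_add_inner_eq_zero_of_hasDerivAt hp U hv (hasDerivAt_lieAct hp U X w)

variable [IsTopologicalGroup G]

theorem lie_mem_commutant (hp : IsCoveringMap p) (U : UnitaryRep G H)
    {O : smoothCore hp U →ₗ[ℂ] H} {X Y : so n} (hX : X ∈ commutant hp U O)
    (hY : Y ∈ commutant hp U O) : ⁅X, Y⁆ ∈ commutant hp U O := by
  intro v w
  simp only [lieAct_lie, LinearMap.sub_apply, Module.End.mul_apply, Submodule.coe_sub, map_sub,
    inner_sub_left, inner_sub_right]
  linear_combination hX (lieAct hp U Y v) w - hY v (lieAct hp U X w)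
    - hY (lieAct hp U X v) w + hX v (lieAct hp U Y w)

/-- The operators on the vectors of class `C^∞` whose matrix coefficients satisfy the Leibniz rule
along the one-parameter groups `U(exp(tX))`. -/
def leibnizOps (hp : IsCoveringMap p) (U : UnitaryRep G H) :
    Submodule ℂ (smoothCore hp U →ₗ[ℂ] H) where
  carrier := {O | ∀ (X : so n) (v w : smoothCore hp U), HasDerivAt
    (fun t : ℝ => inner ℂ (O (coreRep hp U (oneParam hp X t) v)) (U.op (oneParam hp X t) (w : H)))
    (inner ℂ (O (lieAct hp U X v)) (w : H) + inner ℂ (O v) (lieAct hp U X w : H)) 0}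
  add_mem' {O P} hO hP X v w := by
    simp only [LinearMap.add_apply, inner_add_left]
    exact ((hO X v w).fun_add (hP X v w)).congr_deriv (by ring)
  zero_mem' X v w := by simpa using hasDerivAt_const _ _
  smul_mem' c O hO X v w := by
    simp only [LinearMap.smul_apply, inner_smul_left]
    exact ((hO X v w).const_mul _).congr_deriv (by ring)

theorem domRestrict_mem_leibnizOps (hp : IsCoveringMap p) (U : UnitaryRep G H) (B : H →L[ℂ] H) :
    B.toLinearMap.domRestrict (smoothCore hp U) ∈ leibnizOps hp U := fun X v w => by
  have h := ((B.restrictScalars ℝ).hasFDerivAt.comp_hasDerivAt (0 : ℝ)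
    (hasDerivAt_lieAct hp U X v)).inner ℂ (hasDerivAt_lieAct hp U X w)
  simp only [oneParam_zero, U.op_one, Function.comp_apply] at h
  exact h.congr_deriv (add_comm _ _)

theorem lieAct_mul_mem_leibnizOps (hp : IsCoveringMap p) (U : UnitaryRep G H) (Y Z : so n) :
    (smoothCore hp U).subtype ∘ₗ (lieAct hp U Y * lieAct hp U Z) ∈ leibnizOps hp U := by
  intro X v w
  have h := ((hasDerivAt_lieAct_coreRep hp U X Z v).inner ℂ
    (hasDerivAt_lieAct_coreRep hp U X Y w)).fun_neg
  refine (h.congr_of_eventuallyEq (Eventually.of_forall fun t => ?_)).congr_deriv ?_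
  · exact inner_lieAct_left hp U Y _ (coreRep hp U (oneParam hp X t) w)
  · simp only [oneParam_zero, map_one, Module.End.one_apply, LinearMap.comp_apply,
      Submodule.subtype_apply, Module.End.mul_apply, inner_lieAct_left hp U Y]
    ring

theorem apply_coreRep_oneParam_of_mem_commutant (hp : IsCoveringMap p) (U : UnitaryRep G H)
    {O : smoothCore hp U →ₗ[ℂ] H} (hO : O ∈ leibnizOps hp U) {X : so n}
    (hX : X ∈ commutant hp U O) (t : ℝ) (v : smoothCore hp U) :
    O (coreRep hp U (oneParam hp X t) v) = U.op (oneParam hp X t) (O v) := by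
  refine (dense_smoothCore hp U).eq_of_inner_left (𝕜 := ℂ) fun w hw => ?_
  let w' := coreRep hp U (oneParam hp X t)⁻¹ ⟨w, hw⟩
  have hw' : U.op (oneParam hp X t) (w' : H) = w := U.op_op_inv _ _
  have hconst := eq_of_hasDerivAt_zero_shift (f := fun t => inner ℂ
    (O (coreRep hp U (oneParam hp X t) v)) (U.op (oneParam hp X t) (w' : H))) (fun t => by
      have h := hO X (coreRep hp U (oneParam hp X t) v) (coreRep hp U (oneParam hp X t) w')
      rw [hX] at h
      simp only [oneParam_add, map_mul, U.op_mul]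
      exact h) t
  simp only [oneParam_zero, map_one, Module.End.one_apply, U.op_one, hw'] at hconst
  rw [hconst, U.inner_op_left]
  rfl

theorem apply_coreRep_of_mem_analyticSubgroup (hp : IsCoveringMap p) (U : UnitaryRep G H)
    {O : smoothCore hp U →ₗ[ℂ] H} (hO : O ∈ leibnizOps hp U) {𝔥 : Submodule ℝ (so n)}
    (h𝔥 : 𝔥 ≤ commutant hp U O) {g : G} (hg : g ∈ analyticSubgroup hp 𝔥) (v : smoothCore hp U) :
    O (coreRep hp U g v) = U.op g (O v) := by
  induction hg using Subgroup.closure_induction generalizing v with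
  | mem g hg =>
    obtain ⟨X, hX, t, rfl⟩ := hg
    exact apply_coreRep_oneParam_of_mem_commutant hp U hO (h𝔥 hX) t v
  | one => rw [map_one, U.op_one, Module.End.one_apply]
  | mul g h _ _ ihg ihh => rw [map_mul, Module.End.mul_apply, U.op_mul, ihg, ihh]
  | inv g _ ih =>
    rw [← U.op_inv_op g (O (coreRep hp U g⁻¹ v)), ← ih, ← Module.End.mul_apply, ← map_mul,
      mul_inv_cancel, map_one, Module.End.one_apply]

theorem exists_smul_of_le_commutant (hp : IsCoveringMap p) (U : UnitaryRep G H)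
    {𝔥 : Submodule ℝ (so n)} (hU : U.IsIrreducibleOn (analyticSubgroup hp 𝔥)) {B : H →L[ℂ] H}
    (h𝔥 : 𝔥 ≤ commutant hp U (B.toLinearMap.domRestrict (smoothCore hp U))) :
    ∃ c : ℂ, ∀ v, B v = c • v := by
  refine schur U hU fun g hg => congrFun (Continuous.ext_on (dense_smoothCore hp U)
    (B.continuous.comp (U.op g).continuous) ((U.op g).continuous.comp B.continuous) fun v hv => ?_)
  exact apply_coreRep_of_mem_analyticSubgroup hp U (domRestrict_mem_leibnizOps hp U B) h𝔥 hg ⟨v, hv⟩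

theorem exists_eq_smul_one_of_commute (hp : IsCoveringMap p) (U : UnitaryRep G H)
    {𝔥 : Submodule ℝ (so n)} (hU : U.IsIrreducibleOn (analyticSubgroup hp 𝔥))
    {O : Module.End ℂ (smoothCore hp U)} (hO : (smoothCore hp U).subtype ∘ₗ O ∈ leibnizOps hp U)
    (hsymm : ∀ v w : smoothCore hp U, inner ℂ (O v : H) (w : H) = inner ℂ (v : H) (O w : H))
    (h𝔥 : ∀ X ∈ 𝔥, Commute O (lieAct hp U X)) : ∃ c : ℂ, O = c • 1 := by
  obtain ⟨c, hc⟩ := schur_of_symmetric U hU hsymm fun g hg v =>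
    ⟨op_mem_smoothCore hp U g v.2, apply_coreRep_of_mem_analyticSubgroup hp U hO
      (fun X hX => mem_commutant_of_commute hp U (h𝔥 X hX)) hg v⟩
  exact ⟨c, LinearMap.ext fun v => Subtype.ext (hc v)⟩

end Commutant

/-! ### Quadratic relations -/

section Casimir

variable {ι A : Type*} [Fintype ι] [Ring A] [Algebra ℂ A]

/-- The tensor `T_{ac} = ∑_b ε_b m_{ab} m_{bc}`. -/
def casimirTensor (ε : ι → ℂ) (m : ι → ι → A) (a c : ι) : A := ∑ b, ε b • (m a b * m b c)

theorem lie_casimirTensor {ε : ι → ℂ} {m : ι → ι → A} {h : ι → ι → ℂ}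
    (hh : ∀ (d : ι) (x : ι → A), ∑ b, (ε b * h d b) • x b = x d)
    (hskew : ∀ a b, m b a = -m a b)
    (hcomm : ∀ a b c d, ⁅m a b, m c d⁆ =
      h a d • m b c + h b c • m a d - h a c • m b d - h b d • m a c) (d e a c : ι) :
    ⁅m d e, casimirTensor ε m a c⁆ =
      h e a • casimirTensor ε m d c - h d a • casimirTensor ε m e c
        + h e c • casimirTensor ε m a d - h d c • casimirTensor ε m a e := by
  have h0 : ⁅m d e, casimirTensor ε m a c⁆ =
      ∑ b, ε b • (⁅m d e, m a b⁆ * m b c + m a b * ⁅m d e, m b c⁆) := by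
    simp only [casimirTensor, Ring.lie_def, Finset.mul_sum, Finset.sum_mul,
      ← Finset.sum_sub_distrib]
    refine Finset.sum_congr rfl fun b _ => ?_
    rw [mul_smul_comm, smul_mul_assoc, ← smul_sub]
    congr 1
    noncomm_ring
  have h1 : ∀ b, ε b • (⁅m d e, m a b⁆ * m b c + m a b * ⁅m d e, m b c⁆) =
      (ε b * h d b) • (m e a * m b c) + h e a • (ε b • (m d b * m b c))
        - h d a • (ε b • (m e b * m b c)) - (ε b * h e b) • (m d a * m b c)
        - h d c • (ε b • (m a b * m b e)) + (ε b * h e b) • (m a b * m d c)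
        - (ε b * h d b) • (m a b * m e c) + h e c • (ε b • (m a b * m b d)) := by
    intro b
    rw [hcomm, hcomm, hskew e b, hskew b d]
    simp only [add_mul, sub_mul, mul_add, mul_sub, smul_mul_assoc, mul_smul_comm, mul_neg]
    module
  rw [h0, Finset.sum_congr rfl fun b _ => h1 b]
  simp only [Finset.sum_add_distrib, Finset.sum_sub_distrib, ← Finset.smul_sum, hh]
  rw [hskew a e, hskew a d]
  simp only [casimirTensor]
  noncomm_ring

end Casimir

section Relations

variable {n : ℕ} {G : Type*} [Group G] [TopologicalSpace G] {p : G →* SO0 n}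
  {H : Type*} [NormedAddCommGroup H] [InnerProductSpace ℂ H] [CompleteSpace H]

theorem lieAct_M_swap (hp : IsCoveringMap p) (U : UnitaryRep G H) (a b : Fin (n + 2)) :
    lieAct hp U (M b a) = -lieAct hp U (M a b) := by
  rw [M_swap, map_neg]

theorem commute_lieAct_of_mem_poincareAlg (hp : IsCoveringMap p) (U : UnitaryRep G H)
    {O : Module.End ℂ (smoothCore hp U)}
    (htrans : ∀ a, a ≠ 0 → a ≠ Fin.last (n + 1) →
      ⁅lieAct hp U (M 0 a) + lieAct hp U (M a (Fin.last (n + 1))), O⁆ = 0)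
    (hlor : ∀ a b, a ≠ 0 → a ≠ Fin.last (n + 1) → b ≠ 0 → b ≠ Fin.last (n + 1) →
      ⁅lieAct hp U (M a b), O⁆ = 0) {X : so n} (hX : X ∈ poincareAlg n) :
    Commute O (lieAct hp U X) := by
  have hne (α : Fin n) : α.succ.castSucc ≠ 0 ∧ α.succ.castSucc ≠ Fin.last (n + 1) :=
    ⟨by simp [Fin.ext_iff], Fin.castSucc_ne_last _⟩
  induction hX using Submodule.span_induction with
  | mem X hX =>
    refine (commute_iff_lie_eq.2 ?_).symm
    rcases hX with ⟨α, rfl⟩ | ⟨α, β, rfl⟩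
    · rw [map_add]
      exact htrans _ (hne α).1 (hne α).2
    · exact hlor _ _ (hne α).1 (hne α).2 (hne β).1 (hne β).2
  | zero =>
    rw [map_zero]
    exact Commute.zero_right _
  | add X Y _ _ hX hY =>
    rw [map_add]
    exact hX.add_right hY
  | smul r X _ hX =>
    rw [lieAct_smul]
    exact hX.smul_right _

/-- The tensor `T_{ac} = ∑_b η_{bb} U(M_{ab}) U(M_{bc})`. -/
def quadTensor (hp : IsCoveringMap p) (U : UnitaryRep G H) (a c : Fin (n + 2)) :
    Module.End ℂ (smoothCore hp U) :=
  casimirTensor (fun b => (metric n b : ℂ)) (fun a b => lieAct hp U (M a b)) a c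

theorem inner_quadTensor_left (hp : IsCoveringMap p) (U : UnitaryRep G H) (a c : Fin (n + 2))
    (v w : smoothCore hp U) :
    inner ℂ (quadTensor hp U a c v : H) (w : H) = inner ℂ (v : H) (quadTensor hp U c a w : H) := by
  simp only [quadTensor, casimirTensor, LinearMap.sum_apply, LinearMap.smul_apply,
    Module.End.mul_apply, Submodule.coe_sum, Submodule.coe_smul, sum_inner, inner_sum,
    inner_smul_left, inner_smul_right, Complex.conj_ofReal, inner_lieAct_left, neg_neg]
  refine Finset.sum_congr rfl fun b _ => ?_
  rw [lieAct_M_swap hp U a b, lieAct_M_swap hp U b c]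
  simp

/-- Twice the symmetric part of the tensor `T_{ac}`. -/
def symTensor (hp : IsCoveringMap p) (U : UnitaryRep G H) (a c : Fin (n + 2)) :
    Module.End ℂ (smoothCore hp U) := quadTensor hp U a c + quadTensor hp U c a

theorem symTensor_comm (hp : IsCoveringMap p) (U : UnitaryRep G H) (a c : Fin (n + 2)) :
    symTensor hp U a c = symTensor hp U c a := add_comm _ _

theorem symTensor_self (hp : IsCoveringMap p) (U : UnitaryRep G H) (a : Fin (n + 2)) :
    symTensor hp U a a = (2 : ℂ) • quadTensor hp U a a := (two_smul ℂ _).symm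

theorem inner_symTensor_left (hp : IsCoveringMap p) (U : UnitaryRep G H) (a c : Fin (n + 2))
    (v w : smoothCore hp U) :
    inner ℂ (symTensor hp U a c v : H) (w : H) = inner ℂ (v : H) (symTensor hp U a c w : H) := by
  simp only [symTensor, LinearMap.add_apply, Submodule.coe_add, inner_add_left, inner_add_right,
    inner_quadTensor_left]
  ring

variable [IsTopologicalGroup G]

theorem lie_lieAct_M (hp : IsCoveringMap p) (U : UnitaryRep G H) (a b c d : Fin (n + 2)) :
    ⁅lieAct hp U (M a b), lieAct hp U (M c d)⁆ =
      (eta n a d : ℂ) • lieAct hp U (M b c) + (eta n b c : ℂ) • lieAct hp U (M a d)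
        - (eta n a c : ℂ) • lieAct hp U (M b d) - (eta n b d : ℂ) • lieAct hp U (M a c) := by
  rw [Ring.lie_def, ← lieAct_lie, M_bracket]
  simp only [map_sub, map_add, lieAct_smul]

theorem subtype_comp_quadTensor_mem_leibnizOps (hp : IsCoveringMap p) (U : UnitaryRep G H)
    (a c : Fin (n + 2)) : (smoothCore hp U).subtype ∘ₗ quadTensor hp U a c ∈ leibnizOps hp U := by
  have hsum : (smoothCore hp U).subtype ∘ₗ quadTensor hp U a c = ∑ b, (metric n b : ℂ) •
      (smoothCore hp U).subtype ∘ₗ (lieAct hp U (M a b) * lieAct hp U (M b c)) := by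
    ext v
    simp [quadTensor, casimirTensor]
  rw [hsum]
  exact Submodule.sum_mem _ fun _ _ => Submodule.smul_mem _ _ (lieAct_mul_mem_leibnizOps hp U _ _)

theorem subtype_comp_symTensor_mem_leibnizOps (hp : IsCoveringMap p) (U : UnitaryRep G H)
    (a c : Fin (n + 2)) : (smoothCore hp U).subtype ∘ₗ symTensor hp U a c ∈ leibnizOps hp U := by
  rw [symTensor, LinearMap.comp_add]
  exact Submodule.add_mem _ (subtype_comp_quadTensor_mem_leibnizOps hp U a c)
    (subtype_comp_quadTensor_mem_leibnizOps hp U c a)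

theorem lie_quadTensor (hp : IsCoveringMap p) (U : UnitaryRep G H) (d e a c : Fin (n + 2)) :
    ⁅lieAct hp U (M d e), quadTensor hp U a c⁆ =
      (eta n e a : ℂ) • quadTensor hp U d c - (eta n d a : ℂ) • quadTensor hp U e c
        + (eta n e c : ℂ) • quadTensor hp U a d - (eta n d c : ℂ) • quadTensor hp U a e := by
  refine lie_casimirTensor (h := fun a b => (eta n a b : ℂ)) (fun d x => ?_)
    (lieAct_M_swap hp U) (lie_lieAct_M hp U) d e a c
  rw [Finset.sum_eq_single d]
  · rw [eta_self, ← Complex.ofReal_mul, metric_mul_self, Complex.ofReal_one, one_smul]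
  · intro b _ hb
    rw [eta_ne (Ne.symm hb), Complex.ofReal_zero, mul_zero, zero_smul]
  · simp

theorem lie_symTensor (hp : IsCoveringMap p) (U : UnitaryRep G H) (d e a c : Fin (n + 2)) :
    ⁅lieAct hp U (M d e), symTensor hp U a c⁆ =
      (eta n e a : ℂ) • symTensor hp U d c - (eta n d a : ℂ) • symTensor hp U e c
        + (eta n e c : ℂ) • symTensor hp U a d - (eta n d c : ℂ) • symTensor hp U a e := by
  simp only [symTensor, lie_add, lie_quadTensor]
  module

-- The null combination `S_{n,n} + S_{0,0} - 2 S_{0,n}`, `0` standing for the index `-1`, commutes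
-- with the Poincaré algebra and has weight `2` under `M_{-1,n}`: a scalar of weight `2` vanishes.
theorem symTensor_last_last_add_zero_zero (hn : 1 ≤ n) (hp : IsCoveringMap p)
    (U : UnitaryRep G H) (hU : U.IsIrreducibleOn (analyticSubgroup hp (poincareAlg n))) :
    symTensor hp U (Fin.last _) (Fin.last _) + symTensor hp U 0 0 =
      symTensor hp U 0 (Fin.last _) + symTensor hp U 0 (Fin.last _) := by
  set L := Fin.last (n + 1) with hL
  have h0L : (0 : Fin (n + 2)) ≠ L := by simp [hL, Fin.ext_iff]
  have hLm : metric n L = -1 := metric_of_two_le (by simp [hL]; omega)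
  set K := symTensor hp U L L + symTensor hp U 0 0 - (symTensor hp U 0 L + symTensor hp U 0 L)
    with hK
  have hKmem : (smoothCore hp U).subtype ∘ₗ K ∈ leibnizOps hp U := by
    rw [hK, LinearMap.comp_sub, LinearMap.comp_add, LinearMap.comp_add]
    refine Submodule.sub_mem _ (Submodule.add_mem _ ?_ ?_) (Submodule.add_mem _ ?_ ?_) <;>
      exact subtype_comp_symTensor_mem_leibnizOps hp U _ _
  have hKsymm (v w : smoothCore hp U) :
      inner ℂ (K v : H) (w : H) = inner ℂ (v : H) (K w : H) := by
    simp only [hK, LinearMap.sub_apply, LinearMap.add_apply, Submodule.coe_sub, Submodule.coe_add,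
      inner_sub_left, inner_add_left, inner_sub_right, inner_add_right, inner_symTensor_left]
  obtain ⟨c, hc⟩ := exists_eq_smul_one_of_commute hp U hU hKmem hKsymm fun X hX => by
    refine commute_lieAct_of_mem_poincareAlg hp U (fun a ha0 haL => ?_)
      (fun a b ha0 haL hb0 hbL => ?_) hX
    · rw [← hL] at haL ⊢
      simp only [hK, lie_add, lie_sub, add_lie, lie_symTensor, eta_ne ha0, eta_ne haL,
        eta_ne h0L, eta_ne h0L.symm, eta_self, metric_zero, hLm, symTensor_comm hp U L,
        symTensor_comm hp U 0 a, Complex.ofReal_zero, Complex.ofReal_one, Complex.ofReal_neg]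
      module
    · rw [← hL] at haL hbL
      simp only [hK, lie_add, lie_sub, lie_symTensor, eta_ne ha0, eta_ne haL, eta_ne hb0,
        eta_ne hbL, Complex.ofReal_zero]
      module
  have hweight : ⁅lieAct hp U (M 0 L), K⁆ = (2 : ℂ) • K := by
    simp only [hK, lie_add, lie_sub, lie_symTensor, eta_ne h0L, eta_ne h0L.symm,
      eta_self, metric_zero, hLm, symTensor_comm hp U L 0, Complex.ofReal_zero, Complex.ofReal_one,
      Complex.ofReal_neg]
    module
  have hscalar : ⁅lieAct hp U (M 0 L), K⁆ = 0 := by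
    rw [hc, Ring.lie_def, mul_smul_one, smul_one_mul, sub_self]
  exact sub_eq_zero.1 ((smul_eq_zero.1 (hweight.symm.trans hscalar)).resolve_left two_ne_zero)

-- Apply `ad M_{-1,0}` three times to the previous relation.
theorem symTensor_zero_one_eq_zero (hn : 2 ≤ n) (hp : IsCoveringMap p) (U : UnitaryRep G H)
    (hU : U.IsIrreducibleOn (analyticSubgroup hp (poincareAlg n))) : symTensor hp U 0 1 = 0 := by
  have hnull := symTensor_last_last_add_zero_zero (by omega) hp U hU
  set L := Fin.last (n + 1) with hL
  have h0L : (0 : Fin (n + 2)) ≠ L := by simp [hL, Fin.ext_iff]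
  have h1L : (1 : Fin (n + 2)) ≠ L := by
    simp only [hL, ne_eq, Fin.ext_iff, Fin.val_one, Fin.val_last]; omega
  set N := lieAct hp U (M 0 1) with hN
  set S := symTensor hp U with hS
  have hLL : ⁅N, S L L⁆ = 0 := by
    simp [hN, hS, lie_symTensor, eta_ne h0L, eta_ne h1L]
  have h00 : ⁅N, S 0 0⁆ = -S 0 1 - S 0 1 := by
    simp [hN, hS, lie_symTensor, eta_ne, eta_self, metric_zero, symTensor_comm hp U 1 0]
  have h11 : ⁅N, S 1 1⁆ = S 0 1 + S 0 1 := by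
    simp [hN, hS, lie_symTensor, eta_ne, eta_self, metric_one, symTensor_comm hp U 1 0]
  have h01 : ⁅N, S 0 1⁆ = S 0 0 - S 1 1 := by
    simp [hN, hS, lie_symTensor, eta_ne, eta_self, metric_zero, metric_one, neg_add_eq_sub]
  have h0L' : ⁅N, S 0 L⁆ = -S 1 L := by
    simp [hN, hS, lie_symTensor, eta_ne, eta_ne h0L, eta_ne h1L, eta_self, metric_zero]
  have h1L' : ⁅N, S 1 L⁆ = S 0 L := by
    simp [hN, hS, lie_symTensor, eta_ne, eta_ne h0L, eta_ne h1L, eta_self, metric_one]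
  have hfst : S 0 1 = S 1 L := by
    have h := congrArg (fun O => ⁅N, O⁆) hnull
    simp only [lie_add, hLL, h00, h0L'] at h
    linear_combination (norm := module) (-(1 / 2) : ℂ) • h
  have hsnd : S 0 0 - S 1 1 = S 0 L := by rw [← h01, hfst, h1L']
  have hthd : -S 0 1 - S 0 1 - (S 0 1 + S 0 1) = -S 0 1 := by
    rw [← h00, ← h11, ← lie_sub, hsnd, h0L', hfst]
  linear_combination (norm := module) (-(1 / 3) : ℂ) • hthd

theorem symTensor_zero_eq_zero (hn : 2 ≤ n) (hp : IsCoveringMap p) (U : UnitaryRep G H)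
    (hU : U.IsIrreducibleOn (analyticSubgroup hp (poincareAlg n))) {a : Fin (n + 2)}
    (ha : a ≠ 0) : symTensor hp U 0 a = 0 := by
  have h01 := symTensor_zero_one_eq_zero hn hp U hU
  obtain rfl | ha1 := eq_or_ne a 1
  · exact h01
  · have h := congrArg (fun O => ⁅lieAct hp U (M a 1), O⁆) h01
    simpa [lie_symTensor, eta_ne, eta_ne ha, eta_ne ha1, eta_self, metric_one,
      symTensor_comm hp U a 0] using h

theorem quadTensor_zero_zero_eq_one_one (hn : 2 ≤ n) (hp : IsCoveringMap p) (U : UnitaryRep G H)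
    (hU : U.IsIrreducibleOn (analyticSubgroup hp (poincareAlg n))) :
    quadTensor hp U 0 0 = quadTensor hp U 1 1 := by
  have h := congrArg (fun O => ⁅lieAct hp U (M 0 1), O⁆) (symTensor_zero_one_eq_zero hn hp U hU)
  simp only [lie_symTensor, eta_ne (zero_ne_one (α := Fin (n + 2))),
    eta_ne (one_ne_zero (α := Fin (n + 2))), eta_self, metric_zero, metric_one, symTensor_self,
    Complex.ofReal_zero, Complex.ofReal_one, lie_zero] at h
  linear_combination (norm := module) (1 / 2 : ℂ) • h

theorem exists_quadTensor_eq_smul_one (hn : 2 ≤ n) (hp : IsCoveringMap p) (U : UnitaryRep G H)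
    (hU : U.IsIrreducibleOn (analyticSubgroup hp (poincareAlg n))) :
    ∃ c : ℂ, quadTensor hp U 0 0 = c • 1 ∧ quadTensor hp U 1 1 = c • 1 := by
  obtain ⟨c, hc⟩ := exists_eq_smul_one_of_commute hp U hU
    (subtype_comp_quadTensor_mem_leibnizOps hp U 0 0) (inner_quadTensor_left hp U 0 0)
    fun X hX => by
      refine commute_lieAct_of_mem_poincareAlg hp U (fun a ha0 _ => ?_)
        (fun a b ha0 _ hb0 _ => ?_) hX
      · rw [← neg_eq_zero, ← symTensor_zero_eq_zero hn hp U hU ha0]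
        simp [symTensor, lie_quadTensor, eta_ne ha0, eta_ne (Fin.last_pos.ne' : Fin.last _ ≠ 0),
          eta_self, metric_zero, add_comm]
      · simp [lie_quadTensor, eta_ne ha0, eta_ne hb0]
  exact ⟨c, hc, quadTensor_zero_zero_eq_one_one hn hp U hU ▸ hc⟩

end Relations

/-! ### Ladder operators -/

section Ladder

theorem ofReal_mul_I_mul_self {σ : ℝ} (hσ : σ * σ = 1) :
    ((σ : ℂ) * Complex.I) * (σ * Complex.I) = -1 := by
  rw [mul_mul_mul_comm, Complex.I_mul_I, ← Complex.ofReal_mul, hσ, Complex.ofReal_one, one_mul]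

variable {n : ℕ} {G : Type*} [Group G] [TopologicalSpace G] {p : G →* SO0 n}
  {H : Type*} [NormedAddCommGroup H] [InnerProductSpace ℂ H] [CompleteSpace H]

theorem sum_sq_lieAct_eq (hp : IsCoveringMap p) (U : UnitaryRep G H) (a : Fin (n + 2)) :
    ∑ i : Fin n, lieAct hp U (M a i.succ.succ) * lieAct hp U (M a i.succ.succ) =
      quadTensor hp U a a + lieAct hp U (M a 0) * lieAct hp U (M a 0) +
        lieAct hp U (M a 1) * lieAct hp U (M a 1) := by
  have hm (i : Fin n) : metric n i.succ.succ = -1 := metric_of_two_le (by simp)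
  have hsq (b : Fin (n + 2)) : lieAct hp U (M a b) * lieAct hp U (M b a) =
      -(lieAct hp U (M a b) * lieAct hp U (M a b)) := by
    rw [lieAct_M_swap hp U a b]
    exact mul_neg (lieAct hp U (M a b)) (lieAct hp U (M a b))
  simp only [quadTensor, casimirTensor, hsq, Fin.sum_univ_succ, Fin.succ_zero_eq_one, metric_zero,
    metric_one, hm, Complex.ofReal_one, Complex.ofReal_neg, one_smul, neg_smul, neg_neg]
  abel

theorem sum_sq_lieAct_zero (hp : IsCoveringMap p) (U : UnitaryRep G H) {c : ℂ}
    (hc : quadTensor hp U 0 0 = c • 1) :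
    ∑ i : Fin n, lieAct hp U (M 0 i.succ.succ) * lieAct hp U (M 0 i.succ.succ) =
      c • 1 + lieAct hp U (M 0 1) * lieAct hp U (M 0 1) := by
  rw [sum_sq_lieAct_eq, hc, M_self, map_zero, mul_zero, add_zero]

theorem sum_sq_lieAct_one (hp : IsCoveringMap p) (U : UnitaryRep G H) {c : ℂ}
    (hc : quadTensor hp U 1 1 = c • 1) :
    ∑ i : Fin n, lieAct hp U (M 1 i.succ.succ) * lieAct hp U (M 1 i.succ.succ) =
      c • 1 + lieAct hp U (M 0 1) * lieAct hp U (M 0 1) := by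
  rw [sum_sq_lieAct_eq, hc, M_self, map_zero, mul_zero, add_zero, lieAct_M_swap hp U 0 1]
  exact congrArg _ (neg_mul_neg (lieAct hp U (M 0 1)) (lieAct hp U (M 0 1)))

/-- The weight spaces of a generator: the vectors of class `C^∞` with `U(X) v = iμ v`. -/
def weightSpace (hp : IsCoveringMap p) (U : UnitaryRep G H) (X : so n) (μ : ℝ) :
    Submodule ℂ (smoothCore hp U) :=
  Module.End.eigenspace (lieAct hp U X) (Complex.I * μ)

theorem mem_weightSpace_iff (hp : IsCoveringMap p) (U : UnitaryRep G H) {X : so n} {μ : ℝ}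
    {v : smoothCore hp U} :
    v ∈ weightSpace hp U X μ ↔ lieAct hp U X v = (Complex.I * μ) • v :=
  Module.End.mem_eigenspace_iff

theorem inner_eq_zero_of_mem_weightSpace (hp : IsCoveringMap p) (U : UnitaryRep G H) {X : so n}
    {μ ν : ℝ} (h : μ ≠ ν) {v : H}
    (hv : HasDerivAt (fun t : ℝ => U.op (oneParam hp X t) v) ((Complex.I * μ) • v) 0)
    {w : smoothCore hp U} (hw : w ∈ weightSpace hp U X ν) : inner ℂ v (w : H) = 0 := by
  have hskew := inner_add_inner_eq_zero_of_hasDerivAt hp U hv (hasDerivAt_lieAct hp U X w)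
  rw [(mem_weightSpace_iff hp U).1 hw, Submodule.coe_smul, inner_smul_left, inner_smul_right,
    map_mul, Complex.conj_I, Complex.conj_ofReal] at hskew
  have hzero : Complex.I * ((ν : ℂ) - μ) * inner ℂ v (w : H) = 0 := by linear_combination hskew
  refine (mul_eq_zero.1 hzero).resolve_left (mul_ne_zero Complex.I_ne_zero (sub_ne_zero.2 ?_))
  exact fun hνμ => h (Complex.ofReal_injective hνμ).symm

/-- The ladder operators `U(M_{-1,i}) + σ i U(M_{0,i})`, `σ = ±1`. -/
def ladder (hp : IsCoveringMap p) (U : UnitaryRep G H) (σ : ℝ) (i : Fin n) :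
    Module.End ℂ (smoothCore hp U) :=
  lieAct hp U (M 0 i.succ.succ) + (σ * Complex.I) • lieAct hp U (M 1 i.succ.succ)

theorem inner_ladder_left (hp : IsCoveringMap p) (U : UnitaryRep G H) (σ : ℝ) (i : Fin n)
    (v w : smoothCore hp U) :
    inner ℂ (ladder hp U σ i v : H) (w : H) = -inner ℂ (v : H) (ladder hp U (-σ) i w : H) := by
  simp only [ladder, LinearMap.add_apply, LinearMap.smul_apply, Submodule.coe_add,
    Submodule.coe_smul, inner_add_left, inner_add_right, inner_smul_left, inner_smul_right,
    inner_lieAct_left, map_mul, Complex.conj_ofReal, Complex.conj_I, Complex.ofReal_neg]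
  ring

theorem lieAct_zero_eq_ladder (hp : IsCoveringMap p) (U : UnitaryRep G H) (i : Fin n) :
    lieAct hp U (M 0 i.succ.succ) = (1 / 2 : ℂ) • (ladder hp U 1 i + ladder hp U (-1) i) := by
  simp only [ladder, Complex.ofReal_one, Complex.ofReal_neg]
  module

variable [IsTopologicalGroup G]

theorem mul_ladder (hp : IsCoveringMap p) (U : UnitaryRep G H) {σ : ℝ} (hσ : σ * σ = 1)
    (i : Fin n) :
    lieAct hp U (M 0 1) * ladder hp U σ i =
      ladder hp U σ i * lieAct hp U (M 0 1) + (σ * Complex.I) • ladder hp U σ i := by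
  have hne₀ : (0 : Fin (n + 2)) ≠ i.succ.succ := by simp [Fin.ext_iff]
  have hne₁ : (1 : Fin (n + 2)) ≠ i.succ.succ := by simp [Fin.ext_iff]
  have hne : (0 : Fin (n + 2)) ≠ 1 := by simp
  have hlie₀ := lie_lieAct_M hp U 0 1 0 i.succ.succ
  have hlie₁ := lie_lieAct_M hp U 0 1 1 i.succ.succ
  simp only [eta_ne hne₀, eta_ne hne₁, eta_ne hne, eta_ne hne.symm, eta_self, metric_zero,
    metric_one, Complex.ofReal_zero, Complex.ofReal_one, zero_smul, one_smul,
    Ring.lie_def] at hlie₀ hlie₁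
  have hσI := ofReal_mul_I_mul_self hσ
  simp only [ladder, mul_add, add_mul, mul_smul_comm, smul_mul_assoc, smul_add, smul_smul, hσI]
  rw [sub_eq_iff_eq_add.1 hlie₀, sub_eq_iff_eq_add.1 hlie₁]
  module

theorem sum_ladder_mul_ladder (hp : IsCoveringMap p) (U : UnitaryRep G H) {c : ℂ}
    (hc0 : quadTensor hp U 0 0 = c • 1) (hc1 : quadTensor hp U 1 1 = c • 1) {σ : ℝ}
    (hσ : σ * σ = 1) :
    ∑ i, ladder hp U (-σ) i * ladder hp U σ i =
      (2 * c) • 1 + (2 : ℂ) • (lieAct hp U (M 0 1) * lieAct hp U (M 0 1)) +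
        (σ * n * Complex.I) • lieAct hp U (M 0 1) := by
  have hσI := ofReal_mul_I_mul_self hσ
  have hmul (i : Fin n) : ladder hp U (-σ) i * ladder hp U σ i =
        lieAct hp U (M 0 i.succ.succ) * lieAct hp U (M 0 i.succ.succ) +
          lieAct hp U (M 1 i.succ.succ) * lieAct hp U (M 1 i.succ.succ) +
        (σ * Complex.I) • lieAct hp U (M 0 1) := by
    have hne₀ : (0 : Fin (n + 2)) ≠ i.succ.succ := by simp [Fin.ext_iff]
    have hne₁ : (1 : Fin (n + 2)) ≠ i.succ.succ := by simp [Fin.ext_iff]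
    have hm : metric n i.succ.succ = -1 := metric_of_two_le (by simp)
    have hlie := lie_lieAct_M hp U 0 i.succ.succ 1 i.succ.succ
    simp only [eta_ne hne₀, eta_ne hne₁.symm, eta_ne (show (0 : Fin (n + 2)) ≠ 1 by simp),
      eta_self, hm, Complex.ofReal_zero, Complex.ofReal_one, Complex.ofReal_neg, zero_smul,
      Ring.lie_def, sub_eq_iff_eq_add] at hlie
    simp only [ladder, mul_add, add_mul, mul_smul_comm, smul_mul_assoc,
      Complex.ofReal_neg, neg_mul, hlie]
    match_scalars <;> first | ring1 | linear_combination -hσI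
  rw [Finset.sum_congr rfl fun i _ => hmul i, Finset.sum_add_distrib, Finset.sum_add_distrib,
    sum_sq_lieAct_zero hp U hc0, sum_sq_lieAct_one hp U hc1, Finset.sum_const, Finset.card_univ,
    Fintype.card_fin, ← Nat.cast_smul_eq_nsmul ℂ]
  module

theorem ladder_mem_weightSpace (hp : IsCoveringMap p) (U : UnitaryRep G H) {σ : ℝ}
    (hσ : σ * σ = 1) (i : Fin n) {μ : ℝ} {v : smoothCore hp U}
    (hv : v ∈ weightSpace hp U (M 0 1) μ) :
    ladder hp U σ i v ∈ weightSpace hp U (M 0 1) (μ + σ) := by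
  rw [mem_weightSpace_iff] at hv ⊢
  rw [← Module.End.mul_apply, mul_ladder hp U hσ, LinearMap.add_apply, Module.End.mul_apply, hv,
    map_smul, LinearMap.smul_apply, ← add_smul]
  congr 1
  push_cast
  ring

theorem sum_ladder_ladder_apply (hp : IsCoveringMap p) (U : UnitaryRep G H) {c : ℂ}
    (hc0 : quadTensor hp U 0 0 = c • 1) (hc1 : quadTensor hp U 1 1 = c • 1) {σ : ℝ}
    (hσ : σ * σ = 1) {μ : ℝ} {v : smoothCore hp U} (hv : v ∈ weightSpace hp U (M 0 1) μ) :
    ∑ i, ladder hp U (-σ) i (ladder hp U σ i v) = (2 * c - 2 * μ ^ 2 - σ * n * μ) • v := by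
  rw [mem_weightSpace_iff] at hv
  have h := LinearMap.congr_fun (sum_ladder_mul_ladder hp U hc0 hc1 hσ) v
  simp only [LinearMap.sum_apply, LinearMap.add_apply, LinearMap.smul_apply, Module.End.mul_apply,
    hv, map_smul, smul_smul, Module.End.one_apply, ← add_smul] at h
  rw [h]
  congr 1
  linear_combination (2 * μ ^ 2 + σ * n * μ : ℂ) * Complex.I_mul_I

theorem sum_norm_ladder_sq (hp : IsCoveringMap p) (U : UnitaryRep G H) {c : ℝ}
    (hc0 : quadTensor hp U 0 0 = (c : ℂ) • 1) (hc1 : quadTensor hp U 1 1 = (c : ℂ) • 1) {σ : ℝ}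
    (hσ : σ * σ = 1) {μ : ℝ} {v : smoothCore hp U} (hv : v ∈ weightSpace hp U (M 0 1) μ) :
    ∑ i, ‖(ladder hp U σ i v : H)‖ ^ 2 = (2 * μ ^ 2 + σ * n * μ - 2 * c) * ‖(v : H)‖ ^ 2 := by
  have hnorm (i : Fin n) : ((‖(ladder hp U σ i v : H)‖ ^ 2 : ℝ) : ℂ) =
      -inner ℂ (v : H) (ladder hp U (-σ) i (ladder hp U σ i v) : H) := by
    rw [← inner_ladder_left, inner_self_eq_norm_sq_to_K]
    simp
  apply Complex.ofReal_injective
  rw [Complex.ofReal_sum, Finset.sum_congr rfl fun i _ => hnorm i, Finset.sum_neg_distrib,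
    ← inner_sum, ← Submodule.coe_sum, sum_ladder_ladder_apply hp U hc0 hc1 hσ hv,
    Submodule.coe_smul, inner_smul_right, inner_self_eq_norm_sq_to_K]
  simp only [Complex.coe_algebraMap]
  push_cast
  ring

theorem commutant_eq_top (hp : IsCoveringMap p) (U : UnitaryRep G H)
    {O : smoothCore hp U →ₗ[ℂ] H} (h : ∀ a : Fin (n + 2), M 0 a ∈ commutant hp U O) :
    commutant hp U O = ⊤ := by
  rw [eq_top_iff]
  intro X _
  rw [eq_sum_coef X]
  refine Submodule.sum_mem _ fun a _ => Submodule.sum_mem _ fun b _ => Submodule.smul_mem _ _ ?_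
  by_cases ha : a = 0
  · exact ha ▸ h b
  by_cases hb : b = 0
  · rw [hb, M_swap]
    exact Submodule.neg_mem _ (h a)
  have hlie := lie_mem_commutant hp U (h b) (h a)
  rw [M_bracket, eta_ne (Ne.symm ha), eta_ne hb, eta_self, metric_zero, M_self] at hlie
  simpa [← M_swap] using hlie

end Ladder

/-! ### Fourier decomposition under a periodic generator -/

section Fourier

variable {n : ℕ} {G : Type*} [Group G] [TopologicalSpace G] {p : G →* SO0 n}
  {H : Type*} [NormedAddCommGroup H] [InnerProductSpace ℂ H] [CompleteSpace H]

theorem hasDerivAt_cexp_const_mul_ofReal (l : ℂ) (t : ℝ) :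
    HasDerivAt (fun t : ℝ => Complex.exp (l * t)) (Complex.exp (l * t) * l) t := by
  simpa using (((hasDerivAt_id t).ofReal_comp).const_mul l).cexp

theorem mem_weightSpace_of_op_eq (hp : IsCoveringMap p) (U : UnitaryRep G H) {X : so n} {μ : ℝ}
    {v : smoothCore hp U}
    (h : ∀ t : ℝ, U.op (oneParam hp X t) (v : H) = Complex.exp (Complex.I * μ * t) • (v : H)) :
    v ∈ weightSpace hp U X μ := by
  rw [mem_weightSpace_iff]
  refine Subtype.ext (lieAct_eq_of_hasDerivAt hp U ?_)
  simp only [h]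
  simpa using (hasDerivAt_cexp_const_mul_ofReal (Complex.I * μ) 0).smul_const (v : H)

/-- The operator `U(exp(2πX))` is the scalar `e^{2πil}`, so that `X` has its weights in `l + ℤ`. -/
def IsWeightClass (hp : IsCoveringMap p) (U : UnitaryRep G H) (X : so n) (l : ℝ) : Prop :=
  ∀ v, U.op (oneParam hp X (2 * Real.pi)) v =
    Complex.exp (Complex.I * l * (2 * Real.pi : ℝ)) • v

theorem IsWeightClass.add_intCast {hp : IsCoveringMap p} {U : UnitaryRep G H} {X : so n} {l : ℝ}
    (h : IsWeightClass hp U X l) (k : ℤ) : IsWeightClass hp U X (l + k) := fun v => by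
  have hexp : Complex.I * ((l + k : ℝ) : ℂ) * ((2 * Real.pi : ℝ) : ℂ) =
      Complex.I * l * (2 * Real.pi : ℝ) + k * (2 * Real.pi * Complex.I) := by
    push_cast
    ring
  rw [hexp, Complex.exp_add, Complex.exp_int_mul_two_pi_mul_I, mul_one, h v]

/-- The sum of the weight spaces of `X` with weights in `l + ℤ`. -/
def weightSum (hp : IsCoveringMap p) (U : UnitaryRep G H) (X : so n) (l : ℝ) :
    Submodule ℂ (smoothCore hp U) :=
  ⨆ k : ℤ, weightSpace hp U X (l + k)

theorem cosWeight_succ (l : ℝ) (k : ℕ) :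
    cosWeight l (k + 1) = (1 / 2 : ℂ) • cosWeight l k +
      ((1 / 4 : ℂ) • cosWeight (l + 1) k + (1 / 4 : ℂ) • cosWeight (l - 1) k) := by
  funext t
  simp only [cosWeight, Pi.add_apply, Pi.smul_apply, smul_eq_mul]
  rw [show -(Complex.I * ((l + 1 : ℝ) : ℂ) * t) = -(Complex.I * l * t) + -t * Complex.I by
      push_cast; ring,
    show -(Complex.I * ((l - 1 : ℝ) : ℂ) * t) = -(Complex.I * l * t) + t * Complex.I by
      push_cast; ring, Complex.exp_add, Complex.exp_add, pow_succ]
  push_cast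
  rw [Complex.cos]
  ring

theorem inner_add_inner_eq_zero_of_mem_weightSum {hp : IsCoveringMap p} {U : UnitaryRep G H}
    {l : ℝ} {B : H →L[ℂ] H} {Y X : so n}
    (h : ∀ j k : ℤ, ∀ v ∈ weightSpace hp U Y (l + j), ∀ w ∈ weightSpace hp U Y (l + k),
      inner ℂ (B (lieAct hp U X v)) (w : H) + inner ℂ (B v) (lieAct hp U X w : H) = 0)
    {v w : smoothCore hp U} (hv : v ∈ weightSum hp U Y l) (hw : w ∈ weightSum hp U Y l) :
    inner ℂ (B (lieAct hp U X v)) (w : H) + inner ℂ (B v) (lieAct hp U X w : H) = 0 := by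
  induction hv using Submodule.iSup_induction' with
  | mem j v hv =>
    induction hw using Submodule.iSup_induction' with
    | mem k w hw => exact h j k v hv w hw
    | zero => simp
    | add w u _ _ hw hu =>
      simp only [map_add, Submodule.coe_add, inner_add_right]
      linear_combination hw + hu
  | zero => simp
  | add v u _ _ hv hu =>
    simp only [map_add, Submodule.coe_add, inner_add_left]
    linear_combination hv + hu

variable [IsTopologicalGroup G]

theorem IsWeightClass.periodic {hp : IsCoveringMap p} {U : UnitaryRep G H} {X : so n} {l : ℝ}
    (h : IsWeightClass hp U X l) (v : H) : Function.Periodic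
      (fun t : ℝ => Complex.exp (-(Complex.I * l * t)) • U.op (oneParam hp X t) v)
      (2 * Real.pi) := by
  intro t
  dsimp only
  rw [oneParam_add, U.op_mul, h, map_smul, smul_smul, ← Complex.exp_add]
  congr 2
  push_cast
  ring

theorem IsWeightClass.op_orbitAverage {hp : IsCoveringMap p} {U : UnitaryRep G H} {X : so n}
    {l : ℝ} (h : IsWeightClass hp U X l) (v : H) (s : ℝ) :
    U.op (oneParam hp X s) (orbitAverage hp U X (cosWeight l 0) v) =
      Complex.exp (Complex.I * l * s) • orbitAverage hp U X (cosWeight l 0) v := by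
  set f : ℝ → H := fun t => Complex.exp (-(Complex.I * l * t)) • U.op (oneParam hp X t) v with hf
  have hav : orbitAverage hp U X (cosWeight l 0) v = ∫ t in (-Real.pi)..Real.pi, f t := by
    simp only [orbitAverage, cosWeight, hf, pow_zero, Complex.ofReal_one, mul_one]
  have hcont : Continuous f :=
    Continuous.smul (by fun_prop) (U.continuous_op_oneParam hp X v)
  have hop : U.op (oneParam hp X s) (∫ t in (-Real.pi)..Real.pi, f t) =
      ∫ t in (-Real.pi)..Real.pi, Complex.exp (Complex.I * l * s) • f (t + s) := by
    rw [← ContinuousLinearMap.intervalIntegral_comp_comm _ (hcont.intervalIntegrable _ _)]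
    refine intervalIntegral.integral_congr fun t _ => ?_
    simp only [hf]
    rw [map_smul, ← U.op_mul, ← oneParam_add, smul_smul, ← Complex.exp_add, add_comm s t]
    congr 2
    push_cast
    ring
  have hshift : ∫ t in (-Real.pi)..Real.pi, f (t + s) = ∫ t in (-Real.pi)..Real.pi, f t := by
    have hper := (h.periodic v).intervalIntegral_add_eq (-Real.pi + s) (-Real.pi)
    rw [intervalIntegral.integral_comp_add_right]
    rwa [show -Real.pi + s + 2 * Real.pi = Real.pi + s by ring,
      show -Real.pi + 2 * Real.pi = Real.pi by ring] at hper
  rw [hav, hop, intervalIntegral.integral_smul, hshift]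

theorem op_oneParam_of_eigenvector (hp : IsCoveringMap p) (U : UnitaryRep G H) {X : so n} {v : H}
    {l : ℂ} (h : HasDerivAt (fun t : ℝ => U.op (oneParam hp X t) v) (l • v) 0) (t : ℝ) :
    U.op (oneParam hp X t) v = Complex.exp (l * t) • v := by
  have hderiv (t : ℝ) : HasDerivAt
      (fun t : ℝ => Complex.exp (-l * t) • U.op (oneParam hp X t) v) 0 t := by
    refine ((hasDerivAt_cexp_const_mul_ofReal (-l) t).smul
      (hasDerivAt_op_oneParam hp U h t)).congr_deriv ?_
    rw [map_smul, smul_smul, ← add_smul]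
    simp
  have hconst := is_const_of_deriv_eq_zero (fun t => (hderiv t).differentiableAt)
    (fun t => (hderiv t).deriv) t 0
  simp only [Complex.ofReal_zero, mul_zero, Complex.exp_zero, one_smul, oneParam_zero,
    U.op_one] at hconst
  conv_rhs => rw [← hconst]
  rw [smul_smul, ← Complex.exp_add]
  simp

theorem IsWeightClass.orbitAverage_cosWeight_zero_mem {hp : IsCoveringMap p}
    {U : UnitaryRep G H} {X : so n} {l : ℝ} (h : IsWeightClass hp U X l) (v : smoothCore hp U) :
    orbitAverage hp U X (cosWeight l 0) (v : H) ∈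
      (weightSpace hp U X l).map (smoothCore hp U).subtype :=
  ⟨⟨_, orbitAverage_mem_smoothCore hp U X (continuous_cosWeight l 0) v.2⟩,
    mem_weightSpace_of_op_eq hp U (h.op_orbitAverage (v : H)), rfl⟩

theorem IsWeightClass.orbitAverage_cosWeight_mem {hp : IsCoveringMap p} {U : UnitaryRep G H}
    {X : so n} {l : ℝ} (h : IsWeightClass hp U X l) (k : ℕ) (j : ℤ) (v : smoothCore hp U) :
    orbitAverage hp U X (cosWeight (l + j) k) (v : H) ∈
      (weightSum hp U X l).map (smoothCore hp U).subtype := by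
  induction k generalizing j with
  | zero =>
    exact Submodule.map_mono (le_iSup (fun j : ℤ => weightSpace hp U X (l + j)) j)
      ((h.add_intCast j).orbitAverage_cosWeight_zero_mem v)
  | succ k ih =>
    have hup := ih (j + 1)
    have hdown := ih (j - 1)
    push_cast at hup hdown
    rw [← add_assoc] at hup
    rw [← add_sub_assoc] at hdown
    have hcont (μ : ℝ) (r : ℂ) : Continuous (r • cosWeight μ k) :=
      (continuous_cosWeight μ k).const_smul r
    rw [cosWeight_succ, orbitAverage_add hp U X (hcont _ _) ((hcont _ _).add (hcont _ _)),
      orbitAverage_add hp U X (hcont _ _) (hcont _ _)]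
    simp only [orbitAverage_smul]
    exact add_mem (Submodule.smul_mem _ _ (ih j))
      (add_mem (Submodule.smul_mem _ _ hup) (Submodule.smul_mem _ _ hdown))

theorem IsWeightClass.exists_tendsto_weightSum {hp : IsCoveringMap p} {U : UnitaryRep G H}
    {Y : so n} {l : ℝ} (h : IsWeightClass hp U Y l) (v : smoothCore hp U) :
    ∃ u : ℕ → smoothCore hp U, (∀ k, u k ∈ weightSum hp U Y l) ∧
      Tendsto (fun k => (u k : H)) atTop (𝓝 v) ∧
      ∀ X, Tendsto (fun k => (lieAct hp U X (u k) : H)) atTop (𝓝 (lieAct hp U X v)) := by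
  refine ⟨_, fun k => ?_, tendsto_orbitAverage_peakWeight hp U Y l v,
    fun X => tendsto_lieAct_orbitAverage_peakWeight hp U Y X l v⟩
  have hmem : orbitAverage hp U Y (peakWeight l k) (v : H) ∈
      (weightSum hp U Y l).map (smoothCore hp U).subtype := by
    rw [peakWeight, orbitAverage_smul]
    exact Submodule.smul_mem _ _ (by simpa using h.orbitAverage_cosWeight_mem k 0 v)
  obtain ⟨w, hw, hwv⟩ := hmem
  rwa [← show w = ⟨orbitAverage hp U Y (peakWeight l k) v, _⟩ from Subtype.ext hwv]

theorem IsWeightClass.exists_mem_weightSpace_inner_ne_zero {hp : IsCoveringMap p}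
    {U : UnitaryRep G H} {X : so n} {l : ℝ} (h : IsWeightClass hp U X l) {v : H} (hv0 : v ≠ 0)
    (hv : HasDerivAt (fun t : ℝ => U.op (oneParam hp X t) v) ((Complex.I * l) • v) 0) :
    ∃ w ∈ weightSpace hp U X l, inner ℂ v (w : H) ≠ 0 := by
  by_contra! hort
  have hsum {w : smoothCore hp U} (hw : w ∈ weightSum hp U X l) : inner ℂ v (w : H) = 0 := by
    induction hw using Submodule.iSup_induction' with
    | mem j w hw =>
      obtain rfl | hj := eq_or_ne j 0
      · exact hort w (by simpa using hw)
      · refine inner_eq_zero_of_mem_weightSpace hp U ?_ hv hw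
        simpa using hj
    | zero => simp
    | add w u _ _ hw hu => simp [hw, hu]
  refine hv0 ((dense_smoothCore hp U).eq_zero_of_inner_left (𝕜 := ℂ) fun u hu => ?_)
  obtain ⟨a, ha, hau, -⟩ := h.exists_tendsto_weightSum ⟨u, hu⟩
  exact tendsto_nhds_unique (tendsto_const_nhds.inner (𝕜 := ℂ) hau)
    (tendsto_const_nhds.congr fun k => (hsum (ha k)).symm)

theorem IsWeightClass.mem_commutant {hp : IsCoveringMap p} {U : UnitaryRep G H} {l : ℝ}
    {Y : so n} (hl : IsWeightClass hp U Y l) {B : H →L[ℂ] H} {X : so n}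
    (h : ∀ j k : ℤ, ∀ v ∈ weightSpace hp U Y (l + j), ∀ w ∈ weightSpace hp U Y (l + k),
      inner ℂ (B (lieAct hp U X v)) (w : H) + inner ℂ (B v) (lieAct hp U X w : H) = 0) :
    X ∈ commutant hp U (B.toLinearMap.domRestrict (smoothCore hp U)) := by
  intro v w
  obtain ⟨a, ha, hav, haX⟩ := hl.exists_tendsto_weightSum v
  obtain ⟨b, hb, hbw, hbX⟩ := hl.exists_tendsto_weightSum w
  have hlim := (((B.continuous.tendsto _).comp (haX X)).inner (𝕜 := ℂ) hbw).add
    (((B.continuous.tendsto _).comp hav).inner (𝕜 := ℂ) (hbX X))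
  refine tendsto_nhds_unique hlim (tendsto_const_nhds.congr fun k => ?_)
  exact (inner_add_inner_eq_zero_of_mem_weightSum h (ha k) (hb k)).symm

end Fourier

/-! ### The weights of a massless representation -/

section Spectrum

theorem eq_zero_of_sum_isoVec_smul {n : ℕ} {E : Type*} [AddCommGroup E] [Module ℂ E]
    {x : Fin (n + 2) → E}
    (h : ∀ k : ℕ, 0 < k → 2 * k < n + 2 → ∀ σ : ℂ, σ = 1 ∨ σ = -1 → ∑ a, isoVec n k σ a • x a = 0)
    {b : Fin (n + 2)} (hb : 2 ≤ (b : ℕ)) : x b = 0 := by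
  have hk : 0 < (b : ℕ) / 2 := by omega
  have hk' : 2 * ((b : ℕ) / 2) < n + 2 := by omega
  have hplus := h _ hk hk' 1 (Or.inl rfl)
  have hminus := h _ hk hk' (-1) (Or.inr rfl)
  obtain hpar | hpar := Nat.mod_two_eq_zero_or_one b
  · have hsum : ∑ a, (isoVec n (b / 2) 1 a • x a + isoVec n (b / 2) (-1) a • x a) =
        (2 : ℂ) • x b := by
      rw [Finset.sum_eq_single_of_mem b (Finset.mem_univ b) fun a _ hab => ?_]
      · rw [isoVec, isoVec, if_pos (by omega), if_pos (by omega)]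
        module
      · have ha : (a : ℕ) ≠ 2 * ((b : ℕ) / 2) := fun ha => hab (Fin.ext (by omega))
        rw [isoVec, isoVec, if_neg ha, if_neg ha]
        split_ifs <;> module
    rw [Finset.sum_add_distrib, hplus, hminus, add_zero] at hsum
    exact (smul_eq_zero.1 hsum.symm).resolve_left two_ne_zero
  · have hsum : ∑ a, (isoVec n (b / 2) 1 a • x a - isoVec n (b / 2) (-1) a • x a) =
        (2 * Complex.I) • x b := by
      rw [Finset.sum_eq_single_of_mem b (Finset.mem_univ b) fun a _ hab => ?_]
      · have heven : (b : ℕ) ≠ 2 * ((b : ℕ) / 2) := by omega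
        have hodd : (b : ℕ) = 2 * ((b : ℕ) / 2) + 1 := by omega
        rw [isoVec, isoVec, if_neg heven, if_neg heven, if_pos hodd, if_pos hodd]
        module
      · have ha : (a : ℕ) ≠ 2 * ((b : ℕ) / 2) + 1 := fun ha => hab (Fin.ext (by omega))
        rw [isoVec, isoVec, if_neg ha, if_neg ha, sub_self]
    rw [Finset.sum_sub_distrib, hplus, hminus, sub_zero] at hsum
    exact (smul_eq_zero.1 hsum.symm).resolve_left (mul_ne_zero two_ne_zero Complex.I_ne_zero)

variable {n : ℕ} {G : Type*} [Group G] [TopologicalSpace G] {p : G →* SO0 n}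
  {H : Type*} [NormedAddCommGroup H] [InnerProductSpace ℂ H] [CompleteSpace H]

theorem IsHighestWeightVector.raise_eq_zero {hp : IsCoveringMap p} {U : UnitaryRep G H} {v : H}
    (hv : IsHighestWeightVector hp U v) (i : Fin n) :
    deriv (fun t : ℝ => U.op (oneParam hp (M 0 i.succ.succ) t) v) 0 +
      Complex.I • deriv (fun t : ℝ => U.op (oneParam hp (M 1 i.succ.succ) t) v) 0 = 0 := by
  refine eq_zero_of_sum_isoVec_smul (b := i.succ.succ)
    (x := fun b => deriv (fun t : ℝ => U.op (oneParam hp (M 0 b) t) v) 0 +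
      Complex.I • deriv (fun t : ℝ => U.op (oneParam hp (M 1 b) t) v) 0)
    (fun k hk hk' σ hσ => ?_) (by simp)
  have hann := hv.annihilated 0 k hk hk' σ hσ
  have h₀ : isoVec n 0 1 0 = 1 := by simp [isoVec]
  have h₁ : isoVec n 0 1 1 = Complex.I := by simp [isoVec]
  have h₂ (c : Fin n) : isoVec n 0 1 c.succ.succ = 0 := by simp [isoVec]
  rw [wedgeAct, Fin.sum_univ_succ (n := n + 1), Fin.sum_univ_succ (n := n)] at hann
  simp only [Fin.succ_zero_eq_one, h₀, h₁, h₂, zero_mul, zero_smul, Finset.sum_const_zero,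
    add_zero, one_mul, ← Finset.sum_add_distrib] at hann
  rw [← hann]
  refine Finset.sum_congr rfl fun a _ => ?_
  module

theorem IsHighestWeightVector.exists_weight {hp : IsCoveringMap p} {U : UnitaryRep G H} {v : H}
    (hv : IsHighestWeightVector hp U v) :
    ∃ l : ℝ, HasDerivAt (fun t : ℝ => U.op (oneParam hp (M 0 1) t) v) ((Complex.I * l) • v) 0 := by
  obtain ⟨c, hc⟩ := hv.weight 0 (by omega)
  have hderiv : HasDerivAt (fun t : ℝ => U.op (oneParam hp (M 0 1) t) v) (c • v) 0 :=
    hc ▸ hasDerivAt_of_mem_smoothVectors hp U hv.smooth (M 0 1)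
  have hskew := inner_add_inner_eq_zero_of_hasDerivAt hp U hderiv hderiv
  rw [inner_smul_left, inner_smul_right, ← add_mul] at hskew
  have hre := congrArg Complex.re
    ((mul_eq_zero.1 hskew).resolve_right (inner_self_ne_zero.2 hv.ne_zero))
  have hcI : c = Complex.I * c.im := by
    apply Complex.ext <;> simp at hre ⊢
    linarith
  exact ⟨c.im, hcI ▸ hderiv⟩

theorem IsHighestWeightVector.inner_ladder {hp : IsCoveringMap p} {U : UnitaryRep G H} {v : H}
    (hv : IsHighestWeightVector hp U v) (i : Fin n) (u : smoothCore hp U) :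
    inner ℂ v (ladder hp U (-1) i u : H) = 0 := by
  have hskew (X : so n) := inner_add_inner_eq_zero_of_hasDerivAt hp U
    (hasDerivAt_of_mem_smoothVectors hp U hv.smooth X) (hasDerivAt_lieAct hp U X u)
  have hraise := congrArg (fun x => inner ℂ x (u : H)) (hv.raise_eq_zero i)
  simp only [inner_add_left, inner_smul_left, Complex.conj_I, inner_zero_left] at hraise
  simp only [ladder, LinearMap.add_apply, LinearMap.smul_apply, Submodule.coe_add,
    Submodule.coe_smul, inner_add_right, inner_smul_right, Complex.ofReal_neg, Complex.ofReal_one]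
  linear_combination hskew (M 0 i.succ.succ) - Complex.I * hskew (M 1 i.succ.succ) - hraise

/-- `l` is the top weight of the compact generator `M_{-1,0}`: a weight whose class contains all
the weights, with the normalization of the quadratic relations which makes the raising operators
vanish on the weight space of `l`. -/
structure IsTopWeight (hp : IsCoveringMap p) (U : UnitaryRep G H) (l : ℝ) : Prop where
  isWeightClass : IsWeightClass hp U (M 0 1) l
  quadTensor_zero : quadTensor hp U 0 0 = ((l ^ 2 + n * l / 2 : ℝ) : ℂ) • 1
  quadTensor_one : quadTensor hp U 1 1 = ((l ^ 2 + n * l / 2 : ℝ) : ℂ) • 1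
  nonpos : l ≤ 0
  exists_ne_zero : ∃ w ∈ weightSpace hp U (M 0 1) l, w ≠ 0

variable [IsTopologicalGroup G]

theorem isWeightClass_of_hasDerivAt (hp : IsCoveringMap p) (U : UnitaryRep G H)
    {𝔥 : Submodule ℝ (so n)} (hU : U.IsIrreducibleOn (analyticSubgroup hp 𝔥)) {X : so n}
    (hX : expSO X (2 * Real.pi) = 1) {v : H} (hv : v ≠ 0) {l : ℝ}
    (hl : HasDerivAt (fun t : ℝ => U.op (oneParam hp X t) v) ((Complex.I * l) • v) 0) :
    IsWeightClass hp U X l := by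
  set g := oneParam hp X (2 * Real.pi) with hg
  have hcentral : analyticSubgroup hp 𝔥 ≤ Subgroup.centralizer {g} := by
    rw [analyticSubgroup, Subgroup.closure_le]
    rintro _ ⟨Y, -, t, rfl⟩
    exact Subgroup.mem_centralizer_singleton_iff.2
      (commute_oneParam_of_map_eq_one hp (by rw [hg, p_oneParam, hX]) Y t).eq.symm
  obtain ⟨z, hz⟩ := schur U hU (B := U.op g) fun h hh w => by
    rw [← U.op_mul, ← U.op_mul, Subgroup.mem_centralizer_singleton_iff.1 (hcentral hh)]
  have hzl := hz v
  rw [hg, op_oneParam_of_eigenvector hp U hl] at hzl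
  rw [← smul_left_injective ℂ hv hzl] at hz
  exact hz

theorem two_mul_eq_of_inner_ladder_eq_zero (hp : IsCoveringMap p) (U : UnitaryRep G H) {c : ℂ}
    (hc₀ : quadTensor hp U 0 0 = c • 1) (hc₁ : quadTensor hp U 1 1 = c • 1) {v : H}
    (hv : ∀ i (u : smoothCore hp U), inner ℂ v (ladder hp U (-1) i u : H) = 0) {l : ℝ}
    {w : smoothCore hp U} (hw : w ∈ weightSpace hp U (M 0 1) l) (hvw : inner ℂ v (w : H) ≠ 0) :
    2 * c = 2 * l ^ 2 + n * l := by
  have hsum := congrArg (fun x : smoothCore hp U => inner ℂ v (x : H))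
    (sum_ladder_ladder_apply hp U hc₀ hc₁ (one_mul (1 : ℝ)) hw)
  simp only [Submodule.coe_sum, inner_sum, hv, Finset.sum_const_zero, Submodule.coe_smul,
    inner_smul_right] at hsum
  have hcoef := (mul_eq_zero.1 hsum.symm).resolve_right hvw
  push_cast at hcoef
  linear_combination hcoef

theorem weight_nonpos (hn : 0 < n) (hp : IsCoveringMap p) (U : UnitaryRep G H) {l : ℝ}
    (hc₀ : quadTensor hp U 0 0 = ((l ^ 2 + n * l / 2 : ℝ) : ℂ) • 1)
    (hc₁ : quadTensor hp U 1 1 = ((l ^ 2 + n * l / 2 : ℝ) : ℂ) • 1)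
    {w : smoothCore hp U} (hw : w ∈ weightSpace hp U (M 0 1) l) (hw0 : w ≠ 0) : l ≤ 0 := by
  have hsum := sum_norm_ladder_sq hp U hc₀ hc₁ (σ := -1) (by norm_num) hw
  have hnonneg : 0 ≤ -(2 * n * l) * ‖(w : H)‖ ^ 2 :=
    calc 0 ≤ ∑ i, ‖(ladder hp U (-1) i w : H)‖ ^ 2 := Finset.sum_nonneg fun i _ => sq_nonneg _
      _ = -(2 * n * l) * ‖(w : H)‖ ^ 2 := by rw [hsum]; ring
  have hwH : (w : H) ≠ 0 := fun h => hw0 (Subtype.ext h)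
  have hcoef : 0 ≤ -(2 * n * l) := nonneg_of_mul_nonneg_left hnonneg (by positivity)
  have hn' : (0 : ℝ) < n := by exact_mod_cast hn
  nlinarith

theorem exists_isTopWeight (hn : 2 ≤ n) {hp : IsCoveringMap p} {U : UnitaryRep G H}
    (hU : U.IsIrreducibleOn (analyticSubgroup hp (poincareAlg n)))
    {v : H} (hv : IsHighestWeightVector hp U v) : ∃ l, IsTopWeight hp U l := by
  obtain ⟨c, hc₀, hc₁⟩ := exists_quadTensor_eq_smul_one hn hp U hU
  obtain ⟨l, hl⟩ := hv.exists_weight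
  have hclass := isWeightClass_of_hasDerivAt hp U hU expSO_two_pi hv.ne_zero hl
  obtain ⟨w, hw, hvw⟩ := hclass.exists_mem_weightSpace_inner_ne_zero hv.ne_zero hl
  have hw0 : w ≠ 0 := fun h => hvw (by simp [h])
  have hc : c = ((l ^ 2 + n * l / 2 : ℝ) : ℂ) := by
    push_cast
    linear_combination two_mul_eq_of_inner_ladder_eq_zero hp U hc₀ hc₁ hv.inner_ladder hw hvw / 2
  rw [hc] at hc₀ hc₁
  exact ⟨l, hclass, hc₀, hc₁, weight_nonpos (by omega) hp U hc₀ hc₁ hw hw0, w, hw, hw0⟩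

theorem IsTopWeight.ladder_eq_zero {hp : IsCoveringMap p} {U : UnitaryRep G H} {l : ℝ}
    (h : IsTopWeight hp U l) (i : Fin n) {v : smoothCore hp U}
    (hv : v ∈ weightSpace hp U (M 0 1) l) : ladder hp U 1 i v = 0 := by
  have hsum : ∑ i, ‖(ladder hp U 1 i v : H)‖ ^ 2 = 0 := by
    rw [sum_norm_ladder_sq hp U h.quadTensor_zero h.quadTensor_one (one_mul (1 : ℝ)) hv]
    ring
  have hi := (Finset.sum_eq_zero_iff_of_nonneg fun i _ => sq_nonneg _).1 hsum i (Finset.mem_univ i)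
  exact Subtype.ext (norm_eq_zero.1 (sq_eq_zero_iff.1 hi))

theorem IsTopWeight.ladder_neg_eq_zero {hp : IsCoveringMap p} {U : UnitaryRep G H} {l : ℝ}
    (h : IsTopWeight hp U l) (i : Fin n) {v : smoothCore hp U}
    (hv : v ∈ weightSpace hp U (M 0 1) (l + 1)) : ladder hp U (-1) i v = 0 := by
  have hmem := ladder_mem_weightSpace hp U (σ := -1) (by norm_num) i hv
  rw [add_neg_cancel_right] at hmem
  have hinner := inner_ladder_left hp U (-1) i v (ladder hp U (-1) i v)
  rw [neg_neg, h.ladder_eq_zero i hmem, Submodule.coe_zero, inner_zero_right, neg_zero] at hinner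
  exact Subtype.ext (inner_self_eq_zero.1 hinner)

end Spectrum

/-! ### The projection onto the weights below the top weight -/

section NonposProj

variable {n : ℕ} {G : Type*} [Group G] [TopologicalSpace G] {p : G →* SO0 n}
  {H : Type*} [NormedAddCommGroup H] [InnerProductSpace ℂ H] [CompleteSpace H]

/-- The orthogonal projection onto the closed span of the weight spaces of `X` with weights
`l + k`, `k ≤ 0` an integer. -/
def nonposProj (hp : IsCoveringMap p) (U : UnitaryRep G H) (X : so n) (l : ℝ) : H →L[ℂ] H :=
  (⨆ k : {k : ℤ // k ≤ 0}, (weightSpace hp U X (l + (k : ℤ))).map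
    (smoothCore hp U).subtype).topologicalClosure.starProjection

theorem nonposProj_apply_of_nonpos (hp : IsCoveringMap p) (U : UnitaryRep G H) {X : so n} {l : ℝ}
    {k : ℤ} (hk : k ≤ 0) {v : smoothCore hp U} (hv : v ∈ weightSpace hp U X (l + k)) :
    nonposProj hp U X l v = v :=
  Submodule.starProjection_eq_self_iff.2 (Submodule.le_topologicalClosure _
    (Submodule.mem_iSup_of_mem (⟨k, hk⟩ : {k : ℤ // k ≤ 0}) ⟨v, hv, rfl⟩))

theorem nonposProj_apply_of_pos (hp : IsCoveringMap p) (U : UnitaryRep G H) {X : so n} {l : ℝ}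
    {k : ℤ} (hk : 0 < k) {v : smoothCore hp U} (hv : v ∈ weightSpace hp U X (l + k)) :
    nonposProj hp U X l v = 0 := by
  rw [nonposProj, Submodule.starProjection_apply_eq_zero_iff, Submodule.orthogonal_closure,
    Submodule.mem_orthogonal]
  intro u hu
  induction hu using Submodule.iSup_induction' with
  | mem j u hu =>
    obtain ⟨u, hu, rfl⟩ := hu
    have hjk : l + ((j : ℤ) : ℝ) ≠ l + k := fun h => by
      have hjk : (j : ℤ) = k := by exact_mod_cast add_left_cancel h
      exact hk.not_ge (hjk ▸ j.2)
    refine inner_eq_zero_of_mem_weightSpace hp U hjk ?_ hv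
    have hu' := hasDerivAt_lieAct hp U X u
    rwa [(mem_weightSpace_iff hp U).1 hu] at hu'
  | zero => exact inner_zero_left _
  | add u w _ _ hu hw => rw [inner_add_left, hu, hw, add_zero]

variable [IsTopologicalGroup G]

theorem IsWeightClass.mem_commutant_nonposProj {hp : IsCoveringMap p} {U : UnitaryRep G H}
    {X Y : so n} {l : ℝ} (h : IsWeightClass hp U Y l)
    (hnonpos : ∀ k : ℤ, k ≤ 0 → ∀ v ∈ weightSpace hp U Y (l + k),
      nonposProj hp U Y l (lieAct hp U X v) = lieAct hp U X v)
    (hpos : ∀ k : ℤ, 0 < k → ∀ v ∈ weightSpace hp U Y (l + k),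
      nonposProj hp U Y l (lieAct hp U X v) = 0) :
    X ∈ commutant hp U ((nonposProj hp U Y l).toLinearMap.domRestrict (smoothCore hp U)) := by
  refine h.mem_commutant fun j k v hv w _ => ?_
  obtain hj | hj := le_or_gt j 0
  · rw [hnonpos j hj v hv, nonposProj_apply_of_nonpos hp U hj hv, inner_lieAct_left,
      neg_add_cancel]
  · rw [hpos j hj v hv, nonposProj_apply_of_pos hp U hj hv, inner_zero_left, inner_zero_left,
      add_zero]

theorem IsWeightClass.self_mem_commutant_nonposProj {hp : IsCoveringMap p} {U : UnitaryRep G H}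
    {Y : so n} {l : ℝ} (h : IsWeightClass hp U Y l) :
    Y ∈ commutant hp U ((nonposProj hp U Y l).toLinearMap.domRestrict (smoothCore hp U)) := by
  refine h.mem_commutant_nonposProj (fun k hk v hv => ?_) (fun k hk v hv => ?_)
  · rw [(mem_weightSpace_iff hp U).1 hv, Submodule.coe_smul, map_smul,
      nonposProj_apply_of_nonpos hp U hk hv]
  · rw [(mem_weightSpace_iff hp U).1 hv, Submodule.coe_smul, map_smul,
      nonposProj_apply_of_pos hp U hk hv, smul_zero]

theorem IsTopWeight.mem_commutant_nonposProj {hp : IsCoveringMap p} {U : UnitaryRep G H} {l : ℝ}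
    (h : IsTopWeight hp U l) (i : Fin n) : M 0 i.succ.succ ∈
      commutant hp U ((nonposProj hp U (M 0 1) l).toLinearMap.domRestrict (smoothCore hp U)) := by
  have hexp (v : smoothCore hp U) : (lieAct hp U (M 0 i.succ.succ) v : H) =
      (1 / 2 : ℂ) • ((ladder hp U 1 i v : H) + ladder hp U (-1) i v) := by
    rw [lieAct_zero_eq_ladder]
    rfl
  have hup {k : ℤ} {v : smoothCore hp U} (hv : v ∈ weightSpace hp U (M 0 1) (l + k)) :
      ladder hp U 1 i v ∈ weightSpace hp U (M 0 1) (l + (k + 1 : ℤ)) := by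
    simpa [add_assoc] using ladder_mem_weightSpace hp U (one_mul (1 : ℝ)) i hv
  have hdown {k : ℤ} {v : smoothCore hp U} (hv : v ∈ weightSpace hp U (M 0 1) (l + k)) :
      ladder hp U (-1) i v ∈ weightSpace hp U (M 0 1) (l + (k - 1 : ℤ)) := by
    simpa [add_assoc, sub_eq_add_neg] using
      ladder_mem_weightSpace hp U (σ := -1) (by norm_num) i hv
  refine h.isWeightClass.mem_commutant_nonposProj (fun k hk v hv => ?_) (fun k hk v hv => ?_)
  · have hstay : nonposProj hp U (M 0 1) l (ladder hp U 1 i v) = ladder hp U 1 i v := by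
      obtain rfl | hk0 := eq_or_ne k 0
      · rw [h.ladder_eq_zero i (by simpa using hv), Submodule.coe_zero, map_zero]
      · exact nonposProj_apply_of_nonpos hp U (by omega) (hup hv)
    rw [hexp, map_smul, map_add, hstay, nonposProj_apply_of_nonpos hp U (by omega) (hdown hv)]
  · have hstay : nonposProj hp U (M 0 1) l (ladder hp U (-1) i v) = 0 := by
      obtain rfl | hk1 := eq_or_ne k 1
      · rw [h.ladder_neg_eq_zero i (by simpa using hv), Submodule.coe_zero, map_zero]
      · exact nonposProj_apply_of_pos hp U (by omega) (hdown hv)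
    rw [hexp, map_smul, map_add, hstay, nonposProj_apply_of_pos hp U (by omega) (hup hv),
      add_zero, smul_zero]

theorem IsTopWeight.commutant_nonposProj {hp : IsCoveringMap p} {U : UnitaryRep G H} {l : ℝ}
    (h : IsTopWeight hp U l) : commutant hp U
      ((nonposProj hp U (M 0 1) l).toLinearMap.domRestrict (smoothCore hp U)) = ⊤ :=
  commutant_eq_top hp U <| Fin.cases (by rw [M_self]; exact Submodule.zero_mem _) <|
    Fin.cases h.isWeightClass.self_mem_commutant_nonposProj h.mem_commutant_nonposProj

theorem IsTopWeight.eq_zero_of_pos {hp : IsCoveringMap p} {U : UnitaryRep G H} {l : ℝ}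
    (h : IsTopWeight hp U l) {𝔥 : Submodule ℝ (so n)}
    (hU : U.IsIrreducibleOn (analyticSubgroup hp 𝔥)) {k : ℤ} (hk : 0 < k) {v : smoothCore hp U}
    (hv : v ∈ weightSpace hp U (M 0 1) (l + k)) : v = 0 := by
  obtain ⟨z, hz⟩ := exists_smul_of_le_commutant hp U hU (h.commutant_nonposProj ▸ le_top)
  obtain ⟨w, hw, hw0⟩ := h.exists_ne_zero
  have hw0' : (w : H) ≠ 0 := fun h => hw0 (Subtype.ext h)
  have hzw : z • (w : H) = (1 : ℂ) • (w : H) := by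
    rw [← hz, one_smul, nonposProj_apply_of_nonpos hp U le_rfl (by simpa using hw)]
  have hzv := nonposProj_apply_of_pos hp U hk hv
  rw [hz, smul_left_injective ℂ hw0' hzw, one_smul] at hzv
  exact Subtype.ext hzv

end NonposProj

/-! ### Irreducibility on the Lorentz group -/

section Lorentz

variable {n : ℕ} {G : Type*} [Group G] [TopologicalSpace G] {p : G →* SO0 n}
  {H : Type*} [NormedAddCommGroup H] [InnerProductSpace ℂ H] [CompleteSpace H]

theorem inner_lieAct_sq_comm (hp : IsCoveringMap p) (U : UnitaryRep G H) {c : ℝ}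
    (hc : quadTensor hp U 1 1 = (c : ℂ) • 1) {O : smoothCore hp U →ₗ[ℂ] H}
    (hO : ∀ i : Fin n, M 1 i.succ.succ ∈ commutant hp U O) (v w : smoothCore hp U) :
    inner ℂ (O (lieAct hp U (M 0 1) (lieAct hp U (M 0 1) v))) (w : H) =
      inner ℂ (O v) (lieAct hp U (M 0 1) (lieAct hp U (M 0 1) w) : H) := by
  have hsq (v : smoothCore hp U) : lieAct hp U (M 0 1) (lieAct hp U (M 0 1) v) =
      ∑ i : Fin n, lieAct hp U (M 1 i.succ.succ) (lieAct hp U (M 1 i.succ.succ) v) -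
        (c : ℂ) • v := by
    have hsum := LinearMap.congr_fun (sum_sq_lieAct_one hp U hc) v
    simp only [LinearMap.sum_apply, Module.End.mul_apply, LinearMap.add_apply,
      LinearMap.smul_apply, Module.End.one_apply] at hsum
    rw [hsum, add_sub_cancel_left]
  have hi (i : Fin n) (v w : smoothCore hp U) :
      inner ℂ (O (lieAct hp U (M 1 i.succ.succ) (lieAct hp U (M 1 i.succ.succ) v))) (w : H) =
        inner ℂ (O v) (lieAct hp U (M 1 i.succ.succ) (lieAct hp U (M 1 i.succ.succ) w) : H) := by
    linear_combination hO i (lieAct hp U (M 1 i.succ.succ) v) w -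
      hO i v (lieAct hp U (M 1 i.succ.succ) w)
  rw [hsq, hsq]
  simp only [Submodule.coe_sub, Submodule.coe_sum, Submodule.coe_smul, map_sub, map_sum, map_smul,
    inner_sub_left, inner_sub_right, sum_inner, inner_sum, inner_smul_left, inner_smul_right,
    Complex.conj_ofReal, hi]

variable [IsTopologicalGroup G]

theorem IsTopWeight.mem_commutant_of_inner_sq_comm {hp : IsCoveringMap p} {U : UnitaryRep G H}
    {l : ℝ} (h : IsTopWeight hp U l) {𝔥 : Submodule ℝ (so n)}
    (hU : U.IsIrreducibleOn (analyticSubgroup hp 𝔥)) {B : H →L[ℂ] H}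
    (hB : ∀ v w : smoothCore hp U,
      inner ℂ (B (lieAct hp U (M 0 1) (lieAct hp U (M 0 1) v))) (w : H) =
        inner ℂ (B v) (lieAct hp U (M 0 1) (lieAct hp U (M 0 1) w) : H)) :
    M 0 1 ∈ commutant hp U (B.toLinearMap.domRestrict (smoothCore hp U)) := by
  -- As no weight is positive, the weights are determined by their squares.
  have hnonpos {j : ℤ} {v : smoothCore hp U} (hv : v ∈ weightSpace hp U (M 0 1) (l + j))
      (hv0 : v ≠ 0) : l + j ≤ 0 :=
    add_nonpos h.nonpos (by exact_mod_cast not_lt.1 fun hj => hv0 (h.eq_zero_of_pos hU hj hv))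
  refine h.isWeightClass.mem_commutant fun j k v hv w hw => ?_
  obtain rfl | hv0 := eq_or_ne v 0
  · simp
  obtain rfl | hw0 := eq_or_ne w 0
  · simp
  have hμ := hnonpos hv hv0
  have hν := hnonpos hw hw0
  set μ : ℝ := l + j
  set ν : ℝ := l + k
  rw [mem_weightSpace_iff] at hv hw
  have hsq := hB v w
  simp only [hv, hw, map_smul, Submodule.coe_smul, inner_smul_left, inner_smul_right, map_mul,
    Complex.conj_I, Complex.conj_ofReal] at hsq ⊢
  have hdiff : ((μ ^ 2 - ν ^ 2 : ℝ) : ℂ) * inner ℂ (B v) (w : H) = 0 := by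
    push_cast
    linear_combination -hsq + (μ ^ 2 - ν ^ 2 : ℂ) * inner ℂ (B v) (w : H) * Complex.I_mul_I
  obtain hμν | hzero := mul_eq_zero.1 hdiff
  · have hμν' : (-μ) ^ 2 = (-ν) ^ 2 := by linarith [Complex.ofReal_eq_zero.1 hμν]
    rw [neg_injective ((sq_eq_sq₀ (neg_nonneg.2 hμ) (neg_nonneg.2 hν)).1 hμν')]
    ring
  · rw [hzero, mul_zero, mul_zero, add_zero]

theorem commutant_eq_top_of_lorentzAlg_le (hp : IsCoveringMap p) (U : UnitaryRep G H)
    {O : smoothCore hp U →ₗ[ℂ] H} (h : M 0 1 ∈ commutant hp U O)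
    (hO : lorentzAlg n ≤ commutant hp U O) : commutant hp U O = ⊤ := by
  refine commutant_eq_top hp U <| Fin.cases (by rw [M_self]; exact Submodule.zero_mem _) <|
    Fin.cases h fun i => ?_
  have hi : M 1 i.succ.succ ∈ commutant hp U O :=
    hO (Submodule.subset_span ⟨0, i.succ, by rw [Fin.succ_zero_eq_one]⟩)
  have hlie := lie_mem_commutant hp U h hi
  rwa [M_bracket, eta_ne (show (0 : Fin (n + 2)) ≠ i.succ.succ by simp [Fin.ext_iff]),
    eta_ne (show (1 : Fin (n + 2)) ≠ i.succ.succ by simp [Fin.ext_iff]),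
    eta_ne (show (0 : Fin (n + 2)) ≠ 1 by simp), eta_self, metric_one, zero_smul, zero_smul,
    zero_smul, one_smul, zero_add, sub_zero, sub_zero] at hlie

theorem IsTopWeight.exists_smul_of_lorentzAlg_le_commutant {hp : IsCoveringMap p}
    {U : UnitaryRep G H} {l : ℝ} (h : IsTopWeight hp U l) {𝔥 : Submodule ℝ (so n)}
    (hU : U.IsIrreducibleOn (analyticSubgroup hp 𝔥)) {B : H →L[ℂ] H}
    (hB : lorentzAlg n ≤ commutant hp U (B.toLinearMap.domRestrict (smoothCore hp U))) :
    ∃ z : ℂ, ∀ v, B v = z • v := by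
  have hsq := inner_lieAct_sq_comm hp U h.quadTensor_one fun i =>
    hB (Submodule.subset_span ⟨0, i.succ, by rw [Fin.succ_zero_eq_one]⟩)
  have htop := commutant_eq_top_of_lorentzAlg_le hp U (h.mem_commutant_of_inner_sq_comm hU hsq) hB
  exact exists_smul_of_le_commutant hp U hU (htop ▸ le_top)

theorem isIrreducibleOn_lorentzCover (hn : 2 ≤ n) {hp : IsCoveringMap p} {U : UnitaryRep G H}
    (hU : U.IsIrreducibleOn (analyticSubgroup hp (poincareAlg n))) {v : H}
    (hv : IsHighestWeightVector hp U v) : U.IsIrreducibleOn (LorentzCover hp) := by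
  have := hU.1
  obtain ⟨l, hl⟩ := exists_isTopWeight hn hU hv
  exact isIrreducibleOn_of_forall_exists_smul U fun B hB =>
    hl.exists_smul_of_lorentzAlg_le_commutant hU fun X hX =>
      mem_commutant_of_op_comm hp U fun t v => hB _ (oneParam_mem hp hX t) v

end Lorentz

/-! ### Scalar contraction families -/

section LinearPMap

theorem exists_mem_graph_iff_of_isClosed_of_domain_eq_top {𝕜 E F : Type*}
    [NontriviallyNormedField 𝕜] [NormedAddCommGroup E] [NormedSpace 𝕜 E] [CompleteSpace E]
    [NormedAddCommGroup F] [NormedSpace 𝕜 F] [CompleteSpace F] {A : E →ₗ.[𝕜] F} (hA : A.IsClosed)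
    (hdom : A.domain = ⊤) : ∃ B : E →L[𝕜] F, ∀ v w, (v, w) ∈ A.graph ↔ w = B v := by
  have hmem (v : E) : v ∈ A.domain := hdom ▸ Submodule.mem_top
  let f : E →ₗ[𝕜] F := A.toFun ∘ₗ LinearMap.codRestrict A.domain LinearMap.id hmem
  have hf (v w) : (v, w) ∈ A.graph ↔ w = f v := by
    rw [LinearPMap.mem_graph_iff]
    constructor
    · rintro ⟨x, rfl, hx⟩
      exact hx.symm
    · exact fun h => ⟨⟨v, hmem v⟩, rfl, h.symm⟩
  have hgraph : f.graph = A.graph := by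
    ext ⟨v, w⟩
    rw [hf, LinearMap.mem_graph_iff]
  have hclosed : IsClosed (f.graph : Set (E × F)) := hgraph ▸ hA
  exact ⟨⟨f, f.continuous_of_isClosed_graph hclosed⟩, hf⟩

variable {H : Type*} [NormedAddCommGroup H] [InnerProductSpace ℂ H]

theorem conjGraph_eq_graph_of_smul {Z : H →ₗ.[ℂ] H} {z : ℂ} (hz0 : z ≠ 0)
    (hz : ∀ v w, (v, w) ∈ Z.graph ↔ w = z • v) (A : H →ₗ.[ℂ] H) :
    conjGraph Z A = (A.graph : Set (H × H)) := by
  ext ⟨v, w⟩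
  simp only [conjGraph, Set.mem_ofPred_eq, SetLike.mem_coe, hz]
  constructor
  · rintro ⟨_, _, rfl, hA, rfl⟩
    simpa only [Prod.smul_mk, inv_smul_smul₀ hz0] using A.graph.smul_mem z⁻¹ hA
  · exact fun hA => ⟨z • v, z • w, rfl, A.graph.smul_mem z hA, rfl⟩

end LinearPMap

section ContractionFamily

variable {n : ℕ} {G : Type*} [Group G] [TopologicalSpace G] {p : G →* SO0 n}
  {H : Type*} [NormedAddCommGroup H] [InnerProductSpace ℂ H] [CompleteSpace H]

theorem mem_graph_dU_iff (hp : IsCoveringMap p) (U : UnitaryRep G H) (X : so n) (v w : H) :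
    (v, w) ∈ (dU hp U X).graph ↔ HasDerivAt (fun t : ℝ => U.op (oneParam hp X t) v) w 0 := by
  rw [LinearPMap.mem_graph_iff]
  constructor
  · rintro ⟨x, rfl, hx : deriv _ 0 = w⟩
    exact hx ▸ DifferentiableAt.hasDerivAt x.2
  · exact fun h => ⟨⟨v, h.differentiableAt⟩, rfl, h.deriv⟩

variable {hp : IsCoveringMap p} {U : UnitaryRep G H} {Z : ℝ → H →ₗ.[ℂ] H} {ρ : ℝ}

theorem IsContractionFamily.domain_eq_top (hZ : IsContractionFamily hp U Z)
    (hρ : ρ ∈ Set.Ioc (0 : ℝ) 1) : (Z ρ).domain = ⊤ := by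
  -- `U(M_{0,0}) = U(0)` is defined everywhere, and commutes with `Z_ρ` domain included.
  refine Submodule.eq_top_iff'.2 fun v => ?_
  have h : (v, (0 : H)) ∈ ((dU hp U (M (Fin.succ 0) (Fin.succ 0))).graph : Set (H × H)) := by
    rw [SetLike.mem_coe, mem_graph_dU_iff, M_self]
    simp only [oneParam_zero_left]
    exact hasDerivAt_const _ _
  rw [← hZ.commutes ρ hρ 0 0] at h
  obtain ⟨_, _, hv, -, -⟩ := h
  exact LinearPMap.mem_domain_of_mem_graph hv

theorem IsContractionFamily.lorentzAlg_le_commutant (hZ : IsContractionFamily hp U Z)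
    (hρ : ρ ∈ Set.Ioc (0 : ℝ) 1) {B : H →L[ℂ] H} (hB : ∀ v w, (v, w) ∈ (Z ρ).graph ↔ w = B v) :
    lorentzAlg n ≤ commutant hp U (B.toLinearMap.domRestrict (smoothCore hp U)) := by
  refine Submodule.span_le.2 ?_
  rintro _ ⟨α, β, rfl⟩ v w
  have h : ((v : H), (lieAct hp U (M α.succ β.succ) v : H)) ∈
      ((dU hp U (M α.succ β.succ)).graph : Set (H × H)) :=
    (mem_graph_dU_iff hp U _ _ _).2 (hasDerivAt_lieAct hp U _ v)
  rw [← hZ.commutes ρ hρ α β] at h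
  obtain ⟨x, y, hvx, hxy, hvy⟩ := h
  rw [hB] at hvx hvy
  rw [mem_graph_dU_iff, hvx, hvy] at hxy
  exact inner_add_inner_eq_zero_of_hasDerivAt hp U hxy (hasDerivAt_lieAct hp U _ w)

variable [IsTopologicalGroup G]

theorem IsContractionFamily.exists_smul (hU : U.IsIrreducibleOn (LorentzCover hp))
    (hZ : IsContractionFamily hp U Z) (hρ : ρ ∈ Set.Ioc (0 : ℝ) 1) :
    ∃ z : ℂ, z ≠ 0 ∧ ∀ v w, (v, w) ∈ (Z ρ).graph ↔ w = z • v := by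
  obtain ⟨B, hB⟩ := exists_mem_graph_iff_of_isClosed_of_domain_eq_top (hZ.closed ρ hρ)
    (hZ.domain_eq_top hρ)
  obtain ⟨z, hz⟩ := exists_smul_of_le_commutant hp U hU (hZ.lorentzAlg_le_commutant hρ hB)
  simp only [hz] at hB
  refine ⟨z, ?_, hB⟩
  rintro rfl
  have := hU.1
  obtain ⟨v, hv⟩ := exists_ne (0 : H)
  obtain ⟨x, rfl, hx⟩ := (LinearPMap.mem_graph_iff _).1 ((hB v 0).2 (zero_smul ℂ v).symm)
  exact hv (congrArg Subtype.val (hZ.injective ρ hρ (hx.trans (LinearPMap.map_zero _).symm)))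

theorem IsContractionFamily.mem_Uρ_iff (hU : U.IsIrreducibleOn (LorentzCover hp))
    (hZ : IsContractionFamily hp U Z) (hρ : ρ ∈ Set.Ioc (0 : ℝ) 1) (X : so n) (v w : H) :
    (v, w) ∈ Uρ hp U Z ρ X ↔
      HasDerivAt (fun t : ℝ => U.op (oneParam hp (S ρ X) t) v) w 0 := by
  obtain ⟨z, hz0, hz⟩ := hZ.exists_smul hU hρ
  rw [Uρ, conjGraph_eq_graph_of_smul hz0 hz, SetLike.mem_coe, mem_graph_dU_iff]

theorem IsContractionFamily.tendsToAt_iff (hU : U.IsIrreducibleOn (LorentzCover hp))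
    (hZ : IsContractionFamily hp U Z) {X : so n} {v : H} {u : ℝ → H}
    (hu : ∀ ρ, HasDerivAt (fun t : ℝ => U.op (oneParam hp (S ρ X) t) v) (u ρ) 0) (w : H) :
    TendsToAt hp U Z X v w ↔ Tendsto u (𝓝[>] 0) (𝓝 w) := by
  refine ⟨fun ⟨u', hu', hlim⟩ => hlim.congr' ?_,
    fun hlim => ⟨u, fun ρ hρ => (hZ.mem_Uρ_iff hU hρ _ _ _).2 (hu ρ), hlim⟩⟩
  filter_upwards [Ioc_mem_nhdsGT (one_pos (α := ℝ))] with ρ hρ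
  exact ((hZ.mem_Uρ_iff hU hρ _ _ _).1 (hu' ρ hρ)).unique (hu ρ)

theorem IsContractionFamily.tendsToAt_iff_of_mem_lorentzAlg
    (hU : U.IsIrreducibleOn (LorentzCover hp)) (hZ : IsContractionFamily hp U Z) {X : so n}
    (hX : X ∈ lorentzAlg n) {v : H} (hv : v ∈ smoothVectors hp U) (w : H) :
    TendsToAt hp U Z X v w ↔ HasDerivAt (fun t : ℝ => U.op (oneParam hp X t) v) w 0 := by
  have hderiv := hasDerivAt_of_mem_smoothVectors hp U hv X
  rw [hZ.tendsToAt_iff hU (fun ρ => by rw [S_of_mem_lorentzAlg ρ hX]; exact hderiv),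
    tendsto_const_nhds_iff]
  exact ⟨fun h => h ▸ hderiv, fun h => hderiv.unique h⟩

theorem IsContractionFamily.tendsToAt_translGen_iff (hU : U.IsIrreducibleOn (LorentzCover hp))
    (hZ : IsContractionFamily hp U Z) {v : H} (hv : v ∈ smoothVectors hp U)
    (a : Fin (n + 1) → ℝ) (w : H) : TendsToAt hp U Z (translGen a) v w ↔ w = 0 := by
  set d := deriv (fun t : ℝ => U.op (oneParam hp (translGen a) t) v) 0
  have hderiv (ρ : ℝ) : HasDerivAt (fun t : ℝ => U.op (oneParam hp (S ρ (translGen a)) t) v)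
      (Real.sqrt ρ • d) 0 := by
    simp only [S_translGen, oneParam_smul]
    have hd : HasDerivAt (fun t => U.op (oneParam hp (translGen a) t) v) d (Real.sqrt ρ * 0) := by
      rw [mul_zero]
      exact hasDerivAt_of_mem_smoothVectors hp U hv (translGen a)
    exact hd.scomp (0 : ℝ) (by simpa using (hasDerivAt_id (0 : ℝ)).const_mul (Real.sqrt ρ))
  have hlim : Tendsto (fun ρ : ℝ => Real.sqrt ρ • d) (𝓝[>] 0) (𝓝 0) := by
    have hcont : Continuous fun ρ : ℝ => Real.sqrt ρ • d := by fun_prop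
    simpa using (hcont.tendsto 0).mono_left nhdsWithin_le_nhds
  rw [hZ.tendsToAt_iff hU hderiv]
  exact ⟨fun h => tendsto_nhds_unique h hlim, fun h => h ▸ hlim⟩

end ContractionFamily

/-! ### The contracted representation -/

section Representation

variable {G : Type*} [Group G] [TopologicalSpace G]
  {H : Type*} [NormedAddCommGroup H] [InnerProductSpace ℂ H] [CompleteSpace H]

theorem UnitaryRep.ext_op {V W : UnitaryRep G H} (h : ∀ g, V.op g = W.op g) : V = W := by
  obtain ⟨f, hf⟩ := V
  obtain ⟨g, hg⟩ := W
  congr 1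
  ext k : 2
  exact h k

theorem UnitaryRep.hasDerivAt_op_inv_op (W : UnitaryRep G H) {δ : ℝ → G} {f : ℝ → H} {v : H}
    {t : ℝ} (hft : f t = W.op (δ t) v) (h : HasDerivAt (fun s => f s - W.op (δ s) v) 0 t) :
    HasDerivAt (fun s => W.op (δ s)⁻¹ (f s)) 0 t := by
  have hnorm (s : ℝ) : ‖f s - W.op (δ s) v‖ = ‖W.op (δ s)⁻¹ (f s) - v‖ := by
    rw [← W.norm_op (δ s)⁻¹, map_sub, W.op_inv_op]
  rw [hasDerivAt_iff_isLittleO] at h ⊢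
  refine Asymptotics.IsLittleO.of_norm_left ?_
  simpa only [hft, W.op_inv_op, sub_self, smul_zero, sub_zero, hnorm] using h.norm_left

theorem UnitaryRep.op_eq_op_of_hasDerivAt {K : Type*} [Group K] [TopologicalSpace K]
    (V : UnitaryRep G H) (W : UnitaryRep K H) {γ : ℝ → G} {δ : ℝ → K}
    (hγ : ∀ s t, γ (s + t) = γ s * γ t) (hδ : ∀ s t, δ (s + t) = δ s * δ t) {D : Set H}
    (hD : Dense D) (hinv : ∀ t, ∀ v ∈ D, V.op (γ t) v ∈ D)
    (h : ∀ v ∈ D, HasDerivAt (fun s => V.op (γ s) v - W.op (δ s) v) 0 0) (t : ℝ) :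
    V.op (γ t) = W.op (δ t) := by
  have hγ0 : γ 0 = 1 := by simpa using hγ 0 0
  have hδ0 : δ 0 = 1 := by simpa using hδ 0 0
  refine DFunLike.coe_injective (Continuous.ext_on hD (V.op _).continuous (W.op _).continuous
    fun v hv => ?_)
  have hconst := eq_of_hasDerivAt_zero_shift (f := fun t => W.op (δ t)⁻¹ (V.op (γ t) v))
    (fun t => by
      have hu := W.hasDerivAt_op_inv_op (by simp only [hγ0, hδ0, V.op_one, W.op_one])
        (h _ (hinv t v hv))
      have hshift := ((W.op (δ t)⁻¹).restrictScalars ℝ).hasFDerivAt.comp_hasDerivAt (0 : ℝ) hu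
      rw [map_zero] at hshift
      simpa only [Function.comp_def, ContinuousLinearMap.coe_restrictScalars', hγ, hδ, V.op_mul,
        W.op_mul, mul_inv_rev] using hshift) t
  simp only [hγ0, hδ0, inv_one, V.op_one, W.op_one] at hconst
  rw [← W.op_op_inv (δ t) (V.op (γ t) v), hconst]

end Representation

section Contraction

variable {n : ℕ} {G : Type*} [Group G] [TopologicalSpace G] {p : G →* SO0 n}
  {H : Type*} [NormedAddCommGroup H] [InnerProductSpace ℂ H] [CompleteSpace H]

/-- The representation `(a, g) ↦ U(g)` of the covering of the Poincaré group, trivial on the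
translations. -/
def trivialExtension (hp : IsCoveringMap p) (U : UnitaryRep G H) :
    UnitaryRep (PoincareCover hp) H where
  toHom := U.toHom.comp ((LorentzCover hp).subtype.comp SemidirectProduct.rightHom)
  continuous_orbit v := by
    have hright : Continuous fun x : PoincareCover hp => x.right :=
      continuous_snd.comp (continuous_induced_dom
        (f := fun x : PoincareCover hp => (Multiplicative.toAdd x.left, x.right)))
    exact (U.continuous_op v).comp (continuous_subtype_val.comp hright)

theorem trivialExtension_op (hp : IsCoveringMap p) (U : UnitaryRep G H) (x : PoincareCover hp) :
    (trivialExtension hp U).op x = U.op x.right := rfl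

theorem transl_add (hp : IsCoveringMap p) (a b : Fin (n + 1) → ℝ) :
    transl hp (a + b) = transl hp a * transl hp b := by
  rw [transl, ofAdd_add, map_mul]
  rfl

theorem lorentzIncl_mul (hp : IsCoveringMap p) (g h : LorentzCover hp) :
    lorentzIncl hp (g * h) = lorentzIncl hp g * lorentzIncl hp h :=
  map_mul SemidirectProduct.inr g h

theorem transl_left_mul_lorentzIncl_right (hp : IsCoveringMap p) (x : PoincareCover hp) :
    transl hp (Multiplicative.toAdd x.left) * lorentzIncl hp x.right = x :=
  SemidirectProduct.inl_left_mul_inr_right x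

variable [IsTopologicalGroup G] {hp : IsCoveringMap p} {U : UnitaryRep G H}
  {Z : ℝ → H →ₗ.[ℂ] H} {W : UnitaryRep (PoincareCover hp) H}

theorem isContraction_trivialExtension (hU : U.IsIrreducibleOn (LorentzCover hp))
    (hZ : IsContractionFamily hp U Z) : IsContraction hp U Z (trivialExtension hp U) where
  lorentz v hv X hX :=
    have h := hasDerivAt_of_mem_smoothVectors hp U hv X
    ⟨_, (hZ.tendsToAt_iff_of_mem_lorentzAlg hU hX hv _).2 h, h⟩
  translation v hv a := by
    refine ⟨0, (hZ.tendsToAt_translGen_iff hU hv a 0).2 rfl, ?_⟩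
    simp only [trivialExtension_op, transl, SemidirectProduct.right_inl, OneMemClass.coe_one,
      U.op_one]
    exact hasDerivAt_const _ _

theorem IsContraction.op_transl (hU : U.IsIrreducibleOn (LorentzCover hp))
    (hZ : IsContractionFamily hp U Z) (hW : IsContraction hp U Z W) (a : Fin (n + 1) → ℝ) :
    W.op (transl hp a) = 1 := by
  have h := W.op_eq_op_of_hasDerivAt W (γ := fun _ => 1) (δ := fun t => transl hp (t • a))
    (fun _ _ => (one_mul 1).symm) (fun s t => by rw [add_smul, transl_add])
    (dense_smoothVectors hp U) (fun _ v hv => by rwa [W.op_one]) (fun v hv => by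
      obtain ⟨w, hw, hderiv⟩ := hW.translation v hv a
      rw [(hZ.tendsToAt_translGen_iff hU hv a w).1 hw] at hderiv
      simpa using hderiv.const_sub (W.op 1 v)) 1
  rw [one_smul] at h
  exact h.symm.trans (ContinuousLinearMap.ext W.op_one)

theorem IsContraction.op_lorentzIncl_oneParam (hU : U.IsIrreducibleOn (LorentzCover hp))
    (hZ : IsContractionFamily hp U Z) (hW : IsContraction hp U Z W) {X : so n}
    (hX : X ∈ lorentzAlg n) (t : ℝ) :
    W.op (lorentzIncl hp ⟨oneParam hp X t, oneParam_mem hp hX t⟩) = U.op (oneParam hp X t) := by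
  refine (U.op_eq_op_of_hasDerivAt W (γ := oneParam hp X)
    (δ := fun t => lorentzIncl hp ⟨oneParam hp X t, oneParam_mem hp hX t⟩) (oneParam_add hp X)
    (fun s t => ?_) (dense_smoothVectors hp U) (fun t v hv => op_mem_smoothVectors hp U _ hv)
    (fun v hv => ?_) t).symm
  · rw [← lorentzIncl_mul]
    exact congrArg (lorentzIncl hp) (Subtype.ext (oneParam_add hp X s t))
  · obtain ⟨w, hw, hderiv⟩ := hW.lorentz v hv X hX
    simpa only [sub_self] using
      ((hZ.tendsToAt_iff_of_mem_lorentzAlg hU hX hv w).1 hw).fun_sub hderiv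

theorem IsContraction.op_lorentzIncl (hU : U.IsIrreducibleOn (LorentzCover hp))
    (hZ : IsContractionFamily hp U Z) (hW : IsContraction hp U Z W) (g : LorentzCover hp) :
    W.op (lorentzIncl hp g) = U.op g := by
  have hhom : W.toHom.comp SemidirectProduct.inr = U.toHom.comp (LorentzCover hp).subtype := by
    refine MonoidHom.eq_of_eqOn_dense Subgroup.closure_closure_coe_preimage ?_
    rintro ⟨_, _⟩ ⟨X, hX, t, rfl⟩
    exact Subtype.ext (hW.op_lorentzIncl_oneParam hU hZ hX t)
  exact congrArg Subtype.val (DFunLike.congr_fun hhom g)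

theorem IsContraction.eq_trivialExtension (hU : U.IsIrreducibleOn (LorentzCover hp))
    (hZ : IsContractionFamily hp U Z) (hW : IsContraction hp U Z W) :
    W = trivialExtension hp U := by
  refine UnitaryRep.ext_op fun x => ContinuousLinearMap.ext fun v => ?_
  calc W.op x v
      = W.op (transl hp (Multiplicative.toAdd x.left)) (W.op (lorentzIncl hp x.right) v) := by
        rw [← W.op_mul, transl_left_mul_lorentzIncl_right]
    _ = (trivialExtension hp U).op x v := by
        rw [hW.op_transl hU hZ, hW.op_lorentzIncl hU hZ]
        rfl

end Contraction

end ConfMassless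

end

theorem mainTheorem4_general (n : ℕ)
    {G : Type*} [Group G] [TopologicalSpace G] [IsTopologicalGroup G]
    (p : G →* SO0 n) (hp : IsCoveringMap p)
    {H : Type*} [NormedAddCommGroup H] [InnerProductSpace ℂ H] [CompleteSpace H]
    (U : UnitaryRep G H) (hU : U.IsIrreducibleOn (LorentzCover hp))
    (Z : ℝ → H →ₗ.[ℂ] H) (hZ : IsContractionFamily hp U Z) :
    (∀ ρ : ℝ, 0 < ρ → ∀ a b c : Fin (n + 1) → ℝ,
      -bracketρ ρ (bracketρ ρ (translGen a) (translGen b)) (translGen c) =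
        (ρ • translGen (minkowski b c • a - minkowski a c • b) : so n)) ∧
    (∀ X Y : so n,
      Tendsto (fun ρ : ℝ => linPart (bracketρ ρ X Y)) (𝓝[>] 0)
        (𝓝 (linPart X * linPart Y - linPart Y * linPart X)) ∧
      Tendsto (fun ρ : ℝ => transPart (bracketρ ρ X Y)) (𝓝[>] 0)
        (𝓝 (linPart X *ᵥ transPart Y - linPart Y *ᵥ transPart X))) ∧
    Dense (smoothVectors hp U : Set H) ∧
    (∀ v ∈ smoothVectors hp U, ∀ a : Fin (n + 1) → ℝ, TendsToAt hp U Z (translGen a) v 0) ∧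
    (∃! W : UnitaryRep (PoincareCover hp) H, IsContraction hp U Z W) ∧
    (∀ W : UnitaryRep (PoincareCover hp) H, IsContraction hp U Z W →
      ∀ a : Fin (n + 1) → ℝ, W.op (transl hp a) = 1) :=
  ⟨fun _ hρ a b c => curvature_bracketρ hρ a b c,
    fun X Y => ⟨tendsto_linPart_bracketρ X Y, tendsto_transPart_bracketρ X Y⟩,
    dense_smoothVectors hp U,
    fun _ hv a => (hZ.tendsToAt_translGen_iff hU hv a 0).2 rfl,
    ⟨trivialExtension hp U, isContraction_trivialExtension hU hZ,
      fun _ hW => hW.eq_trivialExtension hU hZ⟩,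
    fun _ hW a => hW.op_transl hU hZ a⟩

theorem mainTheorem4 (n : ℕ) (hn : 2 ≤ n)
    {G : Type*} [Group G] [TopologicalSpace G] [IsTopologicalGroup G] [SimplyConnectedSpace G]
    (p : G →* SO0 n) (hp : IsCoveringMap p)
    {H : Type*} [NormedAddCommGroup H] [InnerProductSpace ℂ H] [CompleteSpace H]
    (U : UnitaryRep G H) (hU : IsCnMassless hp U)
    (Z : ℝ → H →ₗ.[ℂ] H) (hZ : IsContractionFamily hp U Z) :
    -- `ρ` is the curvature of the homogeneous space `S_{n+1} / L_{n+1}` of `𝒢_n^ρ`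
    (∀ ρ : ℝ, 0 < ρ → ∀ a b c : Fin (n + 1) → ℝ,
      -bracketρ ρ (bracketρ ρ (translGen a) (translGen b)) (translGen c) =
        (ρ • translGen (minkowski b c • a - minkowski a c • b) : so n)) ∧
    -- as `ρ → 0` the bracket of `𝒢_n^ρ` tends to that of the Poincaré algebra `𝒫_{n+1}`
    (∀ X Y : so n,
      Tendsto (fun ρ : ℝ => linPart (bracketρ ρ X Y)) (𝓝[>] 0)
        (𝓝 (linPart X * linPart Y - linPart Y * linPart X)) ∧
      Tendsto (fun ρ : ℝ => transPart (bracketρ ρ X Y)) (𝓝[>] 0)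
        (𝓝 (linPart X *ᵥ transPart Y - linPart Y *ᵥ transPart X))) ∧
    -- as `ρ → 0` the operators `U_ρ(∑ a_α M_{-1,α})` tend to zero on a dense subspace
    Dense (smoothVectors hp U : Set H) ∧
    (∀ v ∈ smoothVectors hp U, ∀ a : Fin (n + 1) → ℝ, TendsToAt hp U Z (translGen a) v 0) ∧
    -- the contracted representation exists, is unique, and is trivial on the translations
    (∃! W : UnitaryRep (PoincareCover hp) H, IsContraction hp U Z W) ∧
    (∀ W : UnitaryRep (PoincareCover hp) H, IsContraction hp U Z W →
      ∀ a : Fin (n + 1) → ℝ, W.op (transl hp a) = 1) := by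
  obtain ⟨v, hv, -⟩ := hU.highestWeight
  exact mainTheorem4_general n p hp U (isIrreducibleOn_lorentzCover hn hU.irreducible_poincare hv) Z
    hZ
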